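/- **Setting.** Let $\Omega$ be a nonempty open subset of $\mathbb P^{n}=\mathbb P(\mathbb R^{n+1})$. It is *properly convex* if its closure lies in an affine chart in which $\Omega$ is convex. It is then *strictly convex* if $\partial\Omega$ contains no nontrivial segment, and $d_\Omega(x,y)=\frac12\ln\frac{|py|\,|qx|}{|px|\,|qy|}$ is its Hilbert distance, where the line $(xy)$ meets $\partial\Omega$ in $p,q$, in the order $p,x,y,q$ (and $d_\Omega(x,x)=0$). $\mathrm{Aut}(\Omega)$ is the group of elements of $\mathrm{SL}_{n+1}(\mathbb R)$ preserving $\Omega$. Let $\Omega$ be properly convex, strictly convex with $C^1$ boundary, and let $\Gamma\subset\mathrm{Aut}(\Omega)$ be a discrete subgroup. Its limit set is $\Lambda_\Gamma=\overline{\Gamma x}\smallsetminus\Gamma x$, for any $x\in\Omega$. A point $x\in\Lambda_\Gamma$ is * *conical* if there are $\gamma_k\in\Gamma$, $x_0,x_1\in\Omega$ and $C>0$ such that $\gamma_k x_0\to x$ and $d_\Omega(\gamma_k x_0,[x_1,x[)\le C$ for all $k$; * *bounded parabolic* if $\mathrm{Stab}_\Gamma(x)$ acts cocompactly on $\Lambda_\Gamma\smallsetminus\{x\}$;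 * *uniformly bounded parabolic* if $\mathrm{Stab}_\Gamma(x)$ acts cocompactly on the closure, in the affine space $\mathbb A_x$ of lines through $x$ that meet $\Omega$, of the set of lines through $x$ that meet the convex hull of $\Lambda_\Gamma\smallsetminus\{x\}$. The action of $\Gamma$ is *geometrically finite on $\partial\Omega$* (resp. *on $\Omega$*) if every point of $\Lambda_\Gamma$ is conical or bounded parabolic (resp. conical or uniformly bounded parabolic). Let $\rho_4:\mathrm{SL}_2(\mathbb R)\to\mathrm{SL}_5(\mathbb R)$ be the representation on the $5$-dimensional space $V_4$ of real binary quartic forms, $\rho_4(g)f=f\circ g^{-1}$. Let $\Omega_0,\Omega_\infty\subset\mathbb P(V_4)=\mathbb P^4$ be the open sets given by the interiors of the cones of convex forms and of nonnegative forms respectively and, for $0<r<\infty$, let $\Omega_r=\{x\in\Omega_\infty : d_{\Omega_\infty}(x,y)<r \text{ for some } y\in\Omega_0\}$ be the $r$-neighbourhood of $\Omega_0$. **Proposition.** There are a properly convex open set $\Omega\subset\mathbb P^4$, strictly convex with $C^1$ boundary, and a discrete subgroup $\Gamma\subset\mathrm{Aut}(\Omega)$, such that the action of $\Gamma$ is geometrically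 finite on $\partial\Omega$ but not geometrically finite on $\Omega$. Moreover $\Omega$ and $\Gamma$ can be chosen so that $\Omega=\Omega_r$ for some real $r>0$, $\Omega$ is invariant under $\rho_4(\mathrm{SL}_2(\mathbb R))$, and $\Gamma=\rho_4(\Gamma_0)$ for a non-cocompact lattice $\Gamma_0$ of $\mathrm{SL}_2(\mathbb R)$. -/

import Mathlib

open scoped LinearAlgebra.Projectivization MatrixGroups Matrix Topology ENNReal

namespace HilbertGeom

/-! ### Projective space -/

/-- The quotient topology on a projective space. -/
instance projTopology (V : Type*) [AddCommGroup V] [Module ℝ V] [TopologicalSpace V] :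
    TopologicalSpace (ℙ ℝ V) :=
  inferInstanceAs (TopologicalSpace (Quotient (projectivizationSetoid ℝ V)))

/-- The projective space of dimension `d - 1` over `ℝ`, that is, `ℙ(ℝ^d)`.
The group `SL(d, ℝ)` acts on it through Mathlib's action on `ℙ ℝ (Fin d → ℝ)`. -/
abbrev Proj (d : ℕ) : Type := ℙ ℝ (Fin d → ℝ)

/-- The affine chart of `ℙ(ℝ^d)` attached to a linear form `f`: the complement of the projective
hyperplane `f = 0`. -/
def chart {d : ℕ} (f : Module.Dual ℝ (Fin d → ℝ)) : Set (Proj d) := {x | f x.rep ≠ 0}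

/-- The identification of the affine chart `chart f` with the affine hyperplane `{f = 1}` of `ℝ^d`:
a point of the chart is sent to its unique representative on which `f` takes the value `1`.
(Outside the chart the value is `0` and is never used.) -/
noncomputable def coord {d : ℕ} (f : Module.Dual ℝ (Fin d → ℝ)) (x : Proj d) : Fin d → ℝ :=
  (f x.rep)⁻¹ • x.rep

/-- Nonempty properly convex open sets: open sets whose closure lies in some affine chart, and which
are convex in that chart. -/
def IsProperlyConvexOpen {d : ℕ} (Ω : Set (Proj d)) : Prop :=
  Ω.Nonempty ∧ IsOpen Ω ∧
    ∃ f : Module.Dual ℝ (Fin d → ℝ), closure Ω ⊆ chart f ∧ Convex ℝ (coord f '' Ω)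

/-- The closed segment from `x` to `y` (two points of `closure Ω`), taken in an affine chart that
contains `closure Ω`. For a properly convex `Ω` it does not depend on the chart, and it is the
segment from `x` to `y` inside `closure Ω`. -/
def seg {d : ℕ} (Ω : Set (Proj d)) (x y : Proj d) : Set (Proj d) :=
  {z | ∃ f : Module.Dual ℝ (Fin d → ℝ), closure Ω ⊆ chart f ∧ z ∈ chart f ∧
    coord f z ∈ segment ℝ (coord f x) (coord f y)}

/-- The convex hull of a subset `A` of `closure Ω`, taken in an affine chart that contains
`closure Ω`. For a properly convex `Ω` it does not depend on the chart. -/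
def hull {d : ℕ} (Ω A : Set (Proj d)) : Set (Proj d) :=
  {z | ∃ f : Module.Dual ℝ (Fin d → ℝ), closure Ω ⊆ chart f ∧ z ∈ chart f ∧
    coord f z ∈ convexHull ℝ (coord f '' A)}

/-- Strict convexity (of a properly convex open set): the boundary contains no nontrivial segment. -/
def IsStrictlyConvex {d : ℕ} (Ω : Set (Proj d)) : Prop :=
  ∀ x ∈ frontier Ω, ∀ y ∈ frontier Ω, x ≠ y → ¬ seg Ω x y ⊆ frontier Ω

/-- The boundary of `Ω` is of class `C¹`: near each boundary point, `Ω` is given in homogeneous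
coordinates by an inequality `φ < 0` where `φ` is of class `C¹`, vanishes at the point, and has
nonzero differential there. -/
def HasC1Boundary {d : ℕ} (Ω : Set (Proj d)) : Prop :=
  ∀ (v : Fin d → ℝ) (hv : v ≠ 0), Projectivization.mk ℝ v hv ∈ frontier Ω →
    ∃ φ : (Fin d → ℝ) → ℝ, ContDiffAt ℝ 1 φ v ∧ φ v = 0 ∧ fderiv ℝ φ v ≠ 0 ∧
      ∀ᶠ w in 𝓝 v, ∀ hw : w ≠ 0, (Projectivization.mk ℝ w hw ∈ Ω ↔ φ w < 0)

/-- `δ` is the Hilbert distance in `Ω` of the two distinct points `x`, `y` of `Ω`: in an affine chart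
containing `closure Ω`, the line through `x` and `y` meets the boundary in `p` and `q`, in the order
`p, x, y, q`, and `δ = (1/2) log ((|py| |qx|) / (|px| |qy|))`. As the four points are on one line,
the ratio does not depend on the norm used to measure the lengths. -/
def IsHilbertDist {d : ℕ} (Ω : Set (Proj d)) (x y : Proj d) (δ : ℝ) : Prop :=
  ∃ f : Module.Dual ℝ (Fin d → ℝ), closure Ω ⊆ chart f ∧
    ∃ p ∈ frontier Ω, ∃ q ∈ frontier Ω,
      coord f x ∈ openSegment ℝ (coord f p) (coord f y) ∧
      coord f y ∈ openSegment ℝ (coord f x) (coord f q) ∧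
      δ = (1 / 2) * Real.log
        ((‖coord f p - coord f y‖ * ‖coord f q - coord f x‖) /
          (‖coord f p - coord f x‖ * ‖coord f q - coord f y‖))

open Classical in
/-- The Hilbert distance of a properly convex open set `Ω`, on points of `Ω`. For `x ≠ y` in `Ω` there
is exactly one `δ` with `IsHilbertDist Ω x y δ`, and the supremum is just this number. -/
noncomputable def hilbertDist {d : ℕ} (Ω : Set (Proj d)) (x y : Proj d) : ℝ :=
  if x = y then 0 else sSup {δ | IsHilbertDist Ω x y δ}

/-! ### Discrete groups of automorphisms and their limit points -/

/-- The group of projective transformations in `SL(d, ℝ)` that preserve `Ω`. -/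
def Aut {d : ℕ} (Ω : Set (Proj d)) : Subgroup SL(d, ℝ) where
  carrier := {g | (fun x => g • x) '' Ω = Ω}
  one_mem' := by simp
  mul_mem' := by
    intro g h hg hh
    have hg' : (fun x => g • x) '' Ω = Ω := hg
    have hh' : (fun x => h • x) '' Ω = Ω := hh
    change (fun x => (g * h) • x) '' Ω = Ω
    calc (fun x => (g * h) • x) '' Ω = (fun x => g • x) '' ((fun x => h • x) '' Ω) := by
          rw [Set.image_image]; simp only [mul_smul]
      _ = Ω := by rw [hh', hg']
  inv_mem' := by
    intro g hg
    have hg' : (fun x => g • x) '' Ω = Ω := hg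
    change (fun x => g⁻¹ • x) '' Ω = Ω
    conv_lhs => rw [← hg']
    rw [Set.image_image]
    simp

/-- The orbit of `x` under `Γ`. -/
def orb {d : ℕ} (Γ : Subgroup SL(d, ℝ)) (x : Proj d) : Set (Proj d) := {y | ∃ γ ∈ Γ, γ • x = y}

/-- The limit set of `Γ`: the set `closure (Γ x) \ Γ x`, where `x` is any point of `Ω` (for a discrete
group of automorphisms of a strictly convex `Ω`, all points `x` of `Ω` give the same set). -/
def limitSet {d : ℕ} (Ω : Set (Proj d)) (Γ : Subgroup SL(d, ℝ)) : Set (Proj d) :=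
  {p | ∃ x ∈ Ω, p ∈ closure (orb Γ x) \ orb Γ x}

/-- `x` is a conical limit point: there are `γₙ` in `Γ`, a point `x₀` of `Ω`, a half-line `[x₁, x[`
and `C > 0` such that `γₙ x₀` tends to `x` and stays at distance at most `C` from the half-line. -/
def IsConical {d : ℕ} (Ω : Set (Proj d)) (Γ : Subgroup SL(d, ℝ)) (x : Proj d) : Prop :=
  ∃ γ : ℕ → SL(d, ℝ), (∀ n, γ n ∈ Γ) ∧ ∃ x₀ ∈ Ω, ∃ x₁ ∈ Ω, ∃ C : ℝ, 0 < C ∧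
    Filter.Tendsto (fun n => γ n • x₀) Filter.atTop (𝓝 x) ∧
    ∀ n, ∃ y ∈ seg Ω x₁ x \ {x}, hilbertDist Ω (γ n • x₀) y ≤ C

/-- `x` is a bounded parabolic point: the stabilizer of `x` in `Γ` acts cocompactly on the limit set
minus `x`. -/
def IsBoundedParabolic {d : ℕ} (Ω : Set (Proj d)) (Γ : Subgroup SL(d, ℝ)) (x : Proj d) : Prop :=
  ∃ K ⊆ limitSet Ω Γ \ {x}, IsCompact K ∧
    ∀ y ∈ limitSet Ω Γ \ {x}, ∃ γ ∈ Γ, γ • x = x ∧ γ • y ∈ K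

/-! ### The pencil of lines through a point -/

/-- The space of projective lines through `p`, that is, `ℙ(ℝ^d / p)`. -/
abbrev Pencil {d : ℕ} (p : Proj d) : Type := ℙ ℝ ((Fin d → ℝ) ⧸ p.submodule)

theorem mkQ_rep_ne_zero {d : ℕ} (p z : Proj d) (h : z ≠ p) : p.submodule.mkQ z.rep ≠ 0 := by
  intro h0
  apply h
  have h1 : z.rep ∈ p.submodule := by simpa using h0
  rw [Projectivization.submodule_eq, Submodule.mem_span_singleton] at h1
  obtain ⟨a, ha⟩ := h1
  rw [← z.mk_rep, ← p.mk_rep, Projectivization.mk_eq_mk_iff']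
  exact ⟨a, ha⟩

/-- The line through `p` and a point `z ≠ p`. -/
noncomputable def line {d : ℕ} (p z : Proj d) (h : z ≠ p) : Pencil p :=
  Projectivization.mk ℝ (p.submodule.mkQ z.rep) (mkQ_rep_ne_zero p z h)

/-- The set of lines through `p` that meet `A` (in a point other than `p`). -/
def lines {d : ℕ} (p : Proj d) (A : Set (Proj d)) : Set (Pencil p) :=
  {l | ∃ z ∈ A, ∃ h : z ≠ p, l = line p z h}

theorem map_submodule_of_fix {d : ℕ} (g : SL(d, ℝ)) (p : Proj d) (hg : g • p = p) :
    p.submodule.map (DistribMulAction.toLinearEquiv ℝ (Fin d → ℝ) g).toLinearMap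
      = p.submodule := by
  conv_rhs => rw [← hg]
  conv_rhs => rw [← p.mk_rep, Projectivization.smul_mk, Projectivization.submodule_mk]
  rw [Projectivization.submodule_eq, Submodule.map_span, Set.image_singleton]
  rfl

/-- The action on the lines through `p` of an element of `SL(d, ℝ)` that fixes `p`. -/
noncomputable def pencilMap {d : ℕ} (g : SL(d, ℝ)) (p : Proj d) (hg : g • p = p) : Pencil p → Pencil p :=
  Projectivization.map
    (Submodule.Quotient.equiv p.submodule p.submodule
      (DistribMulAction.toLinearEquiv ℝ (Fin d → ℝ) g) (map_submodule_of_fix g p hg)).toLinearMap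
    (LinearEquiv.injective _)

/-- The closure, in the space `lines x Ω` of lines through `x` meeting `Ω` (an affine space when the
boundary is of class `C¹` at `x`), of the set of lines through `x` that meet the convex hull of the
limit set minus `x`. -/
def limitLines {d : ℕ} (Ω : Set (Proj d)) (Γ : Subgroup SL(d, ℝ)) (x : Proj d) : Set (Pencil x) :=
  closure (lines x (hull Ω (limitSet Ω Γ \ {x}))) ∩ lines x Ω

/-- `x` is a uniformly bounded parabolic point: the stabilizer of `x` in `Γ` acts cocompactly on
`limitLines Ω Γ x`. -/
def IsUniformlyBoundedParabolic {d : ℕ} (Ω : Set (Proj d)) (Γ : Subgroup SL(d, ℝ)) (x : Proj d) : Prop :=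
  ∃ K ⊆ limitLines Ω Γ x, IsCompact K ∧
    ∀ l ∈ limitLines Ω Γ x, ∃ γ ∈ Γ, ∃ h : γ • x = x, pencilMap γ x h l ∈ K

/-- The action of `Γ` on the boundary of `Ω` is geometrically finite. -/
def GeomFiniteOnBoundary {d : ℕ} (Ω : Set (Proj d)) (Γ : Subgroup SL(d, ℝ)) : Prop :=
  ∀ x ∈ limitSet Ω Γ, IsConical Ω Γ x ∨ IsBoundedParabolic Ω Γ x

/-- The action of `Γ` on `Ω` is geometrically finite. -/
def GeomFinite {d : ℕ} (Ω : Set (Proj d)) (Γ : Subgroup SL(d, ℝ)) : Prop :=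
  ∀ x ∈ limitSet Ω Γ, IsConical Ω Γ x ∨ IsUniformlyBoundedParabolic Ω Γ x

/-! ### Binary quartic forms -/

/-- The binary quartic form with coefficients `v`; this identifies `ℝ⁵` with the space of homogeneous
polynomials of degree `4` in two variables. -/
def quartic (v : Fin 5 → ℝ) (w : Fin 2 → ℝ) : ℝ :=
  ∑ i : Fin 5, v i * w 0 ^ (4 - (i : ℕ)) * w 1 ^ (i : ℕ)

/-- The matrix, on coefficients of binary quartic forms, of the linear substitution
`(X, Y) ↦ (a X + b Y, c X + e Y)`. -/
def substMatrix (a b c e : ℝ) : Matrix (Fin 5) (Fin 5) ℝ :=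
  !![a ^ 4, a ^ 3 * c, a ^ 2 * c ^ 2, a * c ^ 3, c ^ 4;
     4 * a ^ 3 * b, a ^ 3 * e + 3 * a ^ 2 * b * c, 2 * a ^ 2 * c * e + 2 * a * b * c ^ 2,
       3 * a * c ^ 2 * e + b * c ^ 3, 4 * c ^ 3 * e;
     6 * a ^ 2 * b ^ 2, 3 * a ^ 2 * b * e + 3 * a * b ^ 2 * c,
       a ^ 2 * e ^ 2 + 4 * a * b * c * e + b ^ 2 * c ^ 2,
       3 * a * c * e ^ 2 + 3 * b * c ^ 2 * e, 6 * c ^ 2 * e ^ 2;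
     4 * a * b ^ 3, 3 * a * b ^ 2 * e + b ^ 3 * c, 2 * a * b * e ^ 2 + 2 * b ^ 2 * c * e,
       a * e ^ 3 + 3 * b * c * e ^ 2, 4 * c * e ^ 3;
     b ^ 4, b ^ 3 * e, b ^ 2 * e ^ 2, b * e ^ 3, e ^ 4]

theorem substMatrix_mul (a b c e a' b' c' e' : ℝ) :
    substMatrix a b c e * substMatrix a' b' c' e' =
      substMatrix (a' * a + b' * c) (a' * b + b' * e) (c' * a + e' * c) (c' * b + e' * e) := by
  ext i j
  fin_cases i <;> fin_cases j <;>
    simp [substMatrix, Matrix.mul_apply, Fin.sum_univ_five] <;> ring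

theorem substMatrix_one : substMatrix 1 0 0 1 = 1 := by
  ext i j
  fin_cases i <;> fin_cases j <;> simp [substMatrix]

theorem det_substMatrix (a b c e : ℝ) :
    (substMatrix a b c e).det = (a * e - b * c) ^ 10 := by
  simp [substMatrix, Matrix.det_succ_row_zero, Fin.sum_univ_succ, Fin.succAbove]
  ring

/-- The representation `ρ₄` of `SL₂(ℝ)` on binary quartic forms: `(ρ₄ g) f = f ∘ g⁻¹`
(see `quartic_rho`). -/
def rho : SL(2, ℝ) →* SL(5, ℝ) where
  toFun g := ⟨substMatrix (g 1 1) (-g 0 1) (-g 1 0) (g 0 0), by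
    have h := g.det_coe
    rw [Matrix.det_fin_two] at h
    rw [det_substMatrix]
    have : g 1 1 * g 0 0 - -g 0 1 * -g 1 0 = 1 := by linarith
    rw [this, one_pow]⟩
  map_one' := by
    apply Subtype.ext
    simpa using substMatrix_one
  map_mul' g h := by
    apply Subtype.ext
    change substMatrix ((g * h) 1 1) (-(g * h) 0 1) (-(g * h) 1 0) ((g * h) 0 0) =
      substMatrix (g 1 1) (-g 0 1) (-g 1 0) (g 0 0) *
      substMatrix (h 1 1) (-h 0 1) (-h 1 0) (h 0 0)
    rw [substMatrix_mul]
    simp only [Matrix.SpecialLinearGroup.coe_mul, Matrix.mul_apply, Fin.sum_univ_two]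
    congr 1 <;> ring

/-- `ρ₄` is the action on binary quartic forms induced by the action of `SL₂(ℝ)` on `ℝ²`. -/
theorem quartic_rho (g : SL(2, ℝ)) (v : Fin 5 → ℝ) (w : Fin 2 → ℝ) :
    quartic (rho g • v) w = quartic v (g⁻¹ • w) := by
  change quartic (substMatrix (g 1 1) (-g 0 1) (-g 1 0) (g 0 0) *ᵥ v) w = quartic v (g⁻¹.1 *ᵥ w)
  simp [quartic, substMatrix, Matrix.mulVec, dotProduct, Fin.sum_univ_succ,
    Matrix.SpecialLinearGroup.SL2_inv_expl]
  ring

/-- The trace in `ℙ⁴` of a set of vectors of `ℝ⁵`. -/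
def projTrace (S : Set (Fin 5 → ℝ)) : Set (Proj 5) :=
  {x | ∃ v ∈ S, ∃ hv : v ≠ 0, x = Projectivization.mk ℝ v hv}

/-- The open set `Ω₀` of `ℙ⁴` defined by the cone of convex binary quartic forms. -/
def omegaMin : Set (Proj 5) :=
  interior (projTrace {v | ConvexOn ℝ Set.univ (quartic v)})

/-- The open set `Ω_∞` of `ℙ⁴` defined by the cone of nonnegative binary quartic forms. -/
def omegaMax : Set (Proj 5) :=
  interior (projTrace {v | ∀ w, 0 ≤ quartic v w})

/-- The set `Ω_r`: the `r`-neighbourhood of `Ω₀` in `Ω_∞` for the Hilbert distance of `Ω_∞`. -/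
def omega (r : ℝ) : Set (Proj 5) :=
  {x | x ∈ omegaMax ∧ ∃ y ∈ omegaMin, hilbertDist omegaMax x y < r}

/-! ### Lattices of `SL₂(ℝ)` -/

/-- `Γ` is a lattice of `SL₂(ℝ)`: it is discrete, and it has a fundamental domain of finite Haar
measure (for the Borel `σ`-algebra). -/
def IsLatticeSL2 (Γ : Subgroup SL(2, ℝ)) : Prop :=
  DiscreteTopology Γ ∧
    letI : MeasurableSpace SL(2, ℝ) := borel SL(2, ℝ)
    ∃ (μ : MeasureTheory.Measure SL(2, ℝ)) (F : Set SL(2, ℝ)),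
      μ.IsHaarMeasure ∧ MeasureTheory.IsFundamentalDomain Γ F μ ∧ μ F < ∞

/-- `Γ` is cocompact in `SL₂(ℝ)`. -/
def IsCocompactSL2 (Γ : Subgroup SL(2, ℝ)) : Prop := CompactSpace (SL(2, ℝ) ⧸ Γ)

end HilbertGeom

namespace HilbertGeom

open Projectivization Pointwise

/-! ### The topology of projective spaces -/

/-! The plan is to replace $\Omega_r$, for one well chosen $r$, by an explicit linear-algebraic
cone. A quartic form $f$ has a catalecticant, a quadratic form on $\mathbb R^3$; adding $t$ times
the invariant form $4z_0z_2-z_1^2$ gives a pencil $Q_t$ whose members all restrict to $f$ on the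
conic $(x^2,2xy,y^2)$. If $Q_0\ge 0$ then $f$ is convex, and if some $Q_t>0$ then $f$ is positive
definite. `midCone` lies in between: it asks for a $t$ with both $Q_t>0$ and $Q_{t/2}>0$. The
conditions are linear in $(f,t)$, so the cone is convex, and it is $\mathrm{SL}_2(\mathbb
R)$-invariant. Up to $\mathrm{SL}_2(\mathbb R)$ and positive scaling, every positive definite form
is $x^4+6cx^2y^2+y^4$ with $-1/3<c\le 1/3$ (`exists_normalForm`). Such a form lies in `midCone`
exactly when $c>-1/5$. In Birkhoff's expression of the Hilbert distance through the order of the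
cone (`exists_hilbertDist_eq`), the same inequality says that the distance in $\Omega_\infty$ to
$\Omega_0$ is less than $\frac12\ln\frac52$; this is `omega_eq`. The boundary of the cone has only
two orbits up to scaling, those of the form with $c=-1/5$ and of $y^4$ (`boundary_cases`). So strict
convexity and regularity need checking at these two forms only. At each, one supporting linear form
vanishes on a single ray of the closed cone (`midCone_extremal`) and its positive side consists of
directions entering the cone (`exists_isTangentAt`). The boundary is then a graph of a function with
a unique subgradient, hence $C^1$. The group is the image of $\mathrm{SL}_2(\mathbb Z)$. Integrality
makes it act properly on positive definite forms (`finite_modularGroup_of_bounds`), so its limit set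
is the curve of fourth powers $[(aX+bY)^4]$. At a rational point a conjugate of the integral
translations acts cocompactly on the rest of the curve, so the point is bounded parabolic; at an
irrational point Dirichlet's theorem gives orbit points close to a ray, so the point is conical.
Geometric finiteness on $\Omega$ fails at $[X^4]$. The point is not conical, because along a ray to
it the value at $(0,1)$ stays constant while the form stays bounded below, which leaves finitely
many orbit points. It is not uniformly bounded parabolic either: its stabilizer preserves the
function $(8v_2v_4-3v_3^2)/v_4^2$ on the lines through it that meet $\Omega$, and the chords joining
$[(NX+Y)^4]$ to $[(-NX+Y)^4]$ have midpoints where this function equals $48N^2$. The curve has a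
cocompact quotient there, its convex hull has not. -/

theorem isOpen_proj_iff {V : Type*} [AddCommGroup V] [Module ℝ V] [TopologicalSpace V]
    {U : Set (ℙ ℝ V)} : IsOpen U ↔ IsOpen {v : {v : V // v ≠ 0} | Projectivization.mk ℝ v.1 v.2 ∈ U} :=
  Iff.rfl

theorem continuous_proj_mk {V : Type*} [AddCommGroup V] [Module ℝ V] [TopologicalSpace V] :
    Continuous (fun v : {v : V // v ≠ 0} => Projectivization.mk ℝ v.1 v.2) :=
  continuous_def.2 fun _ h => isOpen_proj_iff.1 h

theorem mk_eq_mk_iff_pos {V : Type*} [AddCommGroup V] [Module ℝ V] {v w : V} (hv : v ≠ 0)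
    (hw : w ≠ 0) : Projectivization.mk ℝ v hv = Projectivization.mk ℝ w hw ↔ ∃ c : ℝ, 0 < c ∧ (v = c • w ∨ v = -(c • w)) := by
  rw [mk_eq_mk_iff']
  constructor
  · rintro ⟨a, ha⟩
    rcases lt_trichotomy a 0 with h | h | h
    · exact ⟨-a, by linarith, Or.inr (by rw [← ha]; simp)⟩
    · exact absurd (by rw [← ha, h, zero_smul]) hv
    · exact ⟨a, h, Or.inl ha.symm⟩
  · rintro ⟨c, -, h | h⟩
    · exact ⟨c, h.symm⟩
    · exact ⟨-c, by rw [h, neg_smul]⟩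

theorem mk_neg' {V : Type*} [AddCommGroup V] [Module ℝ V] {v : V} (hv : v ≠ 0) :
    Projectivization.mk ℝ (-v) (neg_ne_zero.2 hv) = Projectivization.mk ℝ v hv :=
  (mk_eq_mk_iff_pos _ _).2 ⟨1, one_pos, Or.inr (by simp)⟩

theorem mk_smul' {V : Type*} [AddCommGroup V] [Module ℝ V] {v : V} (hv : v ≠ 0) {c : ℝ}
    (hc : c ≠ 0) : Projectivization.mk ℝ (c • v) (smul_ne_zero hc hv) = Projectivization.mk ℝ v hv :=
  (mk_eq_mk_iff' _ _ _ _ _).2 ⟨c, rfl⟩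

/-- The set of vectors representing the points of `S`. -/
def coneOver {V : Type*} [AddCommGroup V] [Module ℝ V] (S : Set (ℙ ℝ V)) : Set V :=
  {v | ∃ hv : v ≠ 0, Projectivization.mk ℝ v hv ∈ S}

theorem coneOver_smul {V : Type*} [AddCommGroup V] [Module ℝ V] {S : Set (ℙ ℝ V)} {c : ℝ}
    (hc : c ≠ 0) {v : V} (hv : v ∈ coneOver S) : c • v ∈ coneOver S := by
  obtain ⟨h0, h⟩ := hv
  exact ⟨smul_ne_zero hc h0, by rwa [mk_smul' h0 hc]⟩

/-- The cone over `S` is stable under nonzero scalars, hence so is its closure; the complement of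
that closure therefore descends to an open set of the projective space. -/
theorem mem_closure_proj_iff {V : Type*} [AddCommGroup V] [Module ℝ V] [TopologicalSpace V]
    [ContinuousConstSMul ℝ V] {S : Set (ℙ ℝ V)} {v : V} (hv : v ≠ 0) :
    Projectivization.mk ℝ v hv ∈ closure S ↔ v ∈ closure (coneOver S) := by
  constructor
  · intro h
    by_contra hc
    have key : ∀ (w : V) (hw : w ≠ 0), (Projectivization.mk ℝ w hw).rep ∉ closure (coneOver S) ↔
        w ∉ closure (coneOver S) := by
      have aux : ∀ (c : ℝ), c ≠ 0 → ∀ w, w ∈ closure (coneOver S) →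
          c • w ∈ closure (coneOver S) := fun c hc w hw =>
        map_mem_closure (continuous_const_smul c) hw fun x hx => coneOver_smul hc hx
      intro w hw
      obtain ⟨a, ha⟩ := exists_smul_eq_mk_rep ℝ w hw
      rw [not_iff_not, ← ha]
      constructor
      · intro h
        have := aux _ (inv_ne_zero a.ne_zero) _ h
        rwa [Units.smul_def, smul_smul, inv_mul_cancel₀ a.ne_zero, one_smul] at this
      · exact aux _ a.ne_zero w
    have hU : IsOpen {x : ℙ ℝ V | x.rep ∉ closure (coneOver S)} := by
      rw [isOpen_proj_iff]
      have : IsOpen {w : {w : V // w ≠ 0} | w.1 ∉ closure (coneOver S)} :=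
        isClosed_closure.isOpen_compl.preimage continuous_subtype_val
      convert this using 1
      ext w
      exact key w.1 w.2
    obtain ⟨x, hx1, hx2⟩ := mem_closure_iff.1 h _ hU ((key v hv).2 hc)
    apply hx1
    refine subset_closure ⟨x.rep_nonzero, ?_⟩
    rwa [mk_rep]
  · intro h
    rw [mem_closure_iff]
    intro U hU hvU
    have h1 := isOpen_proj_iff.1 hU
    rw [isOpen_induced_iff] at h1
    obtain ⟨W, hW, hWU⟩ := h1
    have hvW : v ∈ W := by
      have : (⟨v, hv⟩ : {v : V // v ≠ 0}) ∈ Subtype.val ⁻¹' W := by rw [hWU]; exact hvU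
      exact this
    obtain ⟨w, hw, hw0, hwS⟩ := mem_closure_iff.1 h W hW hvW
    refine ⟨Projectivization.mk ℝ w hw0, ?_, hwS⟩
    have : (⟨w, hw0⟩ : {v : V // v ≠ 0}) ∈ Subtype.val ⁻¹' W := hw
    rw [hWU] at this
    exact this

theorem mem_interior_proj_iff {V : Type*} [AddCommGroup V] [Module ℝ V] [TopologicalSpace V]
    [ContinuousConstSMul ℝ V] [T1Space V] {S : Set (ℙ ℝ V)} {v : V} (hv : v ≠ 0) :
    Projectivization.mk ℝ v hv ∈ interior S ↔ v ∈ interior (coneOver S) := by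
  rw [← compl_compl (interior S), Set.mem_compl_iff, ← closure_compl, mem_closure_proj_iff,
    ← compl_compl (interior (coneOver S)), Set.mem_compl_iff (interior (coneOver S))ᶜ,
    ← closure_compl, not_iff_not]
  have h0 : IsOpen {v : V | v ≠ 0} := isOpen_ne
  rw [mem_closure_iff_nhds, mem_closure_iff_nhds]
  constructor
  · intro h t ht
    obtain ⟨w, hw, hw0, hwS⟩ := h t ht
    exact ⟨w, hw, fun ⟨_, h'⟩ => hwS h'⟩
  · intro h t ht
    obtain ⟨w, ⟨hw, hw0⟩, hwS⟩ := h _ (Filter.inter_mem ht (h0.mem_nhds hv))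
    exact ⟨w, hw, hw0, fun h' => hwS ⟨hw0, h'⟩⟩

/-! ### Charts -/

theorem dual_mk_rep {d : ℕ} {v : Fin d → ℝ} (hv : v ≠ 0) :
    ∃ a : ℝ, a ≠ 0 ∧ (Projectivization.mk ℝ v hv).rep = a • v := by
  obtain ⟨a, ha⟩ := exists_smul_eq_mk_rep ℝ v hv
  exact ⟨a, a.ne_zero, ha.symm⟩

theorem mk_mem_chart {d : ℕ} {f : Module.Dual ℝ (Fin d → ℝ)} {v : Fin d → ℝ} (hv : v ≠ 0) :
    Projectivization.mk ℝ v hv ∈ chart f ↔ f v ≠ 0 := by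
  obtain ⟨a, ha, h⟩ := dual_mk_rep hv
  simp [chart, h, ha]

theorem coord_mk {d : ℕ} (f : Module.Dual ℝ (Fin d → ℝ)) {v : Fin d → ℝ} (hv : v ≠ 0) :
    coord f (Projectivization.mk ℝ v hv) = (f v)⁻¹ • v := by
  obtain ⟨a, ha, h⟩ := dual_mk_rep hv
  simp only [coord, h, map_smul, smul_eq_mul, mul_inv, smul_smul]
  congr 1
  field_simp

theorem coord_neg {d : ℕ} (f : Module.Dual ℝ (Fin d → ℝ)) (x : Proj d) :
    coord (-f) x = -coord f x := by
  simp [coord, inv_neg]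

theorem chart_neg {d : ℕ} (f : Module.Dual ℝ (Fin d → ℝ)) : chart (-f) = chart f := by
  simp [chart]

theorem coord_ne_zero {d : ℕ} {f : Module.Dual ℝ (Fin d → ℝ)} {x : Proj d} (hx : x ∈ chart f) :
    coord f x ≠ 0 := smul_ne_zero (inv_ne_zero hx) x.rep_nonzero

theorem apply_coord {d : ℕ} {f : Module.Dual ℝ (Fin d → ℝ)} {x : Proj d} (hx : x ∈ chart f) :
    f (coord f x) = 1 := by
  simp only [coord, map_smul, smul_eq_mul]
  exact inv_mul_cancel₀ hx

theorem mk_coord {d : ℕ} {f : Module.Dual ℝ (Fin d → ℝ)} {x : Proj d} (hx : x ∈ chart f) :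
    Projectivization.mk ℝ (coord f x) (coord_ne_zero hx) = x := by
  conv_rhs => rw [← x.mk_rep]
  exact (mk_eq_mk_iff' _ _ _ _ _).2 ⟨_, rfl⟩

theorem mk_mem_projTrace_iff {N : Set (Fin 5 → ℝ)}
    (hs : ∀ c : ℝ, 0 < c → ∀ v ∈ N, c • v ∈ N) {v : Fin 5 → ℝ} (hv : v ≠ 0) :
    Projectivization.mk ℝ v hv ∈ projTrace N ↔ v ∈ N ∨ -v ∈ N := by
  constructor
  · rintro ⟨w, hw, hw0, h⟩
    obtain ⟨c, hc, h | h⟩ := (mk_eq_mk_iff_pos _ _).1 h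
    · left
      rw [h]
      exact hs c hc w hw
    · right
      rw [h, neg_neg]
      exact hs c hc w hw
  · rintro (h | h)
    · exact ⟨v, h, hv, rfl⟩
    · exact ⟨-v, h, neg_ne_zero.2 hv, (mk_neg' hv).symm⟩

/-! ### Sharp open convex cones -/

/-- `N` is a nonempty open convex cone of `ℝ⁵` on whose closure, outside the origin, the linear form
`f` is positive. -/
structure IsSharpCone (N : Set (Fin 5 → ℝ)) (f : Module.Dual ℝ (Fin 5 → ℝ)) : Prop where
  isOpen : IsOpen N
  nonempty : N.Nonempty
  add_mem : ∀ v ∈ N, ∀ w ∈ N, v + w ∈ N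
  smul_mem : ∀ c : ℝ, 0 < c → ∀ v ∈ N, c • v ∈ N
  pos : ∀ v ∈ closure N, v ≠ 0 → 0 < f v

namespace IsSharpCone

variable {N : Set (Fin 5 → ℝ)} {f : Module.Dual ℝ (Fin 5 → ℝ)} (hN : IsSharpCone N f)
include hN

theorem closure_add {v w : Fin 5 → ℝ} (hv : v ∈ closure N) (hw : w ∈ closure N) :
    v + w ∈ closure N :=
  map_mem_closure₂ continuous_add hv hw hN.add_mem

theorem closure_smul {c : ℝ} (hc : 0 < c) {v : Fin 5 → ℝ} (hv : v ∈ closure N) :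
    c • v ∈ closure N :=
  map_mem_closure (continuous_const_smul c) hv (hN.smul_mem c hc)

theorem add_closure {v w : Fin 5 → ℝ} (hv : v ∈ N) (hw : w ∈ closure N) : v + w ∈ N := by
  have h : v + w ∈ N + closure N := Set.add_mem_add hv hw
  rw [hN.isOpen.add_closure] at h
  obtain ⟨a, ha, b, hb, hab⟩ := h
  rw [← hab]
  exact hN.add_mem _ ha _ hb

theorem closure_add' {v w : Fin 5 → ℝ} (hv : v ∈ closure N) (hw : w ∈ N) : v + w ∈ N := by
  rw [add_comm]
  exact hN.add_closure hw hv

/-- An open set containing $0$ contains two opposite nonzero vectors, on both of which `f` would be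
positive. -/
theorem zero_notMem : (0 : Fin 5 → ℝ) ∉ N := by
  intro h
  have hc : Continuous fun t : ℝ => t • (fun _ => 1 : Fin 5 → ℝ) := by fun_prop
  have h1 : {t : ℝ | t • (fun _ => 1 : Fin 5 → ℝ) ∈ N} ∈ 𝓝 (0 : ℝ) :=
    (hN.isOpen.preimage hc).mem_nhds (by simpa using h)
  obtain ⟨ε, hε, hb⟩ := Metric.mem_nhds_iff.1 h1
  have h2 : (ε / 2) ∈ Metric.ball (0 : ℝ) ε := by simp [abs_of_pos hε]; linarith
  have h3 : (-(ε / 2)) ∈ Metric.ball (0 : ℝ) ε := by simp [abs_of_pos hε]; linarith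
  have hne : (fun _ => 1 : Fin 5 → ℝ) ≠ 0 := fun h => by simpa using congrFun h 0
  have p2 := hN.pos _ (subset_closure (hb h2)) (smul_ne_zero (by positivity) hne)
  have p3 := hN.pos _ (subset_closure (hb h3)) (smul_ne_zero (by simp; positivity) hne)
  rw [map_smul, smul_eq_mul] at p2 p3
  nlinarith

theorem ne_zero {v : Fin 5 → ℝ} (hv : v ∈ N) : v ≠ 0 := fun h => hN.zero_notMem (h ▸ hv)

theorem neg_notMem_closure {v : Fin 5 → ℝ} (hv : v ∈ closure N) (h0 : v ≠ 0) :
    -v ∉ closure N := by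
  intro h
  have h1 := hN.pos _ hv h0
  have h2 := hN.pos _ h (neg_ne_zero.2 h0)
  rw [map_neg] at h2
  linarith

theorem zero_mem_closure : (0 : Fin 5 → ℝ) ∈ closure N := by
  obtain ⟨v, hv⟩ := hN.nonempty
  have hc : Filter.Tendsto (fun t : ℝ => t • v) (𝓝[>] 0) (𝓝 0) := by
    have : Continuous fun t : ℝ => t • v := by fun_prop
    have := this.tendsto 0
    rw [zero_smul] at this
    exact this.mono_left nhdsWithin_le_nhds
  exact mem_closure_of_tendsto hc
    (eventually_nhdsWithin_of_forall fun t ht => hN.smul_mem t ht v hv)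

theorem closure_smul' {c : ℝ} (hc : 0 ≤ c) {v : Fin 5 → ℝ} (hv : v ∈ closure N) :
    c • v ∈ closure N := by
  rcases hc.eq_or_lt with h | h
  · rw [← h, zero_smul]
    exact hN.zero_mem_closure
  · exact hN.closure_smul h hv

theorem mk_mem {v : Fin 5 → ℝ} (hv : v ≠ 0) : Projectivization.mk ℝ v hv ∈ projTrace N ↔ v ∈ N ∨ -v ∈ N :=
  mk_mem_projTrace_iff hN.smul_mem hv

theorem coneOver_eq : coneOver (projTrace N) = N ∪ -N := by
  ext v
  constructor
  · rintro ⟨hv, h⟩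
    exact (hN.mk_mem hv).1 h
  · intro h
    have hv : v ≠ 0 := by
      rintro rfl
      rcases h with h | h
      · exact hN.zero_notMem h
      · exact hN.zero_notMem (by simpa using h)
    exact ⟨hv, (hN.mk_mem hv).2 h⟩

theorem mk_mem_closure {v : Fin 5 → ℝ} (hv : v ≠ 0) :
    Projectivization.mk ℝ v hv ∈ closure (projTrace N) ↔ v ∈ closure N ∨ -v ∈ closure N := by
  rw [mem_closure_proj_iff, hN.coneOver_eq, closure_union, ← Set.mem_neg, Set.mem_union,
    ← neg_closure]

theorem isOpen_projTrace : IsOpen (projTrace N) := by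
  rw [isOpen_proj_iff]
  have : IsOpen {v : {v : Fin 5 → ℝ // v ≠ 0} | v.1 ∈ N ∪ -N} :=
    (hN.isOpen.union hN.isOpen.neg).preimage continuous_subtype_val
  convert this using 1
  ext v
  exact hN.mk_mem v.2

theorem mk_mem_frontier {v : Fin 5 → ℝ} (hv : v ≠ 0) :
    Projectivization.mk ℝ v hv ∈ frontier (projTrace N) ↔ v ∈ closure N \ N ∨ -v ∈ closure N \ N := by
  rw [hN.isOpen_projTrace.frontier_eq, Set.mem_sdiff, hN.mk_mem_closure, hN.mk_mem]
  constructor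
  · rintro ⟨h | h, h'⟩
    · exact Or.inl ⟨h, fun h2 => h' (Or.inl h2)⟩
    · exact Or.inr ⟨h, fun h2 => h' (Or.inr h2)⟩
  · rintro (⟨h, h'⟩ | ⟨h, h'⟩)
    · exact ⟨Or.inl h, fun h2 => h2.elim h' fun h3 =>
        hN.neg_notMem_closure h hv (subset_closure h3)⟩
    · exact ⟨Or.inr h, fun h2 => h2.elim (fun h3 =>
        hN.neg_notMem_closure h (neg_ne_zero.2 hv) (by rw [neg_neg]; exact subset_closure h3)) h'⟩

/-- A linear form whose chart contains the closure of `projTrace N` has constant sign. -/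
theorem chart_pos {g : Module.Dual ℝ (Fin 5 → ℝ)} (hg : closure (projTrace N) ⊆ chart g) :
    (∀ v ∈ closure N, v ≠ 0 → 0 < g v) ∨ (∀ v ∈ closure N, v ≠ 0 → 0 < (-g) v) := by
  have hne : ∀ v ∈ closure N, v ≠ 0 → g v ≠ 0 := fun v hv h0 =>
    (mk_mem_chart h0).1 (hg ((hN.mk_mem_closure h0).2 (Or.inl hv)))
  by_contra! h
  obtain ⟨⟨v, hv, hv0, hgv⟩, ⟨w, hw, hw0, hgw⟩⟩ := h
  have hgv' : g v < 0 := lt_of_le_of_ne hgv (hne v hv hv0)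
  have hgw' : 0 < g w := lt_of_le_of_ne (by simpa using hgw) (hne w hw hw0).symm
  -- A positive combination of `v` and `w` killed by `g`. It is nonzero since `f` is positive on it,
  -- so it represents a point of the closure outside the chart.
  have hmem : g w • v + (-(g v)) • w ∈ closure N :=
    hN.closure_add (hN.closure_smul hgw' hv) (hN.closure_smul (by linarith) hw)
  have hpos : 0 < f (g w • v + (-(g v)) • w) := by
    have h1 := hN.pos v hv hv0
    have h2 := hN.pos w hw hw0
    simp only [map_add, map_smul, smul_eq_mul]
    nlinarith [mul_pos hgw' h1, mul_pos (neg_pos.2 hgv') h2]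
  have h0 : g w • v + (-(g v)) • w ≠ 0 := fun h => by rw [h, map_zero] at hpos; exact hpos.false
  apply hne _ hmem h0
  simp only [map_add, map_smul, smul_eq_mul]
  ring

theorem chart_subset : closure (projTrace N) ⊆ chart f := by
  intro x
  induction x using Projectivization.ind with
  | h v hv =>
    intro h
    rw [mk_mem_chart]
    rcases (hN.mk_mem_closure hv).1 h with h | h
    · exact (hN.pos v h hv).ne'
    · have := hN.pos _ h (neg_ne_zero.2 hv)
      rw [map_neg] at this
      linarith

theorem coord_mem_closure {g : Module.Dual ℝ (Fin 5 → ℝ)}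
    (hg : ∀ v ∈ closure N, v ≠ 0 → 0 < g v) {x : Proj 5} (hx : x ∈ closure (projTrace N)) :
    coord g x ∈ closure N ∧ g (coord g x) = 1 := by
  induction x using Projectivization.ind with
  | h v hv =>
    rw [coord_mk]
    rcases (hN.mk_mem_closure hv).1 hx with h | h
    · have := hg v h hv
      exact ⟨hN.closure_smul (by positivity) h, by simp [this.ne']⟩
    · have h1 := hg _ h (neg_ne_zero.2 hv)
      rw [map_neg] at h1
      refine ⟨?_, by simp [(neg_pos.1 h1).ne]⟩
      have := hN.closure_smul (inv_pos.2 h1) h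
      rwa [inv_neg, neg_smul_neg] at this

theorem coord_mem {g : Module.Dual ℝ (Fin 5 → ℝ)}
    (hg : ∀ v ∈ closure N, v ≠ 0 → 0 < g v) {x : Proj 5} (hx : x ∈ projTrace N) :
    coord g x ∈ N := by
  obtain ⟨v, hv, hv0, rfl⟩ := hx
  rw [coord_mk]
  exact hN.smul_mem _ (inv_pos.2 (hg v (subset_closure hv) hv0)) v hv

theorem coord_mem_frontier {g : Module.Dual ℝ (Fin 5 → ℝ)}
    (hg : ∀ v ∈ closure N, v ≠ 0 → 0 < g v) {x : Proj 5} (hx : x ∈ frontier (projTrace N)) :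
    coord g x ∈ closure N \ N := by
  refine ⟨(hN.coord_mem_closure hg (frontier_subset_closure hx)).1, fun h => ?_⟩
  rw [hN.isOpen_projTrace.frontier_eq] at hx
  have hxg : x ∈ chart g := by
    have h1 : g (coord g x) = 1 := (hN.coord_mem_closure hg hx.1).2
    intro h2
    simp [coord, h2] at h1
  apply hx.2
  rw [← mk_coord hxg]
  exact (hN.mk_mem _).2 (Or.inl h)

theorem isProperlyConvexOpen : IsProperlyConvexOpen (projTrace N) := by
  refine ⟨?_, hN.isOpen_projTrace, f, hN.chart_subset, ?_⟩
  · obtain ⟨v, hv⟩ := hN.nonempty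
    exact ⟨_, v, hv, hN.ne_zero hv, rfl⟩
  · have : coord f '' projTrace N = {v ∈ N | f v = 1} := by
      ext v
      constructor
      · rintro ⟨x, hx, rfl⟩
        exact ⟨hN.coord_mem hN.pos hx, (hN.coord_mem_closure hN.pos (subset_closure hx)).2⟩
      · rintro ⟨hv, h1⟩
        exact ⟨_, ⟨v, hv, hN.ne_zero hv, rfl⟩, by rw [coord_mk, h1]; simp⟩
    rw [this]
    rintro v ⟨hv, hv1⟩ w ⟨hw, hw1⟩ a b ha hb hab
    refine ⟨?_, by simp [hv1, hw1, hab]⟩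
    rcases ha.eq_or_lt with rfl | ha
    · have : b = 1 := by linarith
      simpa [this] using hw
    rcases hb.eq_or_lt with rfl | hb
    · have : a = 1 := by linarith
      simpa [this] using hv
    exact hN.add_mem _ (hN.smul_mem a ha v hv) _ (hN.smul_mem b hb w hw)

end IsSharpCone

end HilbertGeom

namespace HilbertGeom

/-! ### The Hilbert distance in terms of the order defined by the cone -/

namespace IsSharpCone

variable {N : Set (Fin 5 → ℝ)} {f : Module.Dual ℝ (Fin 5 → ℝ)} (hN : IsSharpCone N f)
include hN

theorem le_of_sub_smul_mem_closure {u v : Fin 5 → ℝ} (hv : v ∈ N) {a a' : ℝ}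
    (ha : u - a • v ∉ N) (ha' : u - a' • v ∈ closure N) : a' ≤ a := by
  by_contra! h
  apply ha
  have := hN.closure_add' ha' (hN.smul_mem (a' - a) (by linarith) v hv)
  convert this using 1
  module

/-- Replacing the chart form by its opposite changes the sign of all coordinates, which affects
neither the order of the four points nor the lengths. -/
theorem exists_positive_chart {x y : Proj 5} {δ : ℝ} (h : IsHilbertDist (projTrace N) x y δ) :
    ∃ g : Module.Dual ℝ (Fin 5 → ℝ), (∀ v ∈ closure N, v ≠ 0 → 0 < g v) ∧
      ∃ p ∈ frontier (projTrace N), ∃ q ∈ frontier (projTrace N),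
        coord g x ∈ openSegment ℝ (coord g p) (coord g y) ∧
        coord g y ∈ openSegment ℝ (coord g x) (coord g q) ∧
        δ = (1 / 2) * Real.log
          ((‖coord g p - coord g y‖ * ‖coord g q - coord g x‖) /
            (‖coord g p - coord g x‖ * ‖coord g q - coord g y‖)) := by
  obtain ⟨g, hg, p, hp, q, hq, h1, h2, h3⟩ := h
  rcases hN.chart_pos hg with h | h
  · exact ⟨g, h, p, hp, q, hq, h1, h2, h3⟩
  · refine ⟨-g, h, p, hp, q, hq, ?_, ?_, ?_⟩
    · simp only [coord_neg]
      obtain ⟨a, b, ha, hb, hab, he⟩ := h1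
      exact ⟨a, b, ha, hb, hab, by rw [← he]; module⟩
    · simp only [coord_neg]
      obtain ⟨a, b, ha, hb, hab, he⟩ := h2
      exact ⟨a, b, ha, hb, hab, by rw [← he]; module⟩
    · simp only [coord_neg, neg_sub_neg]
      rw [norm_sub_rev (coord g y), norm_sub_rev (coord g x), norm_sub_rev (coord g x),
        norm_sub_rev (coord g y)]
      exact h3

/-- Birkhoff's description: the boundary points `p` and `q` are the classes of `u - a v` and `v - b
u`, and the cross-ratio becomes $1/(ab)$. Maximality of `a` and `b` makes them, and so the distance,
independent of the chart and of `p`, `q`. -/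
theorem exists_of_isHilbertDist {u v : Fin 5 → ℝ} (hu : u ∈ N) (hv : v ∈ N) {δ : ℝ}
    (h : IsHilbertDist (projTrace N) (Projectivization.mk ℝ u (hN.ne_zero hu))
      (Projectivization.mk ℝ v (hN.ne_zero hv)) δ) :
    ∃ a b : ℝ, 0 < a ∧ 0 < b ∧ u - a • v ∈ closure N ∧ v - b • u ∈ closure N ∧
      δ = -(1 / 2) * Real.log (a * b) ∧ (∀ a', u - a' • v ∈ closure N → a' ≤ a) ∧
      (∀ b', v - b' • u ∈ closure N → b' ≤ b) := by
  obtain ⟨g, hg, p, hp, q, hq, h1, h2, h3⟩ := hN.exists_positive_chart h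
  have hgu := hg u (subset_closure hu) (hN.ne_zero hu)
  have hgv := hg v (subset_closure hv) (hN.ne_zero hv)
  have hP := hN.coord_mem_frontier hg hp
  have hQ := hN.coord_mem_frontier hg hq
  rw [coord_mk, coord_mk] at h1 h2 h3
  set P := coord g p
  set Q := coord g q
  set U := (g u)⁻¹ • u with hU
  set Y := (g v)⁻¹ • v with hY
  have hUN : U ∈ N := hN.smul_mem _ (inv_pos.2 hgu) u hu
  have hYN : Y ∈ N := hN.smul_mem _ (inv_pos.2 hgv) v hv
  obtain ⟨s', s, hs', hs, hss, hes⟩ := h1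
  obtain ⟨t, t', ht, ht', htt, het⟩ := h2
  have huU : u = g u • U := by rw [hU, smul_smul, mul_inv_cancel₀ hgu.ne', one_smul]
  have hvY : v = g v • Y := by rw [hY, smul_smul, mul_inv_cancel₀ hgv.ne', one_smul]
  -- Solving `U = s' P + s Y` for `P` and undoing the normalizations of `U` and `Y` identifies the
  -- coefficient `a`.
  have e1 : u - (s * g u / g v) • v = (g u * s') • P := by
    have : (s * g u / g v) • v = (s * g u) • Y := by
      rw [hY, smul_smul, div_eq_mul_inv]
    rw [this]
    nth_rewrite 1 [huU]
    rw [← hes]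
    module
  have e2 : v - (t * g v / g u) • u = (g v * t') • Q := by
    have : (t * g v / g u) • u = (t * g v) • U := by
      rw [hU, smul_smul, div_eq_mul_inv]
    rw [this]
    nth_rewrite 1 [hvY]
    rw [← het]
    module
  have notmem : ∀ {c : ℝ}, 0 < c → ∀ {R : Fin 5 → ℝ}, R ∉ N → c • R ∉ N := by
    intro c hc R hR h
    apply hR
    have := hN.smul_mem c⁻¹ (inv_pos.2 hc) _ h
    rwa [smul_smul, inv_mul_cancel₀ hc.ne', one_smul] at this
  refine ⟨s * g u / g v, t * g v / g u, by positivity, by positivity, ?_, ?_, ?_, ?_, ?_⟩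
  · rw [e1]
    exact hN.closure_smul (by positivity) hP.1
  · rw [e2]
    exact hN.closure_smul (by positivity) hQ.1
  · have hPY : P - Y ≠ 0 := fun h => hP.2 (by rw [sub_eq_zero.1 h]; exact hYN)
    have hQU : Q - U ≠ 0 := fun h => hQ.2 (by rw [sub_eq_zero.1 h]; exact hUN)
    have n1 : ‖P - U‖ = s * ‖P - Y‖ := by
      have : P - U = s • (P - Y) := by
        rw [← hes, eq_sub_iff_add_eq.2 hss]
        module
      rw [this, norm_smul, Real.norm_of_nonneg hs.le]
    have n2 : ‖Q - Y‖ = t * ‖Q - U‖ := by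
      have : Q - Y = t • (Q - U) := by
        rw [← het, eq_sub_iff_add_eq'.2 htt]
        module
      rw [this, norm_smul, Real.norm_of_nonneg ht.le]
    have p1 : 0 < ‖P - Y‖ := norm_pos_iff.2 hPY
    have p2 : 0 < ‖Q - U‖ := norm_pos_iff.2 hQU
    rw [h3, n1, n2]
    have e3 : ‖P - Y‖ * ‖Q - U‖ / (s * ‖P - Y‖ * (t * ‖Q - U‖)) =
        (s * g u / g v * (t * g v / g u))⁻¹ := by
      field_simp
    rw [e3, Real.log_inv]
    ring
  · intro a' ha'
    exact hN.le_of_sub_smul_mem_closure hv (by rw [e1]; exact notmem (by positivity) hP.2) ha'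
  · intro b' hb'
    exact hN.le_of_sub_smul_mem_closure hu (by rw [e2]; exact notmem (by positivity) hQ.2) hb'

/-- The half-line from `Y` through `U` leaves the cone. -/
theorem exists_exit {U Y : Fin 5 → ℝ} (hU : U ∈ N) (hfU : f U = 1) (hfY : f Y = 1)
    (hne : U ≠ Y) : ∃ s : ℝ, 0 < s ∧ s < 1 ∧ U - s • Y ∈ closure N \ N := by
  -- The exit parameter is the supremum of this closed set. The bound by $1$ comes from `f`, and it
  -- is strict because at $1$ the vector $U-Y$ is nonzero and killed by `f`.
  set S : Set ℝ := {s | U - s • Y ∈ closure N} with hS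
  have hcont : Continuous fun s : ℝ => U - s • Y := by fun_prop
  have hclosed : IsClosed S := isClosed_closure.preimage hcont
  have hle : ∀ s ∈ S, s ≤ 1 := by
    intro s hs
    by_cases h0 : U - s • Y = 0
    · have : f (U - s • Y) = 0 := by rw [h0, map_zero]
      rw [map_sub, map_smul, hfU, hfY, smul_eq_mul] at this
      linarith
    · have := hN.pos _ hs h0
      rw [map_sub, map_smul, hfU, hfY, smul_eq_mul] at this
      linarith
  have h0S : (0 : ℝ) ∈ S := by
    change U - (0 : ℝ) • Y ∈ closure N
    rw [zero_smul, sub_zero]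
    exact subset_closure hU
  have hbdd : BddAbove S := ⟨1, hle⟩
  have hmem : sSup S ∈ S := hclosed.csSup_mem ⟨0, h0S⟩ hbdd
  have hnot : U - sSup S • Y ∉ N := by
    intro h
    have := (hN.isOpen.preimage hcont).mem_nhds (x := sSup S) h
    obtain ⟨ε, hε, hb⟩ := Metric.mem_nhds_iff.1 this
    have h2 : sSup S + ε / 2 ∈ S := by
      apply subset_closure
      apply hb
      simp [abs_of_pos hε]
      linarith
    have := le_csSup hbdd h2
    linarith
  have hpos : 0 < sSup S := by
    refine lt_of_le_of_ne (le_csSup hbdd h0S) fun h => hnot ?_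
    rw [← h]
    simpa using hU
  have hlt : sSup S < 1 := by
    refine lt_of_le_of_ne (hle _ hmem) fun h => ?_
    have h1 : U - sSup S • Y ≠ 0 := by
      rw [h, one_smul]
      exact sub_ne_zero.2 hne
    have := hN.pos _ hmem h1
    rw [h, one_smul, map_sub, hfU, hfY, sub_self] at this
    exact this.false
  exact ⟨sSup S, hpos, hlt, hmem, hnot⟩

theorem exists_isHilbertDist {x y : Proj 5} (hx : x ∈ projTrace N) (hy : y ∈ projTrace N)
    (hxy : x ≠ y) : ∃ δ, IsHilbertDist (projTrace N) x y δ := by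
  have key : ∀ {x y : Proj 5}, x ∈ projTrace N → y ∈ projTrace N → x ≠ y →
      ∃ p ∈ frontier (projTrace N), coord f x ∈ openSegment ℝ (coord f p) (coord f y) := by
    intro x y hx hy hxy
    have hxc : x ∈ chart f := hN.chart_subset (subset_closure hx)
    have hyc : y ∈ chart f := hN.chart_subset (subset_closure hy)
    obtain ⟨s, hs0, hs1, hs⟩ := hN.exists_exit (hN.coord_mem hN.pos hx)
      (apply_coord hxc) (apply_coord hyc) (fun h => hxy (by
        rw [← mk_coord hxc, ← mk_coord hyc]
        simp only [h]))
    have hf : f (coord f x - s • coord f y) = 1 - s := by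
      rw [map_sub, map_smul, apply_coord hxc, apply_coord hyc, smul_eq_mul, mul_one]
    have h0 : coord f x - s • coord f y ≠ 0 := by
      intro h
      rw [h, map_zero] at hf
      linarith
    refine ⟨Projectivization.mk ℝ _ h0, (hN.mk_mem_frontier h0).2 (Or.inl hs), 1 - s, s,
      by linarith, hs0, by ring, ?_⟩
    rw [coord_mk, hf, smul_smul, mul_inv_cancel₀ (by linarith), one_smul, sub_add_cancel]
  obtain ⟨p, hp, hpx⟩ := key hx hy hxy
  obtain ⟨q, hq, hqx⟩ := key hy hx hxy.symm
  exact ⟨_, f, hN.chart_subset, p, hp, q, hq, hpx, by rwa [openSegment_symm], rfl⟩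

/-- The Hilbert distance of two points is `-(1/2) log (a b)`, where `a` and `b` are the greatest
numbers such that `u - a v` and `v - b u` belong to the closed cone. -/
theorem exists_hilbertDist_eq {u v : Fin 5 → ℝ} (hu : u ∈ N) (hv : v ∈ N) :
    ∃ a b : ℝ, 0 < a ∧ 0 < b ∧ u - a • v ∈ closure N ∧ v - b • u ∈ closure N ∧
      hilbertDist (projTrace N) (Projectivization.mk ℝ u (hN.ne_zero hu))
        (Projectivization.mk ℝ v (hN.ne_zero hv)) = -(1 / 2) * Real.log (a * b) ∧
      (∀ a', u - a' • v ∈ closure N → a' ≤ a) ∧ (∀ b', v - b' • u ∈ closure N → b' ≤ b) := by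
  by_cases h : Projectivization.mk ℝ u (hN.ne_zero hu) = Projectivization.mk ℝ v (hN.ne_zero hv)
  · obtain ⟨c, hc, h' | h'⟩ := (mk_eq_mk_iff_pos _ _).1 h
    · have hv' : v = c⁻¹ • u := by rw [h', smul_smul, inv_mul_cancel₀ hc.ne', one_smul]
      refine ⟨c, c⁻¹, hc, inv_pos.2 hc, ?_, ?_, ?_, ?_, ?_⟩
      · rw [← h', sub_self]; exact hN.zero_mem_closure
      · rw [← hv', sub_self]; exact hN.zero_mem_closure
      · rw [hilbertDist, if_pos h, mul_inv_cancel₀ hc.ne', Real.log_one, mul_zero]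
      · intro a' ha'
        refine hN.le_of_sub_smul_mem_closure hv ?_ ha'
        rw [← h', sub_self]; exact hN.zero_notMem
      · intro a' ha'
        refine hN.le_of_sub_smul_mem_closure hu ?_ ha'
        rw [← hv', sub_self]; exact hN.zero_notMem
    · exfalso
      refine hN.neg_notMem_closure (subset_closure hu) (hN.ne_zero hu) ?_
      rw [h', neg_neg]
      exact subset_closure (hN.smul_mem c hc v hv)
  · obtain ⟨δ, hδ⟩ := hN.exists_isHilbertDist ⟨u, hu, _, rfl⟩ ⟨v, hv, _, rfl⟩ h
    obtain ⟨a, b, ha, hb, h1, h2, h3, h4, h5⟩ := hN.exists_of_isHilbertDist hu hv hδ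
    refine ⟨a, b, ha, hb, h1, h2, ?_, h4, h5⟩
    have : {δ | IsHilbertDist (projTrace N) (Projectivization.mk ℝ u (hN.ne_zero hu))
        (Projectivization.mk ℝ v (hN.ne_zero hv)) δ} = {δ} := by
      ext δ'
      constructor
      · intro hδ'
        obtain ⟨a', b', ha', hb', h1', h2', h3', h4', h5'⟩ := hN.exists_of_isHilbertDist hu hv hδ'
        have ea : a = a' := le_antisymm (h4' a h1) (h4 a' h1')
        have eb : b = b' := le_antisymm (h5' b h2) (h5 b' h2')
        rw [Set.mem_singleton_iff, h3, h3', ea, eb]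
      · rintro rfl
        exact hδ
    rw [hilbertDist, if_neg h, this, csSup_singleton, h3]

/-- Admissible coefficients are at most the maximal ones, so no extremality has to be checked to
bound the distance from above. -/
theorem hilbertDist_le {u v : Fin 5 → ℝ} (hu : u ∈ N) (hv : v ∈ N) {a b : ℝ} (ha : 0 < a)
    (hb : 0 < b) (h1 : u - a • v ∈ closure N) (h2 : v - b • u ∈ closure N) :
    hilbertDist (projTrace N) (Projectivization.mk ℝ u (hN.ne_zero hu))
      (Projectivization.mk ℝ v (hN.ne_zero hv)) ≤ -(1 / 2) * Real.log (a * b) := by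
  obtain ⟨a', b', ha', hb', -, -, h3, h4, h5⟩ := hN.exists_hilbertDist_eq hu hv
  rw [h3]
  have := Real.log_le_log (by positivity) (mul_le_mul (h4 a h1) (h5 b h2) hb.le ha'.le)
  linarith

theorem exists_of_hilbertDist_le {u v : Fin 5 → ℝ} (hu : u ∈ N) (hv : v ∈ N) {D : ℝ}
    (h : hilbertDist (projTrace N) (Projectivization.mk ℝ u (hN.ne_zero hu))
      (Projectivization.mk ℝ v (hN.ne_zero hv)) ≤ D) :
    ∃ a b : ℝ, 0 < a ∧ 0 < b ∧ u - a • v ∈ closure N ∧ v - b • u ∈ closure N ∧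
      Real.exp (-(2 * D)) ≤ a * b := by
  obtain ⟨a, b, ha, hb, h1, h2, h3, -, -⟩ := hN.exists_hilbertDist_eq hu hv
  refine ⟨a, b, ha, hb, h1, h2, ?_⟩
  rw [← Real.le_log_iff_exp_le (by positivity)]
  linarith

end IsSharpCone

end HilbertGeom

namespace HilbertGeom

/-! ### Families of homogeneous functions -/

section Homogeneous

variable {n : ℕ}

theorem pos_of_pos_on_sphere {F : (Fin n → ℝ) → ℝ} {k : ℕ}
    (hF : ∀ (c : ℝ) z, F (c • z) = c ^ k * F z) (h : ∀ z ∈ Metric.sphere (0 : Fin n → ℝ) 1, 0 < F z) :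
    ∀ z, z ≠ 0 → 0 < F z := by
  intro z hz
  have hn : 0 < ‖z‖ := norm_pos_iff.2 hz
  have h1 := h (‖z‖⁻¹ • z) (by simp [norm_smul, hn.ne'])
  rw [hF] at h1
  exact pos_of_mul_pos_right h1 (by positivity)

theorem ne_zero_of_mem_sphere {z : Fin n → ℝ} (h : z ∈ Metric.sphere (0 : Fin n → ℝ) 1) :
    z ≠ 0 := by
  rintro rfl
  simp at h

/-- Homogeneity reduces positivity to the unit sphere, where compactness makes it an open condition
on the parameter. -/
theorem isOpen_setOf_pos {X : Type*} [TopologicalSpace X] {F : X → (Fin n → ℝ) → ℝ} {k : ℕ}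
    (hc : Continuous fun p : X × (Fin n → ℝ) => F p.1 p.2)
    (hF : ∀ x (c : ℝ) z, F x (c • z) = c ^ k * F x z) :
    IsOpen {x | ∀ z, z ≠ 0 → 0 < F x z} := by
  rw [isOpen_iff_mem_nhds]
  intro x hx
  have := (isCompact_sphere (0 : Fin n → ℝ) 1).eventually_forall_of_forall_eventually
    (x₀ := x) (P := fun y z => 0 < F y z) (fun z hz =>
      (isOpen_lt continuous_const hc).mem_nhds (hx z (ne_zero_of_mem_sphere hz)))
  filter_upwards [this] with y hy
  exact pos_of_pos_on_sphere (hF y) hy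

/-- Near a zero of `F` on the sphere the term `E` is positive; near any other point `F` dominates
for small `s`. Compactness of the sphere makes the choice of `s` uniform. This is the first-order
criterion for entering a cone of positive forms. -/
theorem eventually_pos_perturbation {F E : (Fin n → ℝ) → ℝ} {k : ℕ} (hFc : Continuous F)
    (hEc : Continuous E) (hF : ∀ (c : ℝ) z, F (c • z) = c ^ k * F z)
    (hE : ∀ (c : ℝ) z, E (c • z) = c ^ k * E z) (h0 : ∀ z, 0 ≤ F z)
    (h : ∀ z, z ≠ 0 → F z = 0 → 0 < E z) :
    ∀ᶠ s in 𝓝 (0 : ℝ), 0 < s → ∀ z, z ≠ 0 → 0 < F z + s * E z := by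
  have := (isCompact_sphere (0 : Fin n → ℝ) 1).eventually_forall_of_forall_eventually
    (x₀ := (0 : ℝ)) (P := fun s z => 0 < s → 0 < F z + s * E z) (fun z hz => by
      rcases (h0 z).eq_or_lt with hz0 | hz0
      · have hEz := h z (ne_zero_of_mem_sphere hz) hz0.symm
        have : {p : ℝ × (Fin n → ℝ) | 0 < E p.2} ∈ 𝓝 ((0 : ℝ), z) :=
          (isOpen_lt continuous_const (hEc.comp continuous_snd)).mem_nhds hEz
        filter_upwards [this] with p hp hs
        have := mul_pos hs hp
        have := h0 p.2
        linarith
      · have hc : Continuous fun p : ℝ × (Fin n → ℝ) => F p.2 + p.1 * E p.2 := by fun_prop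
        have : {p : ℝ × (Fin n → ℝ) | 0 < F p.2 + p.1 * E p.2} ∈ 𝓝 ((0 : ℝ), z) :=
          (isOpen_lt continuous_const hc).mem_nhds (by simpa using hz0)
        filter_upwards [this] with p hp hs
        exact hp)
  filter_upwards [this] with s hs hs0
  exact pos_of_pos_on_sphere (k := k) (fun c z => by rw [hF, hE]; ring) fun z hz => hs z hz hs0

end Homogeneous

/-! ### Quartic forms -/

theorem quartic_apply (v : Fin 5 → ℝ) (w : Fin 2 → ℝ) :
    quartic v w = v 0 * w 0 ^ 4 + v 1 * w 0 ^ 3 * w 1 + v 2 * w 0 ^ 2 * w 1 ^ 2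
      + v 3 * w 0 * w 1 ^ 3 + v 4 * w 1 ^ 4 := by
  simp [quartic, Fin.sum_univ_succ]
  ring

theorem quartic_mk (v : Fin 5 → ℝ) (x y : ℝ) :
    quartic v ![x, y] = v 0 * x ^ 4 + v 1 * x ^ 3 * y + v 2 * x ^ 2 * y ^ 2
      + v 3 * x * y ^ 3 + v 4 * y ^ 4 := by
  rw [quartic_apply]; simp

theorem quartic_add (v w : Fin 5 → ℝ) (x : Fin 2 → ℝ) :
    quartic (v + w) x = quartic v x + quartic w x := by
  simp only [quartic_apply, Pi.add_apply]; ring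

theorem quartic_sub (v w : Fin 5 → ℝ) (x : Fin 2 → ℝ) :
    quartic (v - w) x = quartic v x - quartic w x := by
  simp only [quartic_apply, Pi.sub_apply]; ring

theorem quartic_smul (c : ℝ) (w : Fin 5 → ℝ) (x : Fin 2 → ℝ) :
    quartic (c • w) x = c * quartic w x := by
  simp only [quartic_apply, Pi.smul_apply, smul_eq_mul]; ring

theorem quartic_smul_right (w : Fin 5 → ℝ) (c : ℝ) (x : Fin 2 → ℝ) :
    quartic w (c • x) = c ^ 4 * quartic w x := by
  simp only [quartic_apply, Pi.smul_apply, smul_eq_mul]; ring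

theorem continuous_quartic : Continuous fun p : (Fin 5 → ℝ) × (Fin 2 → ℝ) => quartic p.1 p.2 := by
  simp only [quartic_apply]
  fun_prop

/-- Values at five pairwise non-proportional vectors determine the five coefficients. -/
theorem quartic_ext {v w : Fin 5 → ℝ} (h : ∀ x y : ℝ, quartic v ![x, y] = quartic w ![x, y]) :
    v = w := by
  have h1 := h 1 0
  have h2 := h 0 1
  have h3 := h 1 1
  have h4 := h 1 (-1)
  have h5 := h 1 2
  simp only [quartic_mk] at h1 h2 h3 h4 h5
  norm_num at h1 h2 h3 h4 h5
  ext i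
  fin_cases i <;> simp <;> linarith

theorem quartic_rho_inv (g : SL(2, ℝ)) (v : Fin 5 → ℝ) (w : Fin 2 → ℝ) :
    quartic (rho g⁻¹ • v) w = quartic v (g • w) := by
  rw [quartic_rho, inv_inv]

theorem rho_add (g : SL(2, ℝ)) (v w : Fin 5 → ℝ) : rho g • (v + w) = rho g • v + rho g • w :=
  smul_add _ _ _

theorem rho_smul (g : SL(2, ℝ)) (c : ℝ) (v : Fin 5 → ℝ) : rho g • (c • v) = c • (rho g • v) :=
  smul_comm _ _ _

theorem rho_inv_smul (g : SL(2, ℝ)) (v : Fin 5 → ℝ) : rho g⁻¹ • rho g • v = v := by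
  rw [map_inv, inv_smul_smul]

theorem continuous_rho_smul (g : SL(2, ℝ)) : Continuous fun v : Fin 5 → ℝ => rho g • v := by
  change Continuous fun v => (rho g).1 *ᵥ v
  fun_prop

theorem rho_smul_ne_zero (g : SL(2, ℝ)) {v : Fin 5 → ℝ} (hv : v ≠ 0) : rho g • v ≠ 0 := by
  intro h
  apply hv
  rw [← rho_inv_smul g v, h, smul_zero]

theorem sl2_smul_ne_zero (g : SL(2, ℝ)) {v : Fin 2 → ℝ} (hv : v ≠ 0) : g • v ≠ 0 := by
  intro h
  apply hv
  rw [← inv_smul_smul g v, h, smul_zero]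

theorem sl2_smul_mk (g : SL(2, ℝ)) (x y : ℝ) :
    g • ![x, y] = ![g 0 0 * x + g 0 1 * y, g 1 0 * x + g 1 1 * y] := by
  change g.1 *ᵥ ![x, y] = _
  ext i
  fin_cases i <;> simp [Matrix.mulVec, dotProduct, Fin.sum_univ_two]

/-- The matrix `[a b; c e]` of determinant one. -/
def sl2 (a b c e : ℝ) (h : a * e - b * c = 1) : SL(2, ℝ) :=
  ⟨!![a, b; c, e], by rw [Matrix.det_fin_two_of, h]⟩

theorem sl2_smul (a b c e : ℝ) (h : a * e - b * c = 1) (x y : ℝ) :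
    sl2 a b c e h • ![x, y] = ![a * x + b * y, c * x + e * y] := by
  rw [sl2_smul_mk]; rfl

/-! ### Positive definite quartic forms as a sharp cone -/

/-- The cone of positive definite quartic forms. -/
def posCone : Set (Fin 5 → ℝ) := {v | ∀ w, w ≠ 0 → 0 < quartic v w}

theorem isOpen_posCone : IsOpen posCone :=
  isOpen_setOf_pos continuous_quartic fun v c z => quartic_smul_right v c z

theorem vec2_ne_zero {x y : ℝ} : (![x, y] : Fin 2 → ℝ) ≠ 0 ↔ x ≠ 0 ∨ y ≠ 0 := by
  rw [← not_iff_not]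
  push Not
  constructor
  · intro h
    exact ⟨by simpa using congrFun h 0, by simpa using congrFun h 1⟩
  · rintro ⟨rfl, rfl⟩
    ext i; fin_cases i <;> rfl

theorem rho_smul_mem_posCone (g : SL(2, ℝ)) {v : Fin 5 → ℝ} (hv : v ∈ posCone) :
    rho g • v ∈ posCone := by
  intro w hw
  rw [quartic_rho]
  exact hv _ (sl2_smul_ne_zero _ hw)

/-- A nonnegative form that vanishes at $(1,0)$ has a double root there; otherwise the linear term
in $t$ of its value at $(1,t)$ would change sign. -/
theorem nonneg_coeff_eq_zero {v : Fin 5 → ℝ} (h : ∀ w, 0 ≤ quartic v w) (h0 : v 0 = 0) :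
    v 1 = 0 := by
  have key : ∀ t : ℝ, 0 ≤ v 1 * t + v 2 * t ^ 2 + v 3 * t ^ 3 + v 4 * t ^ 4 := by
    intro t
    have := h ![1, t]
    rw [quartic_mk, h0] at this
    linarith
  by_contra hne
  have hcont : Continuous fun t : ℝ => v 1 + v 2 * t + v 3 * t ^ 2 + v 4 * t ^ 3 := by fun_prop
  rcases lt_or_gt_of_ne hne with h1 | h1
  · have : {t : ℝ | v 1 + v 2 * t + v 3 * t ^ 2 + v 4 * t ^ 3 < 0} ∈ 𝓝 (0 : ℝ) :=
      (isOpen_lt hcont continuous_const).mem_nhds (by simpa using h1)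
    obtain ⟨ε, hε, hb⟩ := Metric.mem_nhds_iff.1 this
    have h2 : ε / 2 ∈ Metric.ball (0 : ℝ) ε := by simp [abs_of_pos hε]; linarith
    have h3 : v 1 + v 2 * (ε / 2) + v 3 * (ε / 2) ^ 2 + v 4 * (ε / 2) ^ 3 < 0 := hb h2
    have h4 := key (ε / 2)
    nlinarith [mul_pos (half_pos hε) (neg_pos.2 h3)]
  · have : {t : ℝ | 0 < v 1 + v 2 * t + v 3 * t ^ 2 + v 4 * t ^ 3} ∈ 𝓝 (0 : ℝ) :=
      (isOpen_lt continuous_const hcont).mem_nhds (by simpa using h1)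
    obtain ⟨ε, hε, hb⟩ := Metric.mem_nhds_iff.1 this
    have h2 : -(ε / 2) ∈ Metric.ball (0 : ℝ) ε := by simp [abs_of_pos hε]; linarith
    have h3 : 0 < v 1 + v 2 * (-(ε / 2)) + v 3 * (-(ε / 2)) ^ 2 + v 4 * (-(ε / 2)) ^ 3 := hb h2
    have h4 := key (-(ε / 2))
    nlinarith [mul_pos (half_pos hε) h3]

/-- The linear form `8/π ∫ f` (integral over the unit circle), positive on nonnegative forms. -/
def meanForm : Module.Dual ℝ (Fin 5 → ℝ) :=
  3 • LinearMap.proj 0 + LinearMap.proj 2 + 3 • LinearMap.proj 4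

theorem meanForm_apply (v : Fin 5 → ℝ) : meanForm v = 3 * v 0 + v 2 + 3 * v 4 := by
  simp [meanForm]

/-- The form is a positive combination of the values at $(1,0)$, $(0,1)$, $(1,1)$ and $(1,-1)$. If
it vanishes then so do these values; the double roots at $(1,0)$ and $(0,1)$ then kill `v 1` and `v
3`, and `v 2` follows. -/
theorem meanForm_pos {v : Fin 5 → ℝ} (h : ∀ w, 0 ≤ quartic v w) (h0 : v ≠ 0) :
    0 < meanForm v := by
  rw [meanForm_apply]
  have h1 := h ![1, 0]
  have h2 := h ![0, 1]
  have h3 := h ![1, 1]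
  have h4 := h ![1, -1]
  simp only [quartic_mk] at h1 h2 h3 h4
  norm_num at h1 h2 h3 h4
  by_contra! hle
  have e0 : v 0 = 0 := by linarith
  have e4 : v 4 = 0 := by linarith
  have e1 := nonneg_coeff_eq_zero h e0
  have e3 : v 3 = 0 := by
    have := nonneg_coeff_eq_zero (v := ![v 4, v 3, v 2, v 1, v 0]) (fun w => by
      have := h ![w 1, w 0]
      rw [quartic_mk] at this
      rw [quartic_apply]
      simp
      linarith) e4
    simpa using this
  have e2 : v 2 = 0 := by linarith
  apply h0
  ext i
  fin_cases i <;> assumption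

theorem quartic_nonneg_of_mem_closure {v : Fin 5 → ℝ} (h : v ∈ closure posCone)
    (w : Fin 2 → ℝ) : 0 ≤ quartic v w := by
  have hcl : IsClosed {v : Fin 5 → ℝ | 0 ≤ quartic v w} :=
    isClosed_le continuous_const (continuous_quartic.comp (by fun_prop : Continuous fun v => (v, w)))
  refine closure_minimal (fun u hu => ?_) hcl h
  by_cases hw : w = 0
  · simp [hw, quartic_apply]
  · exact (hu w hw).le

/-- The quartic form `x⁴ + 6 c x² y² + y⁴`. -/
def normalForm (c : ℝ) : Fin 5 → ℝ := ![1, 0, 6 * c, 0, 1]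

theorem quartic_normalForm (c x y : ℝ) :
    quartic (normalForm c) ![x, y] = x ^ 4 + 6 * c * x ^ 2 * y ^ 2 + y ^ 4 := by
  rw [quartic_mk]; simp [normalForm]

theorem vec2_eta (w : Fin 2 → ℝ) : w = ![w 0, w 1] := by
  ext i; fin_cases i <;> rfl

theorem normalForm_mem_posCone {c : ℝ} (hc : -(1 / 3) < c) : normalForm c ∈ posCone := by
  intro w hw
  rw [vec2_eta w] at hw ⊢
  rw [quartic_normalForm]
  have h : (w 0) ^ 2 ≠ 0 ∨ (w 1) ^ 2 ≠ 0 := by simpa using vec2_ne_zero.1 hw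
  have h0 := sq_nonneg (w 0)
  have h1 := sq_nonneg (w 1)
  have : 0 < w 0 ^ 2 + w 1 ^ 2 := by
    rcases h with h | h <;> positivity
  by_cases hp : 0 < w 0 ^ 2 * w 1 ^ 2
  · nlinarith [sq_nonneg (w 0 ^ 2 - w 1 ^ 2)]
  · have : w 0 ^ 2 * w 1 ^ 2 = 0 := le_antisymm (not_lt.1 hp) (by positivity)
    nlinarith

theorem posCone_isSharpCone : IsSharpCone posCone meanForm where
  isOpen := isOpen_posCone
  nonempty := ⟨_, normalForm_mem_posCone (c := 0) (by norm_num)⟩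
  add_mem v hv w hw x hx := by
    rw [quartic_add]
    exact add_pos (hv x hx) (hw x hx)
  smul_mem c hc v hv x hx := by
    rw [quartic_smul]
    exact mul_pos hc (hv x hx)
  pos v hv h0 := meanForm_pos (quartic_nonneg_of_mem_closure hv) h0

theorem mem_closure_posCone {v : Fin 5 → ℝ} : v ∈ closure posCone ↔ ∀ w, 0 ≤ quartic v w := by
  refine ⟨quartic_nonneg_of_mem_closure, fun h => ?_⟩
  have ht : Filter.Tendsto (fun s : ℝ => v + s • normalForm 0) (𝓝[>] 0) (𝓝 v) := by
    have hc : Continuous fun s : ℝ => v + s • normalForm 0 := by fun_prop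
    have := hc.tendsto 0
    rw [zero_smul, add_zero] at this
    exact this.mono_left nhdsWithin_le_nhds
  refine mem_closure_of_tendsto ht (eventually_nhdsWithin_of_forall fun s hs w hw => ?_)
  rw [quartic_add, quartic_smul]
  exact add_pos_of_nonneg_of_pos (h w)
    (mul_pos hs (normalForm_mem_posCone (by norm_num) w hw))

/-! ### Normal forms of positive definite quartic forms -/

/-- The dehomogenized polynomial has a complex root, which is not real by positivity; its real
minimal polynomial is the first factor. -/
theorem exists_factorization {v : Fin 5 → ℝ} (hv : v ∈ posCone) :
    ∃ a b α β γ : ℝ, b ≠ 0 ∧ ∀ x y : ℝ, quartic v ![x, y] =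
      ((x - a * y) ^ 2 + b ^ 2 * y ^ 2) * (α * x ^ 2 + β * x * y + γ * y ^ 2) := by
  have h0 : 0 < v 0 := by
    have := hv ![1, 0] (vec2_ne_zero.2 (Or.inl one_ne_zero))
    rw [quartic_mk] at this
    norm_num at this
    exact this
  set P : Polynomial ℂ := .C (v 0 : ℂ) * .X ^ 4 + .C (v 1 : ℂ) * .X ^ 3 + .C (v 2 : ℂ) * .X ^ 2
    + .C (v 3 : ℂ) * .X + .C (v 4 : ℂ) with hP
  have hdeg : P.degree = 4 := by
    rw [hP]
    compute_degree!
    exact h0.ne'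
  obtain ⟨z, hz⟩ := Complex.exists_root (f := P) (by rw [hdeg]; norm_num)
  have hz' : (v 0 : ℂ) * z ^ 4 + v 1 * z ^ 3 + v 2 * z ^ 2 + v 3 * z + v 4 = 0 := by
    have := hz.eq_zero
    simpa [hP] using this
  set a := z.re
  set b := z.im
  have hzz : z = a + b * Complex.I := (Complex.re_add_im z).symm
  have hquad : z ^ 2 = 2 * a * z - (a ^ 2 + b ^ 2) := by
    rw [hzz]
    ring_nf
    rw [Complex.I_sq]
    ring
  have hb : b ≠ 0 := by
    intro hb
    have hza : z = a := by rw [hzz, hb]; simp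
    rw [hza] at hz'
    have h1 : v 0 * a ^ 4 + v 1 * a ^ 3 + v 2 * a ^ 2 + v 3 * a + v 4 = 0 := by exact_mod_cast hz'
    have h2 := hv ![a, 1] (vec2_ne_zero.2 (Or.inr one_ne_zero))
    rw [quartic_mk] at h2
    linarith
  set β := v 1 + 2 * a * v 0 with hβ
  set γ := v 2 + 2 * a * β - (a ^ 2 + b ^ 2) * v 0 with hγ
  set R := v 3 + 2 * a * γ - (a ^ 2 + b ^ 2) * β with hR
  set S := v 4 - (a ^ 2 + b ^ 2) * γ with hS
  -- Euclidean division by the minimal polynomial of `z`. The remainder `R z + S` vanishes at a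
  -- non-real number, so its real coefficients are zero.
  have hid : (v 0 : ℂ) * z ^ 4 + v 1 * z ^ 3 + v 2 * z ^ 2 + v 3 * z + v 4 =
      (z ^ 2 - 2 * a * z + (a ^ 2 + b ^ 2)) * (v 0 * z ^ 2 + β * z + γ) + (R * z + S) := by
    rw [hS, hR, hγ, hβ]
    push_cast
    ring
  rw [hz', hquad] at hid
  have hRS : (R : ℂ) * z + S = 0 := by linear_combination -hid
  have him := congrArg Complex.im hRS
  have hre := congrArg Complex.re hRS
  simp only [Complex.add_im, Complex.mul_im, Complex.ofReal_re, Complex.ofReal_im, zero_mul,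
    add_zero, Complex.zero_im, Complex.add_re, Complex.mul_re, sub_zero, Complex.zero_re] at him hre
  have hR0 : R = 0 := (mul_eq_zero.1 him).resolve_right hb
  have hS0 : S = 0 := by rw [hR0] at hre; linarith
  refine ⟨a, b, v 0, β, γ, hb, fun x y => ?_⟩
  rw [quartic_mk]
  have e3 : v 3 = (a ^ 2 + b ^ 2) * β - 2 * a * γ := by rw [hR] at hR0; linarith
  have e4 : v 4 = (a ^ 2 + b ^ 2) * γ := by rw [hS] at hS0; linarith
  have e2 : v 2 = γ - 2 * a * β + (a ^ 2 + b ^ 2) * v 0 := by rw [hγ]; ring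
  have e1 : v 1 = β - 2 * a * v 0 := by rw [hβ]; ring
  rw [e3, e4, e2, e1]
  ring

/-- The coefficient of $xy$ after rotation by $\theta$ takes opposite values at $0$ and $\pi/2$, so
it vanishes at an intermediate angle. -/
theorem exists_rotation (α β γ : ℝ) : ∃ c s α' γ' : ℝ, c ^ 2 + s ^ 2 = 1 ∧ ∀ x y : ℝ,
    α * (c * x + -s * y) ^ 2 + β * (c * x + -s * y) * (s * x + c * y) + γ * (s * x + c * y) ^ 2 =
      α' * x ^ 2 + γ' * y ^ 2 := by
  set F : ℝ → ℝ := fun θ => β * (Real.cos θ ^ 2 - Real.sin θ ^ 2) +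
    2 * (γ - α) * (Real.cos θ * Real.sin θ) with hF
  have hc : Continuous F := by fun_prop
  have h0 : F 0 = β := by simp [hF]
  have h1 : F (Real.pi / 2) = -β := by simp [hF]
  have : (0 : ℝ) ∈ Set.uIcc (F 0) (F (Real.pi / 2)) := by
    rw [h0, h1, Set.mem_uIcc]
    rcases le_total 0 β with h | h
    · exact Or.inr ⟨by linarith, h⟩
    · exact Or.inl ⟨h, by linarith⟩
  obtain ⟨θ, -, hθ⟩ := intermediate_value_uIcc hc.continuousOn this
  set c := Real.cos θ
  set s := Real.sin θ
  refine ⟨c, s, α * c ^ 2 + β * c * s + γ * s ^ 2, α * s ^ 2 - β * c * s + γ * c ^ 2,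
    Real.cos_sq_add_sin_sq θ, fun x y => ?_⟩
  have hθ' : β * (c ^ 2 - s ^ 2) + 2 * (γ - α) * (c * s) = 0 := hθ
  linear_combination x * y * hθ'

/-- An affine substitution turns one quadratic factor into a multiple of $x^2+y^2$; a rotation
preserves that factor and diagonalizes the other. -/
theorem exists_diagonal {v : Fin 5 → ℝ} (hv : v ∈ posCone) :
    ∃ (g : SL(2, ℝ)) (α γ : ℝ), ∀ x y : ℝ, quartic v (g • ![x, y]) =
      (x ^ 2 + y ^ 2) * (α * x ^ 2 + γ * y ^ 2) := by
  obtain ⟨a, b, α, β, γ, hb, hf⟩ := exists_factorization hv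
  set s := Real.sqrt |b| with hs
  have hb' : 0 < |b| := abs_pos.2 hb
  have hs0 : 0 < s := Real.sqrt_pos.2 hb'
  have hs2 : s ^ 2 = |b| := Real.sq_sqrt hb'.le
  have hs4 : s ^ 4 = b ^ 2 := by
    rw [show s ^ 4 = (s ^ 2) ^ 2 by ring, hs2, sq_abs]
  have hdet : s * s⁻¹ - (a * s⁻¹) * 0 = 1 := by
    rw [mul_inv_cancel₀ hs0.ne']; ring
  set g₁ := sl2 s (a * s⁻¹) 0 s⁻¹ hdet with hg₁
  obtain ⟨c, t, α', γ', hct, hrot⟩ := exists_rotation (s ^ 2 * (α * s ^ 2))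
    (s ^ 2 * (2 * α * a + β)) (s ^ 2 * ((α * a ^ 2 + β * a + γ) * s⁻¹ ^ 2))
  refine ⟨g₁ * sl2 c (-t) t c (by linear_combination hct), α', γ', fun x y => ?_⟩
  rw [mul_smul, sl2_smul, hg₁, sl2_smul, hf]
  have h1 := hrot x y
  have hinv : s * s⁻¹ = 1 := mul_inv_cancel₀ hs0.ne'
  set X := c * x + -t * y
  set Y := t * x + c * y
  have hXY : X ^ 2 + Y ^ 2 = x ^ 2 + y ^ 2 := by
    simp only [X, Y]
    linear_combination (x ^ 2 + y ^ 2) * hct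
  rw [← h1, ← hXY]
  have e1 : (s * X + a * s⁻¹ * Y - a * (0 * X + s⁻¹ * Y)) ^ 2 + b ^ 2 * (0 * X + s⁻¹ * Y) ^ 2 =
      s ^ 2 * (X ^ 2 + Y ^ 2) := by
    rw [← hs4]
    field_simp
    ring
  rw [e1]
  have e2 : α * (s * X + a * s⁻¹ * Y) ^ 2 + β * (s * X + a * s⁻¹ * Y) * (0 * X + s⁻¹ * Y) +
      γ * (0 * X + s⁻¹ * Y) ^ 2 = α * s ^ 2 * X ^ 2 + (2 * α * a + β) * X * Y +
        (α * a ^ 2 + β * a + γ) * s⁻¹ ^ 2 * Y ^ 2 := by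
    linear_combination (2 * α * a + β) * X * Y * hinv
  rw [e2]
  ring

/-- Every positive definite quartic form is equivalent under `SL₂(ℝ)` to a positive multiple of
`x⁴ + 6 c x² y² + y⁴` with `-1/3 < c ≤ 1/3`. -/
theorem exists_normalForm {v : Fin 5 → ℝ} (hv : v ∈ posCone) :
    ∃ (g : SL(2, ℝ)) (l c : ℝ), 0 < l ∧ -(1 / 3) < c ∧ c ≤ 1 / 3 ∧
      rho g • v = l • normalForm c := by
  obtain ⟨g, α, γ, hg⟩ := exists_diagonal hv
  have hα : 0 < α := by
    have h1 := hv (g • ![1, 0]) (sl2_smul_ne_zero g (vec2_ne_zero.2 (Or.inl one_ne_zero)))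
    rw [hg] at h1
    linarith
  have hγ : 0 < γ := by
    have h1 := hv (g • ![0, 1]) (sl2_smul_ne_zero g (vec2_ne_zero.2 (Or.inr one_ne_zero)))
    rw [hg] at h1
    linarith
  set p := Real.sqrt α
  set q := Real.sqrt γ
  have hp : 0 < p := Real.sqrt_pos.2 hα
  have hq : 0 < q := Real.sqrt_pos.2 hγ
  have hpα : α = p ^ 2 := (Real.sq_sqrt hα.le).symm
  have hqγ : γ = q ^ 2 := (Real.sq_sqrt hγ.le).symm
  -- The fourth root of $q/p$, so that the substitution $(mX,m^{-1}Y)$ makes the two extreme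
  -- coefficients equal.
  set m := Real.sqrt (Real.sqrt (q / p))
  have hqp : 0 < q / p := by positivity
  have hm : 0 < m := Real.sqrt_pos.2 (Real.sqrt_pos.2 hqp)
  have hm4 : m ^ 4 = q / p := by
    rw [show m ^ 4 = (m ^ 2) ^ 2 by ring, Real.sq_sqrt (Real.sqrt_nonneg _), Real.sq_sqrt hqp.le]
  have hm4' : m⁻¹ ^ 4 = p / q := by rw [inv_pow, hm4, inv_div]
  have hmm : m * m⁻¹ = 1 := mul_inv_cancel₀ hm.ne'
  set r := Real.sqrt (1 / 2)
  have hr : r ^ 2 = 1 / 2 := Real.sq_sqrt (by norm_num)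
  -- After rescaling, the parameter is at least $1/3$ by the arithmetic-geometric inequality. The
  -- rotation by $\pi/4$ replaces $c$ by $(1-c)/(1+3c)$, which maps $[1/3,\infty)$ onto
  -- $(-1/3,1/3]$.
  set G := g * (sl2 m 0 0 m⁻¹ (by rw [hmm]; ring) * sl2 r (-r) r r (by linear_combination 2 * hr))
  set c := (p ^ 2 + q ^ 2) / (6 * (p * q)) with hc
  have hpq : 0 < p * q := by positivity
  have hc3 : 1 / 3 ≤ c := by
    rw [hc, le_div_iff₀ (by positivity)]
    nlinarith [sq_nonneg (p - q)]
  have hden : 0 < 1 + 3 * c := by linarith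
  refine ⟨G⁻¹, p * q * (1 + 3 * c) / 2, (1 - c) / (1 + 3 * c), by positivity, ?_, ?_, ?_⟩
  · rw [lt_div_iff₀ hden]; linarith
  · rw [div_le_iff₀ hden]; linarith
  apply quartic_ext
  intro x y
  rw [quartic_rho_inv, quartic_smul, quartic_normalForm, mul_smul, mul_smul, sl2_smul, sl2_smul, hg]
  have key : ∀ X Y : ℝ, ((m * X + 0 * Y) ^ 2 + (0 * X + m⁻¹ * Y) ^ 2) *
      (α * (m * X + 0 * Y) ^ 2 + γ * (0 * X + m⁻¹ * Y) ^ 2) =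
        p * q * (X ^ 4 + 6 * c * X ^ 2 * Y ^ 2 + Y ^ 4) := by
    intro X Y
    have e1 : ((m * X + 0 * Y) ^ 2 + (0 * X + m⁻¹ * Y) ^ 2) *
      (α * (m * X + 0 * Y) ^ 2 + γ * (0 * X + m⁻¹ * Y) ^ 2) =
        α * m ^ 4 * X ^ 4 + (α + γ) * (m * m⁻¹) ^ 2 * X ^ 2 * Y ^ 2 + γ * m⁻¹ ^ 4 * Y ^ 4 := by ring
    rw [e1, hm4, hm4', hmm, hpα, hqγ, hc]
    field_simp
  rw [key]
  have e2 : (r * x + -r * y) ^ 4 + 6 * c * (r * x + -r * y) ^ 2 * (r * x + r * y) ^ 2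
      + (r * x + r * y) ^ 4 = (r ^ 2) ^ 2 *
        ((x - y) ^ 4 + 6 * c * (x - y) ^ 2 * (x + y) ^ 2 + (x + y) ^ 4) := by ring
  rw [e2, hr]
  field_simp
  ring

end HilbertGeom

namespace HilbertGeom

/-! ### The pencil of ternary quadratic forms attached to a quartic form -/

/-- The pencil of ternary quadratic forms (catalecticant plus `t` times the invariant form
`4 z₀ z₂ - z₁²`) attached to the quartic form `v`. -/
noncomputable def pencilForm (v : Fin 5 → ℝ) (t : ℝ) (z : Fin 3 → ℝ) : ℝ :=
  v 0 * z 0 ^ 2 + v 1 / 2 * (z 0 * z 1) + v 2 / 6 * (z 1 ^ 2 + 2 * z 0 * z 2)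
    + v 3 / 2 * (z 1 * z 2) + v 4 * z 2 ^ 2 + t * (4 * z 0 * z 2 - z 1 ^ 2)

theorem pencilForm_mk (v : Fin 5 → ℝ) (t x y z : ℝ) : pencilForm v t ![x, y, z] =
    v 0 * x ^ 2 + v 1 / 2 * (x * y) + v 2 / 6 * (y ^ 2 + 2 * x * z)
    + v 3 / 2 * (y * z) + v 4 * z ^ 2 + t * (4 * x * z - y ^ 2) := by
  simp [pencilForm]

theorem pencilForm_add (v w : Fin 5 → ℝ) (t s : ℝ) (z : Fin 3 → ℝ) :
    pencilForm (v + w) (t + s) z = pencilForm v t z + pencilForm w s z := by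
  simp only [pencilForm, Pi.add_apply]; ring

theorem pencilForm_smul (c : ℝ) (v : Fin 5 → ℝ) (t : ℝ) (z : Fin 3 → ℝ) :
    pencilForm (c • v) (c * t) z = c * pencilForm v t z := by
  simp only [pencilForm, Pi.smul_apply, smul_eq_mul]; ring

theorem pencilForm_smul_right (v : Fin 5 → ℝ) (t c : ℝ) (z : Fin 3 → ℝ) :
    pencilForm v t (c • z) = c ^ 2 * pencilForm v t z := by
  simp only [pencilForm, Pi.smul_apply, smul_eq_mul]; ring

theorem continuous_pencilForm :
    Continuous fun p : ((Fin 5 → ℝ) × ℝ) × (Fin 3 → ℝ) => pencilForm p.1.1 p.1.2 p.2 := by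
  simp only [pencilForm]
  fun_prop

/-- The conic is the zero locus of the invariant form, so $t$ disappears: positivity of any one
member of the pencil gives positivity of the quartic. -/
theorem pencilForm_sq (v : Fin 5 → ℝ) (t x y : ℝ) :
    pencilForm v t ![x ^ 2, 2 * x * y, y ^ 2] = quartic v ![x, y] := by
  rw [pencilForm_mk, quartic_mk]; ring

/-- The symmetric square of the standard representation. -/
def symSq (g : SL(2, ℝ)) (z : Fin 3 → ℝ) : Fin 3 → ℝ :=
  ![g 0 0 ^ 2 * z 0 + g 0 0 * g 0 1 * z 1 + g 0 1 ^ 2 * z 2,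
    2 * g 0 0 * g 1 0 * z 0 + (g 0 0 * g 1 1 + g 0 1 * g 1 0) * z 1 + 2 * g 0 1 * g 1 1 * z 2,
    g 1 0 ^ 2 * z 0 + g 1 0 * g 1 1 * z 1 + g 1 1 ^ 2 * z 2]

theorem sl2_det (g : SL(2, ℝ)) : g 0 0 * g 1 1 - g 0 1 * g 1 0 = 1 := by
  have h := g.det_coe
  rwa [Matrix.det_fin_two] at h

theorem symSq_inv_symSq (g : SL(2, ℝ)) (z : Fin 3 → ℝ) : symSq g⁻¹ (symSq g z) = z := by
  have h := sl2_det g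
  have e : g⁻¹ 0 0 = g 1 1 ∧ g⁻¹ 0 1 = -g 0 1 ∧ g⁻¹ 1 0 = -g 1 0 ∧ g⁻¹ 1 1 = g 0 0 := by
    rw [Matrix.SpecialLinearGroup.SL2_inv_expl]
    simp
  obtain ⟨e1, e2, e3, e4⟩ := e
  ext i
  fin_cases i <;> simp only [symSq, e1, e2, e3, e4] <;> simp
  · linear_combination (z 0 * (g 0 0 * g 1 1 - g 0 1 * g 1 0 + 1)) * h
  · linear_combination (z 1 * (g 0 0 * g 1 1 - g 0 1 * g 1 0 + 1)) * h
  · linear_combination (z 2 * (g 0 0 * g 1 1 - g 0 1 * g 1 0 + 1)) * h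

theorem symSq_ne_zero (g : SL(2, ℝ)) {z : Fin 3 → ℝ} (hz : z ≠ 0) : symSq g z ≠ 0 := by
  intro h
  apply hz
  rw [← symSq_inv_symSq g z, h]
  ext i
  fin_cases i <;> simp [symSq]

theorem rho_inv_coeff (g : SL(2, ℝ)) (v : Fin 5 → ℝ) : rho g⁻¹ • v =
    substMatrix (g 0 0) (g 0 1) (g 1 0) (g 1 1) *ᵥ v := by
  have e : g⁻¹ 0 0 = g 1 1 ∧ g⁻¹ 0 1 = -g 0 1 ∧ g⁻¹ 1 0 = -g 1 0 ∧ g⁻¹ 1 1 = g 0 0 := by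
    rw [Matrix.SpecialLinearGroup.SL2_inv_expl]
    simp
  change substMatrix (g⁻¹ 1 1) (-g⁻¹ 0 1) (-g⁻¹ 1 0) (g⁻¹ 0 0) *ᵥ v = _
  rw [e.1, e.2.1, e.2.2.1, e.2.2.2, neg_neg, neg_neg]

/-- The catalecticant is equivariant, and the invariant form is multiplied by the square of the
determinant, which is $1$. Hence the same $t$ serves along a whole orbit. -/
theorem pencilForm_rho_inv (g : SL(2, ℝ)) (v : Fin 5 → ℝ) (t : ℝ) (z : Fin 3 → ℝ) :
    pencilForm (rho g⁻¹ • v) t z = pencilForm v t (symSq g z) := by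
  have h := sl2_det g
  rw [rho_inv_coeff]
  simp only [pencilForm, symSq, substMatrix, Matrix.mulVec, dotProduct, Fin.sum_univ_five]
  simp
  linear_combination (-t * (4 * z 0 * z 2 - z 1 ^ 2) * (g 0 0 * g 1 1 - g 0 1 * g 1 0 + 1)) * h

theorem pencilForm_rho (g : SL(2, ℝ)) (v : Fin 5 → ℝ) (t : ℝ) (z : Fin 3 → ℝ) :
    pencilForm (rho g • v) t z = pencilForm v t (symSq g⁻¹ z) := by
  rw [← pencilForm_rho_inv, inv_inv]

/-- A positive semidefinite form of the pencil which vanishes at `z` has `z` in its kernel. -/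
theorem pencilForm_kernel {v : Fin 5 → ℝ} {t : ℝ} (h : ∀ z, 0 ≤ pencilForm v t z)
    {z : Fin 3 → ℝ} (hz : pencilForm v t z = 0) :
    v 0 * z 0 + v 1 / 4 * z 1 + (v 2 / 6 + 2 * t) * z 2 = 0 ∧
    v 1 / 4 * z 0 + (v 2 / 6 - t) * z 1 + v 3 / 4 * z 2 = 0 ∧
    (v 2 / 6 + 2 * t) * z 0 + v 3 / 4 * z 1 + v 4 * z 2 = 0 := by
  have key : ∀ u : Fin 3 → ℝ, ∀ b : ℝ, (∀ s : ℝ, pencilForm v t (z + s • u) =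
      pencilForm v t z + 2 * s * b + s ^ 2 * pencilForm v t u) → b = 0 := by
    intro u b hb
    by_contra hne
    set q := pencilForm v t u
    have hq : 0 ≤ q := h u
    -- The denominator is `q + 1` rather than `q` to cover `q = 0`; the value at this point is
    -- negative unless `b` vanishes.
    have := h (z + (-b / (q + 1)) • u)
    rw [hb, hz] at this
    have h1 : 0 + 2 * (-b / (q + 1)) * b + (-b / (q + 1)) ^ 2 * q =
        -(b ^ 2 * (q + 2)) / (q + 1) ^ 2 := by
      field_simp
      ring
    rw [h1] at this
    have hb2 : 0 < b ^ 2 := by positivity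
    have : -(b ^ 2 * (q + 2)) / (q + 1) ^ 2 < 0 := by
      apply div_neg_of_neg_of_pos
      · nlinarith
      · positivity
    linarith
  refine ⟨key ![1, 0, 0] _ fun s => ?_, key ![0, 1, 0] _ fun s => ?_, key ![0, 0, 1] _ fun s => ?_⟩
  all_goals simp [pencilForm]; ring

/-- Quartic forms with a positive definite catalecticant are convex. -/
theorem convexOn_quartic {v : Fin 5 → ℝ} (h : ∀ z, 0 ≤ pencilForm v 0 z) :
    ConvexOn ℝ Set.univ (quartic v) := by
  refine ⟨convex_univ, fun x _ y _ a b ha hb hab => ?_⟩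
  set c0 := y 0 - x 0 with hc0
  set c1 := y 1 - x 1 with hc1
  set F : ℝ → ℝ := fun s => v 0 * (x 0 + s * c0) ^ 4 + v 1 * (x 0 + s * c0) ^ 3 * (x 1 + s * c1)
    + v 2 * (x 0 + s * c0) ^ 2 * (x 1 + s * c1) ^ 2 + v 3 * (x 0 + s * c0) * (x 1 + s * c1) ^ 3
    + v 4 * (x 1 + s * c1) ^ 4 with hF
  set F' : ℝ → ℝ := fun s => v 0 * (4 * (x 0 + s * c0) ^ 3 * c0)
    + v 1 * (3 * (x 0 + s * c0) ^ 2 * c0 * (x 1 + s * c1) + (x 0 + s * c0) ^ 3 * c1)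
    + v 2 * (2 * (x 0 + s * c0) * c0 * (x 1 + s * c1) ^ 2
      + (x 0 + s * c0) ^ 2 * (2 * (x 1 + s * c1) * c1))
    + v 3 * (c0 * (x 1 + s * c1) ^ 3 + (x 0 + s * c0) * (3 * (x 1 + s * c1) ^ 2 * c1))
    + v 4 * (4 * (x 1 + s * c1) ^ 3 * c1) with hF'
  -- The second derivative of a quartic at $w$ in the direction $c$ is twelve times its
  -- catalecticant at the symmetric product of $w$ and $c$.
  set F'' : ℝ → ℝ := fun s => 12 * pencilForm v 0 ![(x 0 + s * c0) * c0,
    (x 0 + s * c0) * c1 + (x 1 + s * c1) * c0, (x 1 + s * c1) * c1] with hF''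
  have hl : ∀ (p q s : ℝ), HasDerivAt (fun s => p + s * q) q s := fun p q s => by
    simpa using ((hasDerivAt_id s).mul_const q).const_add p
  have hd : ∀ s, HasDerivAt F (F' s) s := by
    intro s
    have h0 := hl (x 0) c0 s
    have h1 := hl (x 1) c1 s
    have := (((((h0.pow 4).const_mul (v 0)).add ((((h0.pow 3).const_mul (v 1))).mul h1)).add
      (((h0.pow 2).const_mul (v 2)).mul (h1.pow 2))).add ((h0.const_mul (v 3)).mul (h1.pow 3))).add
      ((h1.pow 4).const_mul (v 4))
    exact HasDerivAt.congr_deriv (f := F) this (by simp [hF']; ring)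
  have hd' : ∀ s, HasDerivAt F' (F'' s) s := by
    intro s
    have h0 := hl (x 0) c0 s
    have h1 := hl (x 1) c1 s
    have := ((((((h0.pow 3).const_mul 4).mul_const c0).const_mul (v 0)).add
      (((((((h0.pow 2).const_mul 3).mul_const c0).mul h1).add
        ((h0.pow 3).mul_const c1)).const_mul (v 1)))).add
      (((((h0.const_mul 2).mul_const c0).mul (h1.pow 2)).add
        ((h0.pow 2).mul ((h1.const_mul 2).mul_const c1))).const_mul (v 2))).add
      ((((h1.pow 3).const_mul c0).add (h0.mul (((h1.pow 2).const_mul 3).mul_const c1))).const_mul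
        (v 3))
    have := this.add ((((h1.pow 3).const_mul 4).mul_const c1).const_mul (v 4))
    exact HasDerivAt.congr_deriv (f := F') this (by simp [hF'', pencilForm]; ring)
  have hconv : ConvexOn ℝ Set.univ F := by
    apply convexOn_of_hasDerivWithinAt2_nonneg (f' := F') (f'' := F'') convex_univ
    · exact fun s _ => (hd s).continuousAt.continuousWithinAt
    · exact fun s _ => (hd s).hasDerivWithinAt
    · exact fun s _ => (hd' s).hasDerivWithinAt
    · intro s _
      have := h ![(x 0 + s * c0) * c0,
        (x 0 + s * c0) * c1 + (x 1 + s * c1) * c0, (x 1 + s * c1) * c1]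
      simp only [hF'']
      positivity
  have := hconv.2 (Set.mem_univ 0) (Set.mem_univ 1) ha hb hab
  have e0 : F 0 = quartic v x := by simp [hF, quartic_apply]
  have e1 : F 1 = quartic v y := by simp [hF, quartic_apply, hc0, hc1]
  have e2 : F (a • 0 + b • 1) = quartic v (a • x + b • y) := by
    have ha' : a = 1 - b := by linarith
    simp only [hF, quartic_apply, hc0, hc1, Pi.add_apply, Pi.smul_apply, smul_eq_mul, ha']
    ring
  rwa [e0, e1, e2] at this

theorem nonneg_of_convexOn {v : Fin 5 → ℝ} (h : ConvexOn ℝ Set.univ (quartic v))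
    (w : Fin 2 → ℝ) : 0 ≤ quartic v w := by
  have h1 := h.2 (Set.mem_univ w) (Set.mem_univ (-w)) (by norm_num : (0 : ℝ) ≤ 1 / 2)
    (by norm_num : (0 : ℝ) ≤ 1 / 2) (by norm_num)
  have h2 : quartic v (-w) = quartic v w := by
    simp only [quartic_apply, Pi.neg_apply]; ring
  have h3 : quartic v ((1 / 2 : ℝ) • w + (1 / 2 : ℝ) • -w) = 0 := by
    simp [quartic_apply]
  rw [h2, h3] at h1
  simp only [smul_eq_mul] at h1
  linarith

/-- This coefficient is half the second derivative at $(1,0)$ in the direction $(0,1)$. It is read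
off from the midpoint inequality at $(1,\pm\sqrt s)$, divided by $s$, as $s\to 0$. -/
theorem convexOn_coeff_nonneg {v : Fin 5 → ℝ} (h : ConvexOn ℝ Set.univ (quartic v)) :
    0 ≤ v 2 := by
  have key : ∀ s : ℝ, 0 < s → 0 ≤ v 2 + v 4 * s := by
    intro s hs
    have h1 := h.2 (Set.mem_univ ![1, Real.sqrt s]) (Set.mem_univ ![1, -Real.sqrt s])
      (by norm_num : (0 : ℝ) ≤ 1 / 2) (by norm_num : (0 : ℝ) ≤ 1 / 2) (by norm_num)
    have h3 : ((1 / 2 : ℝ) • ![1, Real.sqrt s] + (1 / 2 : ℝ) • ![1, -Real.sqrt s] : Fin 2 → ℝ) =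
        ![1, 0] := by
      ext i; fin_cases i
      · norm_num
      · simp
    rw [h3, quartic_mk, quartic_mk, quartic_mk] at h1
    simp only [smul_eq_mul] at h1
    have h2 : Real.sqrt s ^ 2 = s := Real.sq_sqrt hs.le
    have h4 : Real.sqrt s ^ 4 = s ^ 2 := by
      rw [show Real.sqrt s ^ 4 = (Real.sqrt s ^ 2) ^ 2 by ring, h2]
    have h5 : 0 ≤ s * (v 2 + v 4 * s) := by
      ring_nf at h1
      rw [h2, h4] at h1
      linarith
    exact nonneg_of_mul_nonneg_right h5 hs
  have hc : Filter.Tendsto (fun s : ℝ => v 2 + v 4 * s) (𝓝[>] 0) (𝓝 (v 2)) := by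
    have : Continuous fun s : ℝ => v 2 + v 4 * s := by fun_prop
    have := this.tendsto 0
    rw [mul_zero, add_zero] at this
    exact this.mono_left nhdsWithin_le_nhds
  exact ge_of_tendsto hc (eventually_nhdsWithin_of_forall key)

theorem convexOn_rho (g : SL(2, ℝ)) {v : Fin 5 → ℝ} (h : ConvexOn ℝ Set.univ (quartic v)) :
    ConvexOn ℝ Set.univ (quartic (rho g • v)) := by
  refine ⟨convex_univ, fun x _ y _ a b ha hb hab => ?_⟩
  rw [quartic_rho, quartic_rho, quartic_rho, smul_add, smul_comm, smul_comm g⁻¹ b]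
  exact h.2 (Set.mem_univ _) (Set.mem_univ _) ha hb hab

/-! ### The invariant cone between convex and nonnegative forms -/

/-- The cone of the quartic forms having two positive definite forms in their pencil, for parameters
`t` and `t / 2`. -/
def midCone : Set (Fin 5 → ℝ) :=
  {v | ∃ t : ℝ, (∀ z, z ≠ 0 → 0 < pencilForm v t z) ∧ ∀ z, z ≠ 0 → 0 < pencilForm v (t / 2) z}

theorem vec3_ne_zero {x y z : ℝ} (h : x ≠ 0 ∨ y ≠ 0 ∨ z ≠ 0) : (![x, y, z] : Fin 3 → ℝ) ≠ 0 := by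
  intro h0
  have h1 := congrFun h0 0
  have h2 := congrFun h0 1
  have h3 := congrFun h0 2
  simp at h1 h2 h3
  tauto

theorem isOpen_pencilForm_pos (t : ℝ) :
    IsOpen {v : Fin 5 → ℝ | ∀ z, z ≠ 0 → 0 < pencilForm v t z} :=
  isOpen_setOf_pos (k := 2) (continuous_pencilForm.comp
    (by fun_prop : Continuous fun p : (Fin 5 → ℝ) × (Fin 3 → ℝ) => ((p.1, t), p.2)))
    fun v c z => pencilForm_smul_right v t c z

theorem isOpen_midCone : IsOpen midCone := by
  have : midCone = ⋃ t : ℝ, {v : Fin 5 → ℝ | ∀ z, z ≠ 0 → 0 < pencilForm v t z} ∩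
      {v : Fin 5 → ℝ | ∀ z, z ≠ 0 → 0 < pencilForm v (t / 2) z} := by
    ext v
    simp [midCone]
  rw [this]
  exact isOpen_iUnion fun t => (isOpen_pencilForm_pos t).inter (isOpen_pencilForm_pos (t / 2))

theorem midCone_subset_posCone : midCone ⊆ posCone := by
  rintro v ⟨t, h, -⟩ w hw
  rw [vec2_eta w] at hw ⊢
  rw [← pencilForm_sq v t]
  apply h
  apply vec3_ne_zero
  rcases vec2_ne_zero.1 hw with h | h
  · exact Or.inl (pow_ne_zero 2 h)
  · exact Or.inr (Or.inr (pow_ne_zero 2 h))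

theorem rho_smul_mem_midCone (g : SL(2, ℝ)) {v : Fin 5 → ℝ} (hv : v ∈ midCone) :
    rho g • v ∈ midCone := by
  obtain ⟨t, h1, h2⟩ := hv
  refine ⟨t, fun z hz => ?_, fun z hz => ?_⟩
  · rw [pencilForm_rho]
    exact h1 _ (symSq_ne_zero _ hz)
  · rw [pencilForm_rho]
    exact h2 _ (symSq_ne_zero _ hz)

theorem rho_smul_mem_closure_midCone (g : SL(2, ℝ)) {v : Fin 5 → ℝ} (hv : v ∈ closure midCone) :
    rho g • v ∈ closure midCone :=
  map_mem_closure (continuous_rho_smul g) hv fun _ h => rho_smul_mem_midCone g h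

theorem rho_smul_mem_midCone_iff (g : SL(2, ℝ)) {v : Fin 5 → ℝ} :
    rho g • v ∈ midCone ↔ v ∈ midCone := by
  refine ⟨fun h => ?_, rho_smul_mem_midCone g⟩
  rw [← rho_inv_smul g v]
  exact rho_smul_mem_midCone _ h

theorem smul_mem_midCone {c : ℝ} (hc : 0 < c) {v : Fin 5 → ℝ} (hv : v ∈ midCone) :
    c • v ∈ midCone := by
  obtain ⟨t, h1, h2⟩ := hv
  refine ⟨c * t, fun z hz => ?_, fun z hz => ?_⟩
  · rw [pencilForm_smul]
    exact mul_pos hc (h1 z hz)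
  · rw [mul_div_assoc, pencilForm_smul]
    exact mul_pos hc (h2 z hz)

theorem smul_mem_midCone_iff {c : ℝ} (hc : 0 < c) {v : Fin 5 → ℝ} :
    c • v ∈ midCone ↔ v ∈ midCone := by
  refine ⟨fun h => ?_, smul_mem_midCone hc⟩
  have := smul_mem_midCone (inv_pos.2 hc) h
  rwa [smul_smul, inv_mul_cancel₀ hc.ne', one_smul] at this

theorem pencilForm_normalForm (c t x y z : ℝ) : pencilForm (normalForm c) t ![x, y, z] =
    x ^ 2 + z ^ 2 + 2 * (c + 2 * t) * (x * z) + (c - t) * y ^ 2 := by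
  rw [pencilForm_mk]
  simp [normalForm]
  ring

theorem vec3_eta (z : Fin 3 → ℝ) : z = ![z 0, z 1, z 2] := by
  ext i; fin_cases i <;> rfl

theorem pencilForm_normalForm_pos {c t : ℝ} (h1 : -1 < c + 2 * t) (h2 : c + 2 * t < 1)
    (h3 : t < c) : ∀ z, z ≠ 0 → 0 < pencilForm (normalForm c) t z := by
  intro z hz
  rw [vec3_eta z, pencilForm_normalForm]
  have hs : 0 ≤ (c - t) * z 1 ^ 2 := mul_nonneg (by linarith) (sq_nonneg _)
  have e : z 0 ^ 2 + z 2 ^ 2 + 2 * (c + 2 * t) * (z 0 * z 2) =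
    (1 + (c + 2 * t)) / 2 * (z 0 + z 2) ^ 2 + (1 - (c + 2 * t)) / 2 * (z 0 - z 2) ^ 2 := by ring
  have p1 : 0 ≤ (1 + (c + 2 * t)) / 2 * (z 0 + z 2) ^ 2 :=
    mul_nonneg (by linarith) (sq_nonneg _)
  have p2 : 0 ≤ (1 - (c + 2 * t)) / 2 * (z 0 - z 2) ^ 2 :=
    mul_nonneg (by linarith) (sq_nonneg _)
  rw [e]
  by_contra! hle
  have q1 : (1 + (c + 2 * t)) / 2 * (z 0 + z 2) ^ 2 = 0 := by linarith
  have q2 : (1 - (c + 2 * t)) / 2 * (z 0 - z 2) ^ 2 = 0 := by linarith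
  have q3 : (c - t) * z 1 ^ 2 = 0 := by linarith
  have r1 : z 0 + z 2 = 0 := by
    rcases mul_eq_zero.1 q1 with h | h
    · linarith
    · exact pow_eq_zero_iff (two_ne_zero) |>.1 h
  have r2 : z 0 - z 2 = 0 := by
    rcases mul_eq_zero.1 q2 with h | h
    · linarith
    · exact pow_eq_zero_iff (two_ne_zero) |>.1 h
  have r3 : z 1 = 0 := by
    rcases mul_eq_zero.1 q3 with h | h
    · linarith
    · exact pow_eq_zero_iff (two_ne_zero) |>.1 h
  apply hz
  ext i
  fin_cases i <;> simp <;> linarith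

/-- The values of $Q_t$ at $(1,0,1)$ and of $Q_{t/2}$ at $(0,1,0)$ impose $-(1+c)/2<t<2c$; this
interval is nonempty exactly when $c>-1/5$. -/
theorem normalForm_mem_midCone_iff {c : ℝ} (hc : c ≤ 1 / 3) :
    normalForm c ∈ midCone ↔ -(1 / 5) < c := by
  constructor
  · rintro ⟨t, h1, h2⟩
    have a1 := h1 ![1, 0, -1] (vec3_ne_zero (Or.inl one_ne_zero))
    have a2 := h1 ![1, 0, 1] (vec3_ne_zero (Or.inl one_ne_zero))
    have a3 := h2 ![0, 1, 0] (vec3_ne_zero (Or.inr (Or.inl one_ne_zero)))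
    rw [pencilForm_normalForm] at a1 a2 a3
    linarith
  · intro h
    by_cases h0 : 0 < c
    · refine ⟨0, pencilForm_normalForm_pos ?_ ?_ ?_, pencilForm_normalForm_pos ?_ ?_ ?_⟩ <;> linarith
    -- The midpoint of the interval $(-(1+c)/2,2c)$ of admissible parameters.
    · refine ⟨(-(1 + c) / 2 + 2 * c) / 2, pencilForm_normalForm_pos ?_ ?_ ?_,
        pencilForm_normalForm_pos ?_ ?_ ?_⟩ <;> linarith

theorem midCone_isSharpCone : IsSharpCone midCone meanForm where
  isOpen := isOpen_midCone
  nonempty := ⟨_, (normalForm_mem_midCone_iff (c := 0) (by norm_num)).2 (by norm_num)⟩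
  add_mem := by
    rintro v ⟨t, h1, h2⟩ w ⟨s, h3, h4⟩
    refine ⟨t + s, fun z hz => ?_, fun z hz => ?_⟩
    · rw [pencilForm_add]
      exact add_pos (h1 z hz) (h3 z hz)
    · rw [add_div, pencilForm_add]
      exact add_pos (h2 z hz) (h4 z hz)
  smul_mem c hc v hv := smul_mem_midCone hc hv
  pos v hv h0 := posCone_isSharpCone.pos v (closure_mono midCone_subset_posCone hv) h0

/-- Along a sequence in the cone the parameters stay bounded, by evaluation at $(0,1,0)$ and
$(1,0,1)$, so a subsequence converges and the inequalities pass to the limit. -/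
theorem exists_of_mem_closure_midCone {v : Fin 5 → ℝ} (hv : v ∈ closure midCone) :
    ∃ t : ℝ, (∀ z, 0 ≤ pencilForm v t z) ∧ ∀ z, 0 ≤ pencilForm v (t / 2) z := by
  obtain ⟨u, hu, hlim⟩ := mem_closure_iff_seq_limit.1 hv
  choose t h1 h2 using hu
  have hb1 : ∀ n, t n ≤ u n 2 / 6 := by
    intro n
    have := h1 n ![0, 1, 0] (vec3_ne_zero (Or.inr (Or.inl one_ne_zero)))
    rw [pencilForm_mk] at this
    norm_num at this
    linarith
  have hb2 : ∀ n, -(u n 0 + u n 2 / 3 + u n 4) / 4 ≤ t n := by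
    intro n
    have := h1 n ![1, 0, 1] (vec3_ne_zero (Or.inl one_ne_zero))
    rw [pencilForm_mk] at this
    norm_num at this
    linarith
  have hi : ∀ i, Filter.Tendsto (fun n => u n i) Filter.atTop (𝓝 (v i)) := fun i =>
    (continuous_apply i).continuousAt.tendsto.comp hlim
  have l1 : Filter.Tendsto (fun n => u n 2 / 6) Filter.atTop (𝓝 (v 2 / 6)) := (hi 2).div_const 6
  have l2 : Filter.Tendsto (fun n => -(u n 0 + u n 2 / 3 + u n 4) / 4) Filter.atTop
      (𝓝 (-(v 0 + v 2 / 3 + v 4) / 4)) :=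
    ((((hi 0).add ((hi 2).div_const 3)).add (hi 4)).neg).div_const 4
  obtain ⟨M, hM⟩ := l1.bddAbove_range
  obtain ⟨m, hm⟩ := l2.bddBelow_range
  have hmem : ∀ n, t n ∈ Set.Icc m M := fun n =>
    ⟨(hm ⟨n, rfl⟩).trans (hb2 n), (hb1 n).trans (hM ⟨n, rfl⟩)⟩
  obtain ⟨s, -, φ, hφ, hs⟩ := isCompact_Icc.tendsto_subseq hmem
  have hlim' := hlim.comp hφ.tendsto_atTop
  refine ⟨s, fun z => ?_, fun z => ?_⟩
  · have : Continuous fun p : (Fin 5 → ℝ) × ℝ => pencilForm p.1 p.2 z :=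
      continuous_pencilForm.comp (by fun_prop : Continuous
        fun p : (Fin 5 → ℝ) × ℝ => ((p.1, p.2), z))
    have h3 := (this.tendsto (v, s)).comp (hlim'.prodMk_nhds hs)
    refine ge_of_tendsto h3 (Filter.Eventually.of_forall fun n => ?_)
    by_cases hz : z = 0
    · simp [hz, pencilForm]
    · exact (h1 (φ n) z hz).le
  · have : Continuous fun p : (Fin 5 → ℝ) × ℝ => pencilForm p.1 (p.2 / 2) z :=
      continuous_pencilForm.comp (by fun_prop : Continuous
        fun p : (Fin 5 → ℝ) × ℝ => ((p.1, p.2 / 2), z))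
    have h3 := (this.tendsto (v, s)).comp (hlim'.prodMk_nhds hs)
    refine ge_of_tendsto h3 (Filter.Eventually.of_forall fun n => ?_)
    by_cases hz : z = 0
    · simp [hz, pencilForm]
    · exact (h2 (φ n) z hz).le

/-! ### Fourth powers and the boundary of the cone -/

/-- The fourth power of the linear form `a x + b y`. -/
def fourthPower (a b : ℝ) : Fin 5 → ℝ :=
  ![a ^ 4, 4 * a ^ 3 * b, 6 * a ^ 2 * b ^ 2, 4 * a * b ^ 3, b ^ 4]

theorem quartic_fourthPower (a b x y : ℝ) :
    quartic (fourthPower a b) ![x, y] = (a * x + b * y) ^ 4 := by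
  rw [quartic_mk]; simp [fourthPower]; ring

theorem rho_inv_fourthPower (g : SL(2, ℝ)) (a b : ℝ) : rho g⁻¹ • fourthPower a b =
    fourthPower (a * g 0 0 + b * g 1 0) (a * g 0 1 + b * g 1 1) := by
  apply quartic_ext
  intro x y
  rw [quartic_rho_inv, sl2_smul_mk, quartic_fourthPower, quartic_fourthPower]
  ring

theorem exists_sl2_col {x y : ℝ} (h : x ≠ 0 ∨ y ≠ 0) :
    ∃ g : SL(2, ℝ), g 0 0 = x ∧ g 1 0 = y := by
  have h2 : 0 < x ^ 2 + y ^ 2 := by rcases h with h | h <;> positivity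
  refine ⟨sl2 x (-y / (x ^ 2 + y ^ 2)) y (x / (x ^ 2 + y ^ 2)) ?_, rfl, rfl⟩
  field_simp
  ring

/-- A form of the closed cone without `x⁴` term is a multiple of `y⁴`. -/
theorem eq_fourthPower_of_coeff {u : Fin 5 → ℝ} (hu : u ∈ closure midCone) (hu0 : u 0 = 0) :
    u = u 4 • fourthPower 0 1 := by
  obtain ⟨t, h1, h2⟩ := exists_of_mem_closure_midCone hu
  have k1 := pencilForm_kernel h1 (z := ![1, 0, 0]) (by rw [pencilForm_mk, hu0]; ring)
  have k2 := pencilForm_kernel h2 (z := ![1, 0, 0]) (by rw [pencilForm_mk, hu0]; ring)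
  simp at k1 k2
  -- The vector $(1,0,0)$ lies in the kernels of both $Q_t$ and $Q_{t/2}$, whence $u_2/6+2t=0$ and
  -- $u_2/6+t=0$. Having two distinct parameters is what forces $u_2=t=0$ and excludes larger faces.
  have ht : t = 0 := by linarith
  have hu2 : u 2 = 0 := by linarith
  have k3 := pencilForm_kernel h1 (z := ![0, 1, 0]) (by rw [pencilForm_mk, hu2, ht]; ring)
  simp at k3
  ext i
  fin_cases i <;> simp [fourthPower] <;> linarith

theorem coeff_zero_nonneg {u : Fin 5 → ℝ} (hu : u ∈ closure midCone) : 0 ≤ u 0 := by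
  have := quartic_nonneg_of_mem_closure (closure_mono midCone_subset_posCone hu) ![1, 0]
  rw [quartic_mk] at this
  simpa using this

/-- A nonzero form in the closure of the cone that vanishes at a nonzero vector is equivalent to a
multiple of `y⁴`. -/
theorem exists_fourthPower {v : Fin 5 → ℝ} (hv : v ∈ closure midCone) (h0 : v ≠ 0)
    (hz : v ∉ posCone) : ∃ (g : SL(2, ℝ)) (l : ℝ), 0 < l ∧ rho g • v = l • fourthPower 0 1 := by
  have hnn := quartic_nonneg_of_mem_closure (closure_mono midCone_subset_posCone hv)
  have : ∃ w : Fin 2 → ℝ, w ≠ 0 ∧ quartic v w = 0 := by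
    simp only [posCone, Set.mem_ofPred_eq] at hz
    push Not at hz
    obtain ⟨w, hw, h⟩ := hz
    exact ⟨w, hw, le_antisymm h (hnn w)⟩
  obtain ⟨w, hw, hvw⟩ := this
  rw [vec2_eta w] at hw
  obtain ⟨g, hg0, hg1⟩ := exists_sl2_col (vec2_ne_zero.1 hw)
  have hgw : g • ![1, 0] = w := by
    rw [sl2_smul_mk, hg0, hg1]
    simpa using (vec2_eta w).symm
  set u := rho g⁻¹ • v with hu
  have huc : u ∈ closure midCone := rho_smul_mem_closure_midCone _ hv
  have hu0 : u 0 = 0 := by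
    have : quartic u ![1, 0] = 0 := by rw [hu, quartic_rho_inv, hgw, hvw]
    rw [quartic_mk] at this
    simpa using this
  have hu4 := eq_fourthPower_of_coeff huc hu0
  refine ⟨g⁻¹, u 4, ?_, hu4⟩
  have hnn4 : 0 ≤ u 4 := by
    have := quartic_nonneg_of_mem_closure (closure_mono midCone_subset_posCone huc) ![0, 1]
    rw [quartic_mk] at this
    simpa using this
  refine lt_of_le_of_ne hnn4 fun h => ?_
  rw [← h, zero_smul] at hu4
  exact rho_smul_ne_zero _ h0 hu4

/-- The boundary of the cone consists of two orbits (up to positive multiples). -/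
theorem boundary_cases {v : Fin 5 → ℝ} (hv : v ∈ closure midCone \ midCone) (h0 : v ≠ 0) :
    ∃ (g : SL(2, ℝ)) (l : ℝ), 0 < l ∧
      (rho g • v = l • normalForm (-(1 / 5)) ∨ rho g • v = l • fourthPower 0 1) := by
  by_cases hp : v ∈ posCone
  · obtain ⟨g, l, c, hl, hc1, hc2, hg⟩ := exists_normalForm hp
    refine ⟨g, l, hl, Or.inl ?_⟩
    have hcl : normalForm c ∈ closure midCone := by
      have := midCone_isSharpCone.closure_smul (inv_pos.2 hl) (rho_smul_mem_closure_midCone g hv.1)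
      rwa [hg, smul_smul, inv_mul_cancel₀ hl.ne', one_smul] at this
    have hn : normalForm c ∉ midCone := by
      rw [← smul_mem_midCone_iff hl, ← hg, rho_smul_mem_midCone_iff]
      exact hv.2
    rw [normalForm_mem_midCone_iff hc2, not_lt] at hn
    obtain ⟨t, h1, h2⟩ := exists_of_mem_closure_midCone hcl
    have a2 := h1 ![1, 0, -1]
    have a2' := h1 ![1, 0, 1]
    have a3 := h2 ![0, 1, 0]
    rw [pencilForm_normalForm] at a2 a2' a3
    -- Semidefiniteness gives the closed inequalities $-(1+c)/2\le t\le 2c$, hence $c\ge -1/5$; the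
    -- other inequality is `hn`.
    have : c = -(1 / 5) := by linarith
    rw [hg, this]
  · obtain ⟨g, l, hl, hg⟩ := exists_fourthPower hv.1 h0 hp
    exact ⟨g, l, hl, Or.inr hg⟩

end HilbertGeom

namespace HilbertGeom

/-! ### Cones with a differentiable boundary -/

/-- Everywhere differentiable convex functions are $C^1$, by monotonicity of slopes: subgradient
inequalities bound the derivative at a nearby point by difference quotients controlled by
differentiability at `a`. -/
theorem continuousOn_of_subgradient {E : Type*} [NormedAddCommGroup E] [NormedSpace ℝ E]
    {θ : E → ℝ} {D : E → E →L[ℝ] ℝ} {U : Set E} (hU : IsOpen U)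
    (hs : ∀ w ∈ U, ∀ h, θ w + D w h ≤ θ (w + h)) (hd : ∀ w ∈ U, HasFDerivAt θ (D w) w) :
    ContinuousOn D U := by
  intro a ha
  apply ContinuousAt.continuousWithinAt
  rw [Metric.continuousAt_iff]
  intro ε hε
  have h1 := (hasFDerivAt_iff_isLittleO_nhds_zero.1 (hd a ha)).def (by positivity : 0 < ε / 4)
  obtain ⟨ρ, hρ, hb⟩ := Metric.mem_nhds_iff.1 h1
  obtain ⟨ρ', hρ', hb'⟩ := Metric.isOpen_iff.1 hU a ha
  refine ⟨min (ρ / 4) ρ', by positivity, fun {w} hw => ?_⟩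
  rw [lt_min_iff] at hw
  have hwU : w ∈ U := hb' hw.2
  set k := w - a with hk
  have hkn : ‖k‖ < ρ / 4 := by rw [hk, ← dist_eq_norm]; exact hw.1
  have hwk : w = a + k := by rw [hk]; abel
  -- Three estimates are added: the subgradient inequalities at `w` for the step `h` and at `a` for
  -- the step `k`, and the first-order expansion at `a` for the step `k + h`.
  have key : ∀ h : E, ‖h‖ = ρ / 4 → (D w - D a) h ≤ ε / 2 * (ρ / 4) := by
    intro h hh
    have e1 := hs w hwU h
    have e2 := hs a ha k
    have hkh : ‖k + h‖ < ρ / 2 := (norm_add_le k h).trans_lt (by linarith)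
    have e3 : ‖θ (a + (k + h)) - θ a - D a (k + h)‖ ≤ ε / 4 * ‖k + h‖ :=
      hb (by simp; linarith)
    have e4 := (Real.le_norm_self _).trans e3
    have e5 : ε / 4 * ‖k + h‖ ≤ ε / 4 * (ρ / 2) := by gcongr
    rw [hwk, add_assoc] at e1
    rw [map_add] at e4
    rw [sub_apply]
    rw [hwk]
    linarith
  rw [dist_eq_norm]
  refine lt_of_le_of_lt (ContinuousLinearMap.opNorm_le_bound _ (by positivity : 0 ≤ ε / 2)
    fun h => ?_) (half_lt_self hε)
  rcases eq_or_ne h 0 with rfl | hne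
  · simp
  have hn : 0 < ‖h‖ := norm_pos_iff.2 hne
  have key2 : ∀ h : E, h ≠ 0 → (D w - D a) h ≤ ε / 2 * ‖h‖ := by
    intro h hne
    have hn : 0 < ‖h‖ := norm_pos_iff.2 hne
    have := key ((ρ / 4 * ‖h‖⁻¹) • h) (by
      rw [norm_smul, Real.norm_of_nonneg (by positivity)]; field_simp)
    rw [map_smul, smul_eq_mul] at this
    have h2 : ρ / 4 * (‖h‖⁻¹ * (D w - D a) h) ≤ ρ / 4 * (ε / 2) := by linarith
    have h3 := le_of_mul_le_mul_left h2 (by positivity)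
    rwa [inv_mul_le_iff₀ hn, mul_comm] at h3
  rw [Real.norm_eq_abs, abs_le]
  constructor
  · have := key2 (-h) (neg_ne_zero.2 hne)
    rw [map_neg, norm_neg] at this
    linarith
  · exact key2 h hne

/-- `L` is positive on `N`, vanishes at `v`, and every direction on which `L` is positive enters `N`
from `v`. -/
def IsTangentAt (N : Set (Fin 5 → ℝ)) (v : Fin 5 → ℝ) (L : (Fin 5 → ℝ) →L[ℝ] ℝ) : Prop :=
  (∀ u ∈ N, 0 < L u) ∧ L v = 0 ∧ ∀ h, 0 < L h → ∃ s : ℝ, 0 < s ∧ v + s • h ∈ N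

/-- The function `w ↦ inf {t | w + t o ∈ N}`. -/
noncomputable def exitTime (N : Set (Fin 5 → ℝ)) (o w : Fin 5 → ℝ) : ℝ :=
  sInf {t : ℝ | w + t • o ∈ N}

namespace IsSharpCone

variable {N : Set (Fin 5 → ℝ)} {f : Module.Dual ℝ (Fin 5 → ℝ)} (hN : IsSharpCone N f)
include hN

/-- The set of admissible `t` is an open, upward closed, nonempty half-line, bounded below because
`f` is positive on `N`. So `N` is the strict sublevel set at $0$ of `exitTime`. -/
theorem add_smul_mem_iff {o : Fin 5 → ℝ} (ho : o ∈ N) (w : Fin 5 → ℝ) (t : ℝ) :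
    w + t • o ∈ N ↔ exitTime N o w < t := by
  set S : Set ℝ := {t : ℝ | w + t • o ∈ N} with hS
  have hcont : Continuous fun s : ℝ => w + s • o := by fun_prop
  have hopen : IsOpen S := hN.isOpen.preimage hcont
  have hup : ∀ s ∈ S, ∀ s', s < s' → s' ∈ S := by
    intro s hs s' h
    have := hN.add_mem _ hs _ (hN.smul_mem (s' - s) (by linarith) o ho)
    change w + s' • o ∈ N
    convert this using 1
    module
  have hne : S.Nonempty := by
    have hc : Continuous fun s : ℝ => o + s • w := by fun_prop
    have : {s : ℝ | o + s • w ∈ N} ∈ 𝓝 (0 : ℝ) :=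
      (hN.isOpen.preimage hc).mem_nhds (by simpa using ho)
    obtain ⟨ε, hε, hb⟩ := Metric.mem_nhds_iff.1 this
    have h2 : o + (ε / 2) • w ∈ N := hb (by simp [abs_of_pos hε]; linarith)
    have := hN.smul_mem (2 / ε) (by positivity) _ h2
    refine ⟨2 / ε, ?_⟩
    change w + (2 / ε) • o ∈ N
    convert this using 1
    rw [smul_add, smul_smul, show 2 / ε * (ε / 2) = 1 by field_simp, one_smul, add_comm]
  have hbdd : BddBelow S := by
    have hfo := hN.pos o (subset_closure ho) (hN.ne_zero ho)
    refine ⟨-(f w) / f o, fun s hs => ?_⟩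
    have := hN.pos _ (subset_closure hs) (hN.ne_zero hs)
    rw [map_add, map_smul, smul_eq_mul] at this
    rw [div_le_iff₀ hfo]
    linarith
  constructor
  · intro h
    obtain ⟨ε, hε, hb⟩ := Metric.isOpen_iff.1 hopen t h
    have h2 : t - ε / 2 ∈ S := hb (by simp [abs_of_pos hε]; linarith)
    have := csInf_le hbdd h2
    change sInf S < t
    linarith
  · intro h
    obtain ⟨s, hs, hst⟩ := exists_lt_of_csInf_lt hne h
    exact hup s hs t hst

theorem mem_iff_exitTime {o : Fin 5 → ℝ} (ho : o ∈ N) (w : Fin 5 → ℝ) :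
    w ∈ N ↔ exitTime N o w < 0 := by
  rw [← hN.add_smul_mem_iff ho, zero_smul, add_zero]

theorem add_exitTime_mem {o : Fin 5 → ℝ} (ho : o ∈ N) (w : Fin 5 → ℝ) :
    w + exitTime N o w • o ∈ closure N \ N := by
  refine ⟨?_, fun h => ((hN.add_smul_mem_iff ho w _).1 h).false⟩
  have hc : Filter.Tendsto (fun s : ℝ => w + s • o) (𝓝[>] (exitTime N o w))
      (𝓝 (w + exitTime N o w • o)) := by
    have : Continuous fun s : ℝ => w + s • o := by fun_prop
    exact (this.tendsto _).mono_left nhdsWithin_le_nhds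
  exact mem_closure_of_tendsto hc
    (eventually_nhdsWithin_of_forall fun t ht => (hN.add_smul_mem_iff ho w t).2 ht)

theorem exitTime_eq_zero {o : Fin 5 → ℝ} (ho : o ∈ N) {v : Fin 5 → ℝ} (hv : v ∈ closure N \ N) :
    exitTime N o v = 0 := by
  apply le_antisymm
  · by_contra! h
    have : v + (exitTime N o v) • o ∈ N :=
      hN.closure_add' hv.1 (hN.smul_mem _ h o ho)
    exact (hN.add_exitTime_mem ho v).2 this
  · by_contra! h
    exact hv.2 ((hN.mem_iff_exitTime ho v).2 h)

omit hN in
theorem nonneg_on_closure {L : (Fin 5 → ℝ) →L[ℝ] ℝ} (hL : ∀ u ∈ N, 0 < L u) {u : Fin 5 → ℝ}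
    (hu : u ∈ closure N) : 0 ≤ L u := by
  have hcl : IsClosed {u | 0 ≤ L u} := isClosed_le continuous_const L.continuous
  exact closure_minimal (fun u hu => (hL u hu).le) hcl hu

/-- The supporting form is nonnegative at the exit point of `w + h` and zero at that of `w`;
dividing the difference by `L o` gives the affine lower bound. -/
theorem exitTime_subgradient {o : Fin 5 → ℝ} (ho : o ∈ N) {w : Fin 5 → ℝ}
    {L : (Fin 5 → ℝ) →L[ℝ] ℝ} (hL : IsTangentAt N (w + exitTime N o w • o) L) (h : Fin 5 → ℝ) :
    exitTime N o w + (-(L o)⁻¹ • L) h ≤ exitTime N o (w + h) := by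
  have hLo := hL.1 o ho
  have h1 := nonneg_on_closure hL.1 (hN.add_exitTime_mem ho (w + h)).1
  have h2 := hL.2.1
  rw [map_add, map_smul, smul_eq_mul] at h1 h2
  rw [map_add] at h1
  have h3 : 0 ≤ (L o)⁻¹ * ((exitTime N o (w + h) - exitTime N o w) * L o + L h) := by
    apply mul_nonneg (inv_nonneg.2 hLo.le)
    linarith
  have h4 : (L o)⁻¹ * ((exitTime N o (w + h) - exitTime N o w) * L o + L h) =
      exitTime N o (w + h) - exitTime N o w + (L o)⁻¹ * L h := by
    field_simp
  rw [h4] at h3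
  simp only [smul_apply, smul_eq_mul, neg_mul]
  linarith

/-- The lower estimate is the subgradient inequality. For the upper one, a direction corrected by
slightly more than `-l h` times `o` lies on the positive side of `L`, hence enters the cone,
uniformly over unit directions. -/
theorem exitTime_hasFDerivAt {o : Fin 5 → ℝ} (ho : o ∈ N) {w : Fin 5 → ℝ}
    {L : (Fin 5 → ℝ) →L[ℝ] ℝ} (hL : IsTangentAt N (w + exitTime N o w • o) L) :
    HasFDerivAt (exitTime N o) (-(L o)⁻¹ • L) w := by
  have hLo := hL.1 o ho
  set l := (L o)⁻¹ • L with hl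
  have hlo : l o = 1 := by simp [hl, hLo.ne']
  set v := w + exitTime N o w • o with hv
  have hvc := (hN.add_exitTime_mem ho w).1
  rw [hasFDerivAt_iff_isLittleO_nhds_zero, Asymptotics.isLittleO_iff]
  intro ε hε
  -- The multiple of `o` is chosen so that `l` takes the constant value `ε` on all these directions.
  set K : (Fin 5 → ℝ) → (Fin 5 → ℝ) := fun h => h + (-(l h) + ε) • o with hK
  have hKc : Continuous K := by fun_prop
  have := (isCompact_sphere (0 : Fin 5 → ℝ) 1).eventually_forall_of_forall_eventually
    (x₀ := (0 : ℝ)) (P := fun s h => 0 < s → v + s • K h ∈ N) (fun h _ => by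
      have hlK : 0 < L (K h) := by
        have : l (K h) = ε := by simp [hK, hlo]
        rw [hl] at this
        simp only [smul_apply, smul_eq_mul] at this
        have h2 : L (K h) = L o * ε := by rw [← this]; field_simp
        rw [h2]
        positivity
      obtain ⟨s₀, hs₀, hmem⟩ := hL.2.2 _ hlK
      have hc : Continuous fun p : ℝ × (Fin 5 → ℝ) => v + s₀ • K p.2 := by fun_prop
      have h1 : {p : ℝ × (Fin 5 → ℝ) | v + s₀ • K p.2 ∈ N} ∈ 𝓝 ((0 : ℝ), h) :=
        (hN.isOpen.preimage hc).mem_nhds hmem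
      have h2 : {p : ℝ × (Fin 5 → ℝ) | p.1 < s₀} ∈ 𝓝 ((0 : ℝ), h) :=
        (isOpen_lt continuous_fst continuous_const).mem_nhds hs₀
      filter_upwards [h1, h2] with p hp1 hp2 hp0
      -- By convexity, a direction that enters the cone at parameter `s₀` has entered it at all
      -- smaller positive parameters.
      have e : v + p.1 • K p.2 = (1 - p.1 / s₀) • v + (p.1 / s₀) • (v + s₀ • K p.2) := by
        have e' : (p.1 / s₀) • (v + s₀ • K p.2) = (p.1 / s₀) • v + p.1 • K p.2 := by
          rw [smul_add, smul_smul, div_mul_cancel₀ _ hs₀.ne']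
        rw [e']
        generalize K p.2 = k
        module
      rw [e]
      refine hN.closure_add' (hN.closure_smul' ?_ hvc) (hN.smul_mem _ (by positivity) _ hp1)
      rw [sub_nonneg, div_le_one hs₀]
      exact le_of_lt hp2)
  obtain ⟨δ, hδ, hb⟩ := Metric.mem_nhds_iff.1 this
  filter_upwards [Metric.ball_mem_nhds (0 : Fin 5 → ℝ) hδ] with h hh
  have hlow := hN.exitTime_subgradient ho hL h
  have en : -(L o)⁻¹ • L = -l := by
    ext x
    simp [hl]
  rw [en, neg_apply] at hlow
  rw [en, neg_apply]
  rcases eq_or_ne h 0 with rfl | hne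
  · simp
  have hn : 0 < ‖h‖ := norm_pos_iff.2 hne
  have hmem := @hb ‖h‖ (by simpa using hh) (‖h‖⁻¹ • h) (by simp [norm_smul, hn.ne']) hn
  have e : v + ‖h‖ • K (‖h‖⁻¹ • h) = (w + h) + (exitTime N o w - l h + ε * ‖h‖) • o := by
    simp only [hK, map_smul, smul_eq_mul, smul_add, smul_smul, hv]
    rw [mul_inv_cancel₀ hn.ne', one_smul, mul_add, mul_neg, mul_inv_cancel_left₀ hn.ne']
    module
  rw [e, hN.add_smul_mem_iff ho] at hmem
  rw [Real.norm_eq_abs, abs_le]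
  constructor
  · have : 0 ≤ ε * ‖h‖ := by positivity
    linarith
  · linarith

omit hN in
theorem add_exitTime_ne_zero {o w : Fin 5 → ℝ} (hw : w ∉ Submodule.span ℝ {o}) :
    w + exitTime N o w • o ≠ 0 := by
  intro h
  apply hw
  rw [Submodule.mem_span_singleton]
  exact ⟨-exitTime N o w, by rw [neg_smul, eq_comm, ← add_eq_zero_iff_eq_neg, h]⟩

theorem exitTime_contDiffAt {o : Fin 5 → ℝ} (ho : o ∈ N)
    (hT : ∀ v ∈ closure N \ N, v ≠ 0 → ∃ L, IsTangentAt N v L) {w : Fin 5 → ℝ}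
    (hw : w ∉ Submodule.span ℝ {o}) :
    ContDiffAt ℝ 1 (exitTime N o) w ∧ fderiv ℝ (exitTime N o) w ≠ 0 := by
  have h1 : ∀ w : Fin 5 → ℝ, ∃ L : (Fin 5 → ℝ) →L[ℝ] ℝ, w ∉ Submodule.span ℝ {o} →
      IsTangentAt N (w + exitTime N o w • o) L := by
    intro w
    by_cases hw : w ∈ Submodule.span ℝ {o}
    · exact ⟨0, fun h => absurd hw h⟩
    · obtain ⟨L, hL⟩ := hT _ (hN.add_exitTime_mem ho w) (add_exitTime_ne_zero hw)
      exact ⟨L, fun _ => hL⟩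
  choose L hL using h1
  set U : Set (Fin 5 → ℝ) := {w | w ∉ Submodule.span ℝ {o}}
  have hU : IsOpen U := (Submodule.closed_of_finiteDimensional _).isOpen_compl
  have hd : ∀ w ∈ U, HasFDerivAt (exitTime N o) (-(L w o)⁻¹ • L w) w := fun w hw =>
    hN.exitTime_hasFDerivAt ho (hL w hw)
  constructor
  · rw [contDiffAt_one_iff]
    exact ⟨_, U, hU.mem_nhds hw, continuousOn_of_subgradient hU
      (fun w hw h => hN.exitTime_subgradient ho (hL w hw) h) hd, hd⟩
  · rw [(hd w hw).fderiv]
    intro h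
    have h2 := congrArg (fun T : (Fin 5 → ℝ) →L[ℝ] ℝ => T o) h
    have h3 := (hL w hw).1 o ho
    simp [h3.ne'] at h2

theorem hasC1Boundary (hT : ∀ v ∈ closure N \ N, v ≠ 0 → ∃ L, IsTangentAt N v L) :
    HasC1Boundary (projTrace N) := by
  obtain ⟨o, ho⟩ := hN.nonempty
  have hfc : Continuous f := f.continuous_of_finiteDimensional
  have key : ∀ v : Fin 5 → ℝ, v ≠ 0 → v ∈ closure N \ N →
      ContDiffAt ℝ 1 (exitTime N o) v ∧ exitTime N o v = 0 ∧ fderiv ℝ (exitTime N o) v ≠ 0 ∧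
      ∀ᶠ w in 𝓝 v, ∀ hw : w ≠ 0,
        (Projectivization.mk ℝ w hw ∈ projTrace N ↔ exitTime N o w < 0) := by
    intro v hv0 hv
    have hspan : v ∉ Submodule.span ℝ {o} := by
      intro h
      rw [Submodule.mem_span_singleton] at h
      obtain ⟨c, hc⟩ := h
      rcases lt_trichotomy c 0 with h | h | h
      · apply hN.neg_notMem_closure hv.1 hv0
        rw [← hc, ← neg_smul]
        exact subset_closure (hN.smul_mem _ (by linarith) o ho)
      · rw [h, zero_smul] at hc
        exact hv0 hc.symm
      · exact hv.2 (hc ▸ hN.smul_mem c h o ho)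
    obtain ⟨h1, h2⟩ := hN.exitTime_contDiffAt ho hT hspan
    refine ⟨h1, hN.exitTime_eq_zero ho hv, h2, ?_⟩
    -- A projective point belongs to the domain when `w` or `-w` is in the cone; positivity of `f`
    -- near `v` rules out the second case.
    have : {w | 0 < f w} ∈ 𝓝 v := (isOpen_lt continuous_const hfc).mem_nhds (hN.pos v hv.1 hv0)
    filter_upwards [this] with w hw hw0
    rw [hN.mk_mem, ← hN.mem_iff_exitTime ho]
    refine ⟨fun h => h.resolve_right fun h' => ?_, Or.inl⟩
    have := hN.pos _ (subset_closure h') (neg_ne_zero.2 hw0)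
    rw [map_neg] at this
    have hw' : 0 < f w := hw
    linarith
  intro v hv0 hv
  rcases (hN.mk_mem_frontier hv0).1 hv with h | h
  · exact ⟨_, key v hv0 h⟩
  · obtain ⟨h1, h2, h3, h4⟩ := key (-v) (neg_ne_zero.2 hv0) h
    refine ⟨fun w => exitTime N o (-w), ?_, h2, ?_, ?_⟩
    · exact ContDiffAt.comp (g := exitTime N o) (f := fun w => -w) v h1 contDiff_neg.contDiffAt
    · have hd := (h1.differentiableAt one_ne_zero).hasFDerivAt
      have hd' : HasFDerivAt (fun w => exitTime N o (-w))
          ((fderiv ℝ (exitTime N o) (-v)).comp (-ContinuousLinearMap.id ℝ (Fin 5 → ℝ))) v :=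
        hd.comp v (hasFDerivAt_id v).neg
      rw [hd'.fderiv]
      intro h0
      apply h3
      ext x
      have := congrArg (fun T : (Fin 5 → ℝ) →L[ℝ] ℝ => T (-x)) h0
      simpa using this
    · have : Filter.Tendsto (fun w : Fin 5 → ℝ => -w) (𝓝 v) (𝓝 (-v)) :=
        continuous_neg.tendsto v
      filter_upwards [this.eventually h4] with w hw hw0
      rw [← hw (neg_ne_zero.2 hw0), mk_neg']

end IsSharpCone

end HilbertGeom

namespace HilbertGeom

/-! ### Tangent hyperplanes of the cone -/

/-- The expression is $3\,(Q_t(1,0,1)+8\,Q_{t/2}(0,1,0))$: the parameter cancels between the two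
kernel vectors of the boundary form with $c=-1/5$. -/
theorem normalForm_support {u : Fin 5 → ℝ} (hu : u ∈ closure midCone) :
    0 ≤ 3 * u 0 + 5 * u 2 + 3 * u 4 := by
  obtain ⟨t, h1, h2⟩ := exists_of_mem_closure_midCone hu
  have a1 := h1 ![1, 0, 1]
  have a2 := h2 ![0, 1, 0]
  rw [pencilForm_mk] at a1 a2
  linarith

theorem normalForm_support_pos {u : Fin 5 → ℝ} (hu : u ∈ midCone) :
    0 < 3 * u 0 + 5 * u 2 + 3 * u 4 := by
  obtain ⟨t, h1, h2⟩ := hu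
  have a1 := h1 ![1, 0, 1] (vec3_ne_zero (Or.inl one_ne_zero))
  have a2 := h2 ![0, 1, 0] (vec3_ne_zero (Or.inr (Or.inl one_ne_zero)))
  rw [pencilForm_mk] at a1 a2
  linarith

/-- Equality makes both terms vanish, so $(1,0,1)$ and $(0,1,0)$ lie in the kernels of $Q_t$ and
$Q_{t/2}$; these linear equations leave one dimension. -/
theorem normalForm_support_eq {u : Fin 5 → ℝ} (hu : u ∈ closure midCone)
    (h : 3 * u 0 + 5 * u 2 + 3 * u 4 = 0) : u = u 0 • normalForm (-(1 / 5)) := by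
  obtain ⟨t, h1, h2⟩ := exists_of_mem_closure_midCone hu
  have a1 := h1 ![1, 0, 1]
  have a2 := h2 ![0, 1, 0]
  rw [pencilForm_mk] at a1 a2
  have k1 := pencilForm_kernel h1 (z := ![1, 0, 1]) (by rw [pencilForm_mk]; linarith)
  have k2 := pencilForm_kernel h2 (z := ![0, 1, 0]) (by rw [pencilForm_mk]; linarith)
  simp at k1 k2
  ext i
  fin_cases i <;> simp [normalForm] <;> linarith

theorem coeff_zero_pos {u : Fin 5 → ℝ} (hu : u ∈ posCone) : 0 < u 0 := by
  have := hu ![1, 0] (vec2_ne_zero.2 (Or.inl one_ne_zero))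
  rw [quartic_mk] at this
  simpa using this

theorem coeff_four_pos {u : Fin 5 → ℝ} (hu : u ∈ posCone) : 0 < u 4 := by
  have := hu ![0, 1] (vec2_ne_zero.2 (Or.inr one_ne_zero))
  rw [quartic_mk] at this
  simpa using this

/-- The closed cone has only one-dimensional proper faces. -/
theorem midCone_extremal {u w : Fin 5 → ℝ} (hu : u ∈ closure midCone) (hw : w ∈ closure midCone)
    (huw : u + w ∈ closure midCone \ midCone) (h0 : u + w ≠ 0) :
    ∃ (e : Fin 5 → ℝ) (a b : ℝ), u = a • e ∧ w = b • e := by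
  obtain ⟨g, l, hl, hg⟩ := boundary_cases huw h0
  have hu' := rho_smul_mem_closure_midCone g hu
  have hw' := rho_smul_mem_closure_midCone g hw
  rw [rho_add] at hg
  have back : ∀ {e : Fin 5 → ℝ} {a b : ℝ}, rho g • u = a • e → rho g • w = b • e →
      ∃ (e : Fin 5 → ℝ) (a b : ℝ), u = a • e ∧ w = b • e := by
    intro e a b h1 h2
    refine ⟨rho g⁻¹ • e, a, b, ?_, ?_⟩
    · rw [← rho_smul, ← h1, rho_inv_smul]
    · rw [← rho_smul, ← h2, rho_inv_smul]
  rcases hg with hg | hg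
  · have s1 := normalForm_support hu'
    have s2 := normalForm_support hw'
    have e0 := congrFun hg 0
    have e2 := congrFun hg 2
    have e4 := congrFun hg 4
    simp [normalForm] at e0 e2 e4
    exact back (normalForm_support_eq hu' (by linarith)) (normalForm_support_eq hw' (by linarith))
  · have s1 := coeff_zero_nonneg hu'
    have s2 := coeff_zero_nonneg hw'
    have e0 := congrFun hg 0
    simp [fourthPower] at e0
    exact back (eq_fourthPower_of_coeff hu' (by linarith))
      (eq_fourthPower_of_coeff hw' (by linarith))

/-- If the midpoint of a boundary segment is in the boundary, extremality makes both endpoints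
proportional, and the chart normalization makes them equal. -/
theorem midCone_isStrictlyConvex : IsStrictlyConvex (projTrace midCone) := by
  have hN := midCone_isSharpCone
  intro x hx y hy hxy hseg
  have hX := hN.coord_mem_frontier hN.pos hx
  have hY := hN.coord_mem_frontier hN.pos hy
  have hxc : x ∈ chart meanForm := hN.chart_subset (frontier_subset_closure hx)
  have hyc : y ∈ chart meanForm := hN.chart_subset (frontier_subset_closure hy)
  set X := coord meanForm x
  set Y := coord meanForm y
  have hfX : meanForm X = 1 := apply_coord hxc
  have hfY : meanForm Y = 1 := apply_coord hyc
  have hfm : meanForm (X + Y) = 2 := by rw [map_add, hfX, hfY]; norm_num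
  have hm0 : X + Y ≠ 0 := by
    intro h
    rw [h, map_zero] at hfm
    norm_num at hfm
  have hmem : Projectivization.mk ℝ (X + Y) hm0 ∈ seg (projTrace midCone) x y := by
    refine ⟨meanForm, hN.chart_subset, ?_, ?_⟩
    · rw [mk_mem_chart, hfm]
      norm_num
    · rw [coord_mk, hfm]
      exact ⟨2⁻¹, 2⁻¹, by norm_num, by norm_num, by norm_num, by rw [smul_add]⟩
  have hfr : X + Y ∈ closure midCone \ midCone := by
    rcases (hN.mk_mem_frontier hm0).1 (hseg hmem) with h | h
    · exact h
    · exact absurd h.1 (hN.neg_notMem_closure (hN.closure_add hX.1 hY.1) hm0)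
  obtain ⟨e, a, b, h1, h2⟩ := midCone_extremal hX.1 hY.1 hfr hm0
  have e1 : a * meanForm e = 1 := by rw [← hfX, h1, map_smul, smul_eq_mul]
  have e2 : b * meanForm e = 1 := by rw [← hfY, h2, map_smul, smul_eq_mul]
  have hab : a = b := by
    have : meanForm e ≠ 0 := right_ne_zero_of_mul_eq_one e1
    exact mul_right_cancel₀ this (e1.trans e2.symm)
  apply hxy
  rw [← mk_coord hxc, ← mk_coord hyc]
  have : coord meanForm x = coord meanForm y := by
    change X = Y
    rw [h1, h2, hab]
  simp only [this]

theorem pencilForm_add_smul (v h : Fin 5 → ℝ) (t τ s : ℝ) (z : Fin 3 → ℝ) :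
    pencilForm (v + s • h) (t + s * τ) z = pencilForm v t z + s * pencilForm h τ z := by
  rw [pencilForm_add, pencilForm_smul]

/-- First-order criterion: the parameter of the pencil may move too, at speed `τ`, and positivity of
the derivative is needed only on the two kernels. -/
theorem exists_add_smul_mem_midCone {v h : Fin 5 → ℝ} {t τ : ℝ}
    (h1 : ∀ z, 0 ≤ pencilForm v t z) (h2 : ∀ z, 0 ≤ pencilForm v (t / 2) z)
    (h3 : ∀ z, z ≠ 0 → pencilForm v t z = 0 → 0 < pencilForm h τ z)
    (h4 : ∀ z, z ≠ 0 → pencilForm v (t / 2) z = 0 → 0 < pencilForm h (τ / 2) z) :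
    ∃ s : ℝ, 0 < s ∧ v + s • h ∈ midCone := by
  have hc : ∀ (u : Fin 5 → ℝ) (r : ℝ), Continuous (pencilForm u r) := fun u r =>
    continuous_pencilForm.comp (by fun_prop : Continuous fun z : Fin 3 → ℝ => ((u, r), z))
  have e1 := eventually_pos_perturbation (hc v t) (hc h τ) (pencilForm_smul_right v t)
    (pencilForm_smul_right h τ) h1 h3
  have e2 := eventually_pos_perturbation (hc v (t / 2)) (hc h (τ / 2))
    (pencilForm_smul_right v (t / 2)) (pencilForm_smul_right h (τ / 2)) h2 h4
  obtain ⟨ε, hε, hb⟩ := Metric.mem_nhds_iff.1 (e1.and e2)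
  have hm := hb (by simp [abs_of_pos hε]; linarith : ε / 2 ∈ Metric.ball (0 : ℝ) ε)
  refine ⟨ε / 2, by positivity, t + ε / 2 * τ, fun z hz => ?_, fun z hz => ?_⟩
  · rw [pencilForm_add_smul]
    exact hm.1 (by positivity) z hz
  · rw [show (t + ε / 2 * τ) / 2 = t / 2 + ε / 2 * (τ / 2) by ring, pencilForm_add_smul]
    exact hm.2 (by positivity) z hz

theorem isTangentAt_normalForm :
    ∃ L, IsTangentAt midCone (normalForm (-(1 / 5))) L := by
  refine ⟨(3 : ℝ) • .proj 0 + (5 : ℝ) • .proj 2 + (3 : ℝ) • .proj 4, fun u hu => ?_, ?_,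
    fun h hh => ?_⟩
  · simpa using normalForm_support_pos hu
  · simp [normalForm]; norm_num
  · have hh' : 0 < 3 * h 0 + 5 * h 2 + 3 * h 4 := by simpa using hh
    -- At $c=-1/5$ the only admissible parameter is $t=2c$. Positivity on the two kernel lines asks
    -- for $-(h_0+h_2/3+h_4)/4<\tau<h_2/3$; `τ` is the midpoint, and the interval is nonempty
    -- precisely by `hh'`.
    refine exists_add_smul_mem_midCone (t := -(2 / 5))
      (τ := (h 2 / 3 - (h 0 + h 2 / 3 + h 4) / 4) / 2) (fun z => ?_) (fun z => ?_)
      (fun z hz hz0 => ?_) (fun z hz hz0 => ?_)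
    · rw [vec3_eta z, pencilForm_normalForm]
      nlinarith [sq_nonneg (z 0 - z 2), sq_nonneg (z 1)]
    · rw [vec3_eta z, pencilForm_normalForm]
      nlinarith [sq_nonneg (z 0 - z 2), sq_nonneg (z 0 + z 2)]
    · rw [vec3_eta z, pencilForm_normalForm] at hz0
      have q1 : (z 0 - z 2) ^ 2 = 0 := by nlinarith [sq_nonneg (z 0 - z 2), sq_nonneg (z 1)]
      have q2 : z 1 ^ 2 = 0 := by nlinarith [sq_nonneg (z 0 - z 2), sq_nonneg (z 1)]
      have r1 : z 2 = z 0 := by linarith [pow_eq_zero_iff (two_ne_zero) |>.1 q1]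
      have r2 : z 1 = 0 := pow_eq_zero_iff (two_ne_zero) |>.1 q2
      have r0 : z 0 ≠ 0 := by
        intro h0
        apply hz
        ext i
        fin_cases i <;> simp [r1, r2, h0]
      rw [vec3_eta z, r1, r2, pencilForm_mk]
      have : 0 < z 0 ^ 2 := by positivity
      nlinarith
    · rw [vec3_eta z, pencilForm_normalForm] at hz0
      have q1 : (z 0 - z 2) ^ 2 = 0 := by nlinarith [sq_nonneg (z 0 - z 2), sq_nonneg (z 0 + z 2)]
      have q2 : (z 0 + z 2) ^ 2 = 0 := by nlinarith [sq_nonneg (z 0 - z 2), sq_nonneg (z 0 + z 2)]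
      have r1 := pow_eq_zero_iff (two_ne_zero) |>.1 q1
      have r2 := pow_eq_zero_iff (two_ne_zero) |>.1 q2
      have s0 : z 0 = 0 := by linarith
      have s2 : z 2 = 0 := by linarith
      have r0 : z 1 ≠ 0 := by
        intro h0
        apply hz
        ext i
        fin_cases i <;> simp [s0, s2, h0]
      rw [vec3_eta z, s0, s2, pencilForm_mk]
      have : 0 < z 1 ^ 2 := by positivity
      nlinarith

/-- Here $t=0$ and both quadratic forms equal $z_2^2$. On the common kernel plane the derivative
becomes positive definite as soon as `h 0 > 0` and `τ` is very negative. -/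
theorem isTangentAt_fourthPower : ∃ L, IsTangentAt midCone (fourthPower 0 1) L := by
  refine ⟨.proj 0, fun u hu => ?_, ?_, fun h hh => ?_⟩
  · simpa using coeff_zero_pos (midCone_subset_posCone hu)
  · simp [fourthPower]
  · have hh' : 0 < h 0 := by simpa using hh
    have hE : ∀ z : Fin 3 → ℝ, pencilForm (fourthPower 0 1) 0 z = z 2 ^ 2 := by
      intro z
      simp [pencilForm, fourthPower]
    -- Completing the square in $z_0$ leaves $h_2/6-\tau-h_1^2/(16h_0)$ as coefficient of $z_1^2$;
    -- it is positive once $\tau\le -M$. The final choice $-2M$ makes $\tau/2$ satisfy this as well.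
    set M := |h 2| / 6 + h 1 ^ 2 / (16 * h 0) + 1 with hM
    have main : ∀ τ : ℝ, τ ≤ -M → ∀ z : Fin 3 → ℝ, z ≠ 0 → z 2 ^ 2 = 0 →
        0 < pencilForm h τ z := by
      intro τ hτ z hz hz0
      have r2 : z 2 = 0 := pow_eq_zero_iff (two_ne_zero) |>.1 hz0
      rw [vec3_eta z, r2, pencilForm_mk]
      have e : h 0 * z 0 ^ 2 + h 1 / 2 * (z 0 * z 1) + h 2 / 6 * (z 1 ^ 2 + 2 * z 0 * 0)
          + h 3 / 2 * (z 1 * 0) + h 4 * 0 ^ 2 + τ * (4 * z 0 * 0 - z 1 ^ 2) =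
          h 0 * (z 0 + h 1 / (4 * h 0) * z 1) ^ 2 +
            (h 2 / 6 - τ - h 1 ^ 2 / (16 * h 0)) * z 1 ^ 2 := by
        field_simp
        ring
      rw [e]
      have hc : 0 < h 2 / 6 - τ - h 1 ^ 2 / (16 * h 0) := by
        have := neg_abs_le (h 2)
        linarith
      by_cases h1 : z 1 = 0
      · have h0 : z 0 ≠ 0 := by
          intro h0
          apply hz
          ext i
          fin_cases i <;> simp [h0, h1, r2]
        rw [h1]
        have : 0 < z 0 ^ 2 := by positivity
        simp
        positivity
      · have : 0 < z 1 ^ 2 := by positivity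
        have := mul_pos hc this
        positivity
    have hM0 : 0 < M := by positivity
    refine exists_add_smul_mem_midCone (t := 0) (τ := -(2 * M)) (fun z => ?_) (fun z => ?_)
      (fun z hz hz0 => ?_) (fun z hz hz0 => ?_)
    · rw [hE]; positivity
    · rw [zero_div, hE]; positivity
    · rw [hE] at hz0
      exact main _ (by linarith) z hz hz0
    · rw [zero_div, hE] at hz0
      exact main _ (by linarith) z hz hz0

/-- The action of `g` as a continuous linear map. -/
noncomputable def rhoLinear (g : SL(2, ℝ)) : (Fin 5 → ℝ) →L[ℝ] (Fin 5 → ℝ) where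
  toFun v := rho g • v
  map_add' := rho_add g
  map_smul' := rho_smul g
  cont := continuous_rho_smul g

theorem exists_isTangentAt {v : Fin 5 → ℝ} (hv : v ∈ closure midCone \ midCone) (h0 : v ≠ 0) :
    ∃ L, IsTangentAt midCone v L := by
  obtain ⟨g, l, hl, hg⟩ := boundary_cases hv h0
  have key : ∀ {e : Fin 5 → ℝ}, (∃ L, IsTangentAt midCone e L) → rho g • v = l • e →
      ∃ L, IsTangentAt midCone v L := by
    rintro e ⟨L, hL1, hL2, hL3⟩ he
    refine ⟨L.comp (rhoLinear g), fun u hu => hL1 _ (rho_smul_mem_midCone g hu), ?_, fun h hh => ?_⟩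
    · change L (rho g • v) = 0
      rw [he, map_smul, hL2, smul_zero]
    · obtain ⟨s, hs, hmem⟩ := hL3 (rho g • h) hh
      refine ⟨l * s, by positivity, ?_⟩
      rw [← rho_smul_mem_midCone_iff g, rho_add, he, rho_smul, mul_smul, ← smul_add]
      exact smul_mem_midCone hl hmem
  rcases hg with hg | hg
  · exact key isTangentAt_normalForm hg
  · exact key isTangentAt_fourthPower hg

theorem midCone_hasC1Boundary : HasC1Boundary (projTrace midCone) :=
  midCone_isSharpCone.hasC1Boundary fun _ hv h0 => exists_isTangentAt hv h0

/-! ### Identification with a neighbourhood of the set of convex forms -/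

theorem smul_mk_rho (g : SL(2, ℝ)) {v : Fin 5 → ℝ} (hv : v ≠ 0) :
    rho g • Projectivization.mk ℝ v hv = Projectivization.mk ℝ (rho g • v) (rho_smul_ne_zero g hv) :=
  Projectivization.smul_mk _ _

theorem range_rho_le_aut : rho.range ≤ Aut (projTrace midCone) := by
  rintro _ ⟨g, rfl⟩
  change (fun x => rho g • x) '' projTrace midCone = projTrace midCone
  have hsub : ∀ g : SL(2, ℝ), ∀ x ∈ projTrace midCone, rho g • x ∈ projTrace midCone := by
    rintro g _ ⟨v, hv, hv0, rfl⟩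
    rw [smul_mk_rho]
    exact ⟨_, rho_smul_mem_midCone g hv, _, rfl⟩
  apply Set.Subset.antisymm
  · rintro _ ⟨x, hx, rfl⟩
    exact hsub g x hx
  · intro x hx
    refine ⟨rho g⁻¹ • x, hsub _ x hx, ?_⟩
    change rho g • rho g⁻¹ • x = x
    rw [map_inv, smul_inv_smul]

/-- If a nonnegative form with a nontrivial zero were an interior point, subtracting a small
positive definite form would make it negative at that zero; its opposite would then have to be
nonnegative everywhere, and in the limit the form would vanish. -/
theorem omegaMax_eq : omegaMax = projTrace posCone := by
  have hN := posCone_isSharpCone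
  have main : ∀ v : Fin 5 → ℝ, v ≠ 0 → (∀ w, 0 ≤ quartic v w) →
      v ∈ interior (coneOver (projTrace {v | ∀ w, 0 ≤ quartic v w})) → v ∈ posCone := by
    intro v hv0 hnn hint
    by_contra hpos
    simp only [posCone, Set.mem_ofPred_eq] at hpos
    push Not at hpos
    obtain ⟨w, hw, hvw⟩ := hpos
    have hc : Continuous fun s : ℝ => v - s • normalForm 0 := by fun_prop
    have h1 : ∀ᶠ s in 𝓝 (0 : ℝ), v - s • normalForm 0 ∈
        coneOver (projTrace {v | ∀ w, 0 ≤ quartic v w}) := by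
      have : ∀ᶠ s in 𝓝 (0 : ℝ), v - s • normalForm 0 ∈
          interior (coneOver (projTrace {v | ∀ w, 0 ≤ quartic v w})) :=
        (isOpen_interior.preimage hc).mem_nhds (by simpa using hint)
      exact this.mono fun s hs => interior_subset hs
    have h2 : ∀ᶠ s in 𝓝[>] (0 : ℝ), ∀ x, 0 ≤ quartic (-(v - s • normalForm 0)) x := by
      filter_upwards [h1.filter_mono nhdsWithin_le_nhds, self_mem_nhdsWithin] with s hs hs0
      obtain ⟨h0, u, hu, hu0, huv⟩ := hs
      obtain ⟨c, hc, h | h⟩ := (mk_eq_mk_iff_pos _ _).1 huv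
      · exfalso
        have h3 := hu w
        have h4 : quartic (v - s • normalForm 0) w = c * quartic u w := by rw [h, quartic_smul]
        rw [quartic_sub, quartic_smul] at h4
        have h5 := mul_pos hs0 (normalForm_mem_posCone (c := 0) (by norm_num) w hw)
        have h6 := mul_nonneg hc.le h3
        linarith
      · intro x
        rw [h, neg_neg, quartic_smul]
        exact mul_nonneg hc.le (hu x)
    have h3 : ∀ x, quartic v x ≤ 0 := by
      intro x
      have hc2 : Filter.Tendsto (fun s : ℝ => quartic (-(v - s • normalForm 0)) x) (𝓝[>] 0)
          (𝓝 (-quartic v x)) := by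
        have : Continuous fun s : ℝ => quartic (-(v - s • normalForm 0)) x :=
          continuous_quartic.comp (by fun_prop : Continuous
            fun s : ℝ => (-(v - s • normalForm 0), x))
        have := this.tendsto 0
        rw [zero_smul, sub_zero, ← neg_one_smul ℝ v, quartic_smul, neg_one_mul] at this
        exact this.mono_left nhdsWithin_le_nhds
      have := ge_of_tendsto hc2 (h2.mono fun s hs => hs x)
      linarith
    apply hv0
    apply quartic_ext
    intro x y
    rw [le_antisymm (h3 _) (hnn _), quartic_mk]
    simp
  apply Set.Subset.antisymm
  · intro x hx
    obtain ⟨v, hv, hv0, rfl⟩ : x ∈ projTrace {v | ∀ w, 0 ≤ quartic v w} := interior_subset hx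
    exact ⟨v, main v hv0 hv ((mem_interior_proj_iff hv0).1 hx), hv0, rfl⟩
  · apply interior_maximal _ hN.isOpen_projTrace
    rintro _ ⟨v, hv, hv0, rfl⟩
    exact ⟨v, quartic_nonneg_of_mem_closure (subset_closure hv), hv0, rfl⟩

theorem exists_of_mem_omegaMin {x : Proj 5} (hx : x ∈ omegaMin) :
    ∃ v : Fin 5 → ℝ, ∃ hv : v ≠ 0, v ∈ posCone ∧ ConvexOn ℝ Set.univ (quartic v) ∧
      x = Projectivization.mk ℝ v hv := by
  have hsub : projTrace {v | ConvexOn ℝ Set.univ (quartic v)} ⊆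
      projTrace {v | ∀ w, 0 ≤ quartic v w} := by
    rintro _ ⟨v, hv, hv0, rfl⟩
    exact ⟨v, nonneg_of_convexOn hv, hv0, rfl⟩
  have hmax : x ∈ projTrace posCone := by
    rw [← omegaMax_eq]
    exact interior_mono hsub hx
  obtain ⟨v, hv, hv0, rfl⟩ : x ∈ projTrace {v | ConvexOn ℝ Set.univ (quartic v)} :=
    interior_subset hx
  refine ⟨v, hv0, ?_, hv, rfl⟩
  rcases (posCone_isSharpCone.mk_mem hv0).1 hmax with h | h
  · exact h
  · exact absurd (subset_closure h) (posCone_isSharpCone.neg_notMem_closure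
      (mem_closure_posCone.2 (nonneg_of_convexOn hv)) hv0)

theorem mk_mem_omegaMin {v : Fin 5 → ℝ} (hv0 : v ≠ 0)
    (hv : ∀ z, z ≠ 0 → 0 < pencilForm v 0 z) : Projectivization.mk ℝ v hv0 ∈ omegaMin := by
  rw [omegaMin, mem_interior_proj_iff]
  refine mem_interior.2 ⟨_, fun u hu => ?_, isOpen_pencilForm_pos 0, hv⟩
  have hu' : ∀ z, z ≠ 0 → 0 < pencilForm u 0 z := hu
  have hu0 : u ≠ 0 := by
    rintro rfl
    have := hu' ![1, 0, 0] (vec3_ne_zero (Or.inl one_ne_zero))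
    rw [pencilForm_mk] at this
    simp at this
  refine ⟨hu0, u, convexOn_quartic fun z => ?_, hu0, rfl⟩
  by_cases hz : z = 0
  · simp [hz, pencilForm]
  · exact (hu' z hz).le

/-- Everything is transported to a normal form. A convex comparison form has nonnegative $x^2y^2$
coefficient, which bounds the distance from below; conversely, a normal form with parameter $c'>0$
is an explicit nearby point of $\Omega_0$. The threshold is $1+3c=2/5$. -/
theorem omega_eq : omega (Real.log (5 / 2) / 2) = projTrace midCone := by
  have hP := posCone_isSharpCone
  ext x
  constructor
  · rintro ⟨hx, y, hy, hd⟩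
    rw [omegaMax_eq] at hx hd
    obtain ⟨u, hu, hu0, rfl⟩ := hx
    obtain ⟨v, hv0, hv, hvc, rfl⟩ := exists_of_mem_omegaMin hy
    obtain ⟨a, b, ha, hb, h1, h2, h3, -, -⟩ := hP.exists_hilbertDist_eq hu hv
    rw [h3] at hd
    have hab : 2 / 5 < a * b := by
      have h4 : Real.log (2 / 5) < Real.log (a * b) := by
        have : Real.log (2 / 5) = -Real.log (5 / 2) := by
          rw [← Real.log_inv]; norm_num
        linarith
      exact (Real.log_lt_log_iff (by norm_num) (by positivity)).1 h4
    obtain ⟨g, l, c, hl, hc1, hc2, hg⟩ := exists_normalForm hu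
    have hv2 := convexOn_coeff_nonneg (convexOn_rho g hvc)
    set V := rho g • v with hV
    have k1 : ∀ w, 0 ≤ l * quartic (normalForm c) w - a * quartic V w := by
      intro w
      have := mem_closure_posCone.1 h1 (g⁻¹ • w)
      rwa [← quartic_rho, smul_sub, quartic_sub, hg, rho_smul, quartic_smul, quartic_smul] at this
    have k2 : ∀ w, 0 ≤ quartic V w - b * (l * quartic (normalForm c) w) := by
      intro w
      have := mem_closure_posCone.1 h2 (g⁻¹ • w)
      rwa [← quartic_rho, smul_sub, quartic_sub, rho_smul, hg, quartic_smul, quartic_smul] at this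
    -- The values at $(1,\pm1)$ bound $a(V_0+V_2+V_4)$ by $l(2+6c)$, while those at $(1,0)$ and
    -- $(0,1)$ give $V_0,V_4\ge bl$. Hence $ab\le 1+3c$.
    have a1 := k1 ![1, 1]
    have a2 := k1 ![1, -1]
    have a3 := k2 ![1, 0]
    have a4 := k2 ![0, 1]
    rw [quartic_normalForm, quartic_mk] at a1 a2 a3 a4
    norm_num at a1 a2 a3 a4
    have hc : -(1 / 5) < c := by
      have b1 : a * (b * l) ≤ a * V 0 := by gcongr
      have b2 : a * (b * l) ≤ a * V 4 := by gcongr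
      have b3 : 0 ≤ a * V 2 := by positivity
      have b4 : 2 * (a * b * l) ≤ l * (2 + 6 * c) := by nlinarith
      have b5 : l * (2 * (a * b)) ≤ l * (2 + 6 * c) := by linarith
      have := le_of_mul_le_mul_left b5 hl
      linarith
    refine ⟨u, ?_, hu0, rfl⟩
    rw [← rho_smul_mem_midCone_iff g, hg, smul_mem_midCone_iff hl]
    exact (normalForm_mem_midCone_iff hc2).2 hc
  · rintro ⟨u, hu, hu0, rfl⟩
    have hup := midCone_subset_posCone hu
    refine ⟨by rw [omegaMax_eq]; exact ⟨u, hup, hu0, rfl⟩, ?_⟩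
    obtain ⟨g, l, c, hl, hc1, hc2, hg⟩ := exists_normalForm hup
    have hc : -(1 / 5) < c := by
      rwa [← rho_smul_mem_midCone_iff g, hg, smul_mem_midCone_iff hl,
        normalForm_mem_midCone_iff hc2] at hu
    -- The parameter must be strictly positive to land in the interior of the convex forms. For
    -- $c\le 0$ the value $(c+1/5)/2$ is positive and small enough to keep the distance below the
    -- threshold.
    obtain ⟨c', hc'0, hc'1, hcc', hc'⟩ : ∃ c' : ℝ, 0 < c' ∧ c' ≤ 1 / 3 ∧ c ≤ c' ∧
        2 / 5 * (1 + 3 * c') < 1 + 3 * c := by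
      by_cases h : 0 < c
      · exact ⟨c, h, hc2, le_rfl, by linarith⟩
      · exact ⟨(c + 1 / 5) / 2, by linarith, by linarith, by linarith, by linarith⟩
    set a := (1 + 3 * c) / (1 + 3 * c') with ha
    have hden : 0 < 1 + 3 * c' := by linarith
    have ha0 : 0 < a := div_pos (by linarith) hden
    have ha1 : a ≤ 1 := by rw [ha, div_le_one hden]; linarith
    have haeq : a * (1 + 3 * c') = 1 + 3 * c := by rw [ha]; field_simp
    set V := rho g⁻¹ • normalForm c' with hV
    have hVp : V ∈ posCone := rho_smul_mem_posCone _ (normalForm_mem_posCone (by linarith))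
    have hV0 : V ≠ 0 := hP.ne_zero hVp
    have hu' : u = l • rho g⁻¹ • normalForm c := by rw [← rho_smul, ← hg, rho_inv_smul]
    refine ⟨Projectivization.mk ℝ V hV0, mk_mem_omegaMin hV0 fun z hz => ?_, ?_⟩
    · rw [hV, pencilForm_rho_inv]
      exact pencilForm_normalForm_pos (by linarith) (by linarith) hc'0 _ (symSq_ne_zero _ hz)
    · rw [omegaMax_eq]
      have c1 : u - (l * a) • V ∈ closure posCone := by
        rw [mem_closure_posCone]
        intro w
        have : u - (l * a) • V = rho g⁻¹ • (l • (normalForm c - a • normalForm c')) := by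
          rw [hu', rho_smul, smul_sub, rho_smul, smul_sub, smul_smul]
        rw [this, quartic_rho_inv, quartic_smul, quartic_sub, quartic_smul]
        set p := g • w
        rw [vec2_eta p, quartic_normalForm, quartic_normalForm]
        apply mul_nonneg hl.le
        have : p 0 ^ 4 + 6 * c * p 0 ^ 2 * p 1 ^ 2 + p 1 ^ 4 -
          a * (p 0 ^ 4 + 6 * c' * p 0 ^ 2 * p 1 ^ 2 + p 1 ^ 4) =
            (1 - a) * (p 0 ^ 2 - p 1 ^ 2) ^ 2 := by
          linear_combination (-2 * p 0 ^ 2 * p 1 ^ 2) * haeq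
        rw [this]
        exact mul_nonneg (by linarith) (sq_nonneg _)
      have c2 : V - l⁻¹ • u ∈ closure posCone := by
        rw [mem_closure_posCone]
        intro w
        have : V - l⁻¹ • u = rho g⁻¹ • (normalForm c' - normalForm c) := by
          rw [hu', smul_smul, inv_mul_cancel₀ hl.ne', one_smul, smul_sub]
        rw [this, quartic_rho_inv, quartic_sub]
        set p := g • w
        rw [vec2_eta p, quartic_normalForm, quartic_normalForm]
        have : 0 ≤ (c' - c) * (p 0 ^ 2 * p 1 ^ 2) := mul_nonneg (by linarith) (by positivity)
        nlinarith
      refine (hP.hilbertDist_le hup hVp (mul_pos hl ha0) (inv_pos.2 hl) c1 c2).trans_lt ?_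
      rw [show l * a * l⁻¹ = a by field_simp]
      have h4 : Real.log (2 / 5) < Real.log a := by
        apply Real.log_lt_log (by norm_num)
        rw [ha, lt_div_iff₀ hden]
        exact hc'
      have : Real.log (2 / 5) = -Real.log (5 / 2) := by
        rw [← Real.log_inv]; norm_num
      linarith

end HilbertGeom

namespace HilbertGeom

/-! ### Fundamental domains of discrete subgroups -/

section FundamentalDomain

open MeasureTheory

variable {G : Type*} [Group G] [TopologicalSpace G] [IsTopologicalGroup G]

/-- Discreteness isolates $1$ in `Γ`, and continuity of $(a,b)\mapsto ab^{-1}$ spreads this to a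
neighbourhood injecting into the quotient. -/
theorem exists_small_nhds_one (Γ : Subgroup G) [DiscreteTopology Γ] :
    ∃ W : Set G, IsOpen W ∧ (1 : G) ∈ W ∧ ∀ a ∈ W, ∀ b ∈ W, a * b⁻¹ ∈ Γ → a = b := by
  have h1 : ({1} : Set Γ) ∈ 𝓝 (1 : Γ) := by simp [nhds_discrete]
  rw [nhds_subtype, Filter.mem_comap] at h1
  obtain ⟨U, hU, hU1⟩ := h1
  have hc : Filter.Tendsto (fun p : G × G => p.1 * p.2⁻¹) (𝓝 (1, 1)) (𝓝 1) := by
    have : Continuous fun p : G × G => p.1 * p.2⁻¹ := by fun_prop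
    have := this.tendsto (1, 1)
    simpa using this
  have h2 := hc hU
  rw [Filter.mem_map, nhds_prod_eq, Filter.mem_prod_self_iff] at h2
  obtain ⟨V, hV, hVU⟩ := h2
  obtain ⟨W, hWV, hW, hW1⟩ := mem_nhds_iff.1 hV
  refine ⟨W, hW, hW1, fun a ha b hb hab => ?_⟩
  have h3 : a * b⁻¹ ∈ U := hVU (Set.mk_mem_prod (hWV ha) (hWV hb))
  have h4 : (⟨a * b⁻¹, hab⟩ : Γ) ∈ ({1} : Set Γ) := hU1 h3
  have h5 : a * b⁻¹ = 1 := congrArg Subtype.val h4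
  exact mul_inv_eq_one.1 h5

/-- Every Borel set whose translates under a discrete countable subgroup cover the group contains
a fundamental domain. -/
theorem exists_isFundamentalDomain_subset [SecondCountableTopology G] [MeasurableSpace G]
    [BorelSpace G] (Γ : Subgroup G) [DiscreteTopology Γ] [Countable Γ] (μ : Measure G) {S : Set G}
    (hS : MeasurableSet S) (hcov : ∀ g : G, ∃ γ ∈ Γ, γ * g ∈ S) :
    ∃ F ⊆ S, IsFundamentalDomain Γ F μ := by
  obtain ⟨W, hW, hW1, hWΓ⟩ := exists_small_nhds_one Γ
  have hnhds : ∀ x : G, {g | g * x⁻¹ ∈ W} ∈ 𝓝 x := fun x =>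
    (hW.preimage (by fun_prop : Continuous fun g => g * x⁻¹)).mem_nhds (by simpa using hW1)
  obtain ⟨s, hs, hsU⟩ := TopologicalSpace.countable_cover_nhds hnhds
  have hsne : s.Nonempty := by
    by_contra h
    rw [Set.not_nonempty_iff_eq_empty] at h
    rw [h] at hsU
    simp at hsU
    exact (Set.empty_ne_univ (α := G)) hsU
  obtain ⟨x, hx⟩ := hs.exists_eq_range hsne
  -- Countably many pieces cover `S`, each meeting every orbit at most once.
  set A : ℕ → Set G := fun i => {g | g * (x i)⁻¹ ∈ W} ∩ S with hA
  have hAm : ∀ i, MeasurableSet (A i) := fun i =>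
    ((hW.preimage (by fun_prop : Continuous fun g => g * (x i)⁻¹)).measurableSet).inter hS
  have hAcov : ∀ g ∈ S, ∃ i, g ∈ A i := by
    intro g hg
    have : g ∈ ⋃ y ∈ s, {g | g * y⁻¹ ∈ W} := by rw [hsU]; trivial
    simp only [Set.mem_iUnion] at this
    obtain ⟨y, hy, hgy⟩ := this
    rw [hx] at hy
    obtain ⟨i, rfl⟩ := hy
    exact ⟨i, hgy, hg⟩
  have hAinj : ∀ i, ∀ a ∈ A i, ∀ γ : Γ, (γ : G) * a ∈ A i → γ = 1 := by
    intro i a ha γ hγ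
    have := hWΓ _ hγ.1 _ ha.1 (by simp [mul_assoc])
    have h2 : (γ : G) * a = a := mul_right_cancel this
    exact Subtype.ext (by simpa using h2)
  -- From each orbit, the representative in the first piece that the orbit meets is kept.
  set F : Set G := ⋃ i, (A i \ ⋃ j, ⋃ (_ : j < i), ⋃ γ : Γ, {g | (γ : G) * g ∈ A j}) with hF
  have hmem : ∀ g, g ∈ F ↔ ∃ i, g ∈ A i ∧ ∀ j < i, ∀ γ : Γ, (γ : G) * g ∉ A j := by
    intro g
    simp [hF]
  refine ⟨F, fun g hg => ?_, ?_, ?_, ?_⟩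
  · obtain ⟨i, hi, -⟩ := (hmem g).1 hg
    exact hi.2
  · refine (MeasurableSet.iUnion fun i => (hAm i).diff ?_).nullMeasurableSet
    exact MeasurableSet.iUnion fun j => MeasurableSet.iUnion fun _ => MeasurableSet.iUnion fun γ =>
      (by fun_prop : Continuous fun g => (γ : G) * g).measurable (hAm j)
  · refine Filter.Eventually.of_forall fun g => ?_
    have hex : ∃ i, ∃ γ : Γ, (γ : G) * g ∈ A i := by
      obtain ⟨γ, hγ, hg⟩ := hcov g
      obtain ⟨i, hi⟩ := hAcov _ hg
      exact ⟨i, ⟨γ, hγ⟩, hi⟩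
    classical
    obtain ⟨γ, hγ⟩ := Nat.find_spec hex
    refine ⟨γ, (hmem _).2 ⟨_, hγ, fun j hj γ' hγ' => ?_⟩⟩
    refine Nat.find_min hex hj ⟨γ' * γ, ?_⟩
    rw [Subgroup.coe_mul, mul_assoc]
    exact hγ'
  · intro γ₁ γ₂ hne
    refine Disjoint.aedisjoint ?_
    rw [Set.disjoint_left]
    rintro _ ⟨y, hy, rfl⟩ ⟨y', hy', h⟩
    have hyy : (γ₂ : G) * y' = (γ₁ : G) * y := h
    obtain ⟨i, hi, hi'⟩ := (hmem y).1 hy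
    obtain ⟨j, hj, hj'⟩ := (hmem y').1 hy'
    have e1 : ((γ₂⁻¹ * γ₁ : Γ) : G) * y = y' := by
      simp [mul_assoc, ← hyy]
    have e2 : ((γ₁⁻¹ * γ₂ : Γ) : G) * y' = y := by
      simp [mul_assoc, hyy]
    rcases lt_trichotomy i j with hij | hij | hij
    · exact hj' i hij (γ₁⁻¹ * γ₂) (by rwa [e2])
    · subst hij
      have := hAinj i y hi (γ₂⁻¹ * γ₁) (by rwa [e1])
      exact hne (inv_mul_eq_one.1 this).symm
    · exact hi' j hij (γ₂⁻¹ * γ₁) (by rwa [e1])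

end FundamentalDomain

/-! ### The modular group as a lattice -/

theorem isClosedEmbedding_sl2_val :
    Topology.IsClosedEmbedding (fun (g : SL(2, ℝ)) (i j : Fin 2) => g i j) := by
  have hc : IsClosed {A : Matrix (Fin 2) (Fin 2) ℝ | A.det = 1} :=
    isClosed_eq (by fun_prop) continuous_const
  exact hc.isClosedEmbedding_subtypeVal

instance : LocallyCompactSpace SL(2, ℝ) := isClosedEmbedding_sl2_val.locallyCompactSpace

instance : SecondCountableTopology SL(2, ℝ) :=
  isClosedEmbedding_sl2_val.isEmbedding.secondCountableTopology

instance : T2Space SL(2, ℝ) := isClosedEmbedding_sl2_val.isEmbedding.t2Space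

theorem isCompact_sl2_bounded (C : ℝ) : IsCompact {g : SL(2, ℝ) | ∀ i j, |g i j| ≤ C} := by
  have h : IsCompact (Set.univ.pi fun _ : Fin 2 => Set.univ.pi fun _ : Fin 2 => Set.Icc (-C) C) :=
    isCompact_univ_pi fun _ => isCompact_univ_pi fun _ => isCompact_Icc
  have := isClosedEmbedding_sl2_val.isCompact_preimage h
  convert this using 1
  ext g
  simp only [Set.mem_preimage, Set.mem_pi, Set.mem_univ, forall_true_left, Set.mem_Icc,
    Set.mem_ofPred_eq, abs_le]

theorem continuous_sl2_entry (i j : Fin 2) : Continuous fun g : SL(2, ℝ) => g i j :=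
  (continuous_apply j).comp ((continuous_apply i).comp isClosedEmbedding_sl2_val.continuous)

/-- The modular group, as a subgroup of `SL₂(ℝ)`. -/
def modularGroup : Subgroup SL(2, ℝ) :=
  (Matrix.SpecialLinearGroup.map (n := Fin 2) (Int.castRingHom ℝ)).range

theorem entry_of_mem_modularGroup {g : SL(2, ℝ)} (hg : g ∈ modularGroup) (i j : Fin 2) :
    ∃ n : ℤ, g i j = n := by
  obtain ⟨γ, rfl⟩ := hg
  exact ⟨γ i j, rfl⟩

theorem sl2_mem_modularGroup {a b c e : ℤ} (h : (a : ℝ) * e - b * c = 1) :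
    sl2 a b c e h ∈ modularGroup := by
  have h' : a * e - b * c = 1 := by exact_mod_cast h
  refine ⟨⟨!![a, b; c, e], by rw [Matrix.det_fin_two_of, h']⟩, ?_⟩
  ext i j
  fin_cases i <;> fin_cases j <;> rfl

instance : DiscreteTopology modularGroup := by
  unfold modularGroup
  infer_instance

instance : Countable modularGroup :=
  have : Countable SL(2, ℤ) :=
    Function.Injective.countable (f := fun (g : SL(2, ℤ)) (i j : Fin 2) => g i j)
      fun g h hgh => by
        ext i j
        exact congrFun (congrFun hgh i) j
  Set.countable_range (Matrix.SpecialLinearGroup.map (n := Fin 2) (Int.castRingHom ℝ))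

theorem finite_modularGroup_bounded (C : ℝ) :
    {g : SL(2, ℝ) | g ∈ modularGroup ∧ ∀ i j, |g i j| ≤ C}.Finite := by
  have hI : {x : ℝ | ∃ n : ℤ, x = n ∧ |x| ≤ C}.Finite := by
    refine ((Set.finite_Icc (-⌈C⌉) ⌈C⌉).image (fun n : ℤ => (n : ℝ))).subset ?_
    rintro x ⟨n, rfl, hn⟩
    refine ⟨n, ?_, rfl⟩
    rw [abs_le] at hn
    have h1 := Int.le_ceil C
    constructor
    · have : ((-⌈C⌉ : ℤ) : ℝ) ≤ n := by push_cast; linarith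
      exact_mod_cast this
    · have : (n : ℝ) ≤ (⌈C⌉ : ℤ) := by linarith
      exact_mod_cast this
  have h2 : (Set.univ.pi fun _ : Fin 2 => Set.univ.pi fun _ : Fin 2 =>
      {x : ℝ | ∃ n : ℤ, x = n ∧ |x| ≤ C}).Finite :=
    Set.Finite.pi fun _ => Set.Finite.pi fun _ => hI
  refine Set.Finite.of_finite_image (f := fun (g : SL(2, ℝ)) (i j : Fin 2) => g i j)
    (h2.subset ?_) isClosedEmbedding_sl2_val.injective.injOn
  rintro _ ⟨g, ⟨hg, hC⟩, rfl⟩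
  simp only [Set.mem_pi, Set.mem_univ, forall_true_left]
  intro i j
  obtain ⟨n, hn⟩ := entry_of_mem_modularGroup hg i j
  exact ⟨n, hn, hC i j⟩

/-! ### The orbit map $g\mapsto g\cdot i$ in coordinates -/

/-- The squared norm of the second row; the inverse of the imaginary part of `g • i`. -/
def rowNorm (g : SL(2, ℝ)) : ℝ := g 1 0 ^ 2 + g 1 1 ^ 2

/-- The real part of `g • i`. -/
noncomputable def realPart (g : SL(2, ℝ)) : ℝ := (g 0 0 * g 1 0 + g 0 1 * g 1 1) / rowNorm g

theorem rowNorm_pos (g : SL(2, ℝ)) : 0 < rowNorm g := by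
  have h := sl2_det g
  by_contra! hle
  have h1 : g 1 0 = 0 := by
    unfold rowNorm at hle
    nlinarith [sq_nonneg (g 1 0), sq_nonneg (g 1 1)]
  have h2 : g 1 1 = 0 := by
    unfold rowNorm at hle
    nlinarith [sq_nonneg (g 1 0), sq_nonneg (g 1 1)]
  rw [h1, h2] at h
  simp at h

theorem continuous_rowNorm : Continuous rowNorm := by
  unfold rowNorm
  have h1 := continuous_sl2_entry 1 0
  have h2 := continuous_sl2_entry 1 1
  fun_prop

theorem continuous_realPart : Continuous realPart := by
  have h1 := continuous_sl2_entry 1 0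
  have h2 := continuous_sl2_entry 1 1
  have h3 := continuous_sl2_entry 0 0
  have h4 := continuous_sl2_entry 0 1
  exact Continuous.div (by fun_prop) continuous_rowNorm fun g => (rowNorm_pos g).ne'

theorem smul_I_eq (g : SL(2, ℝ)) :
    (g • UpperHalfPlane.I).re = realPart g ∧ (g • UpperHalfPlane.I).im = (rowNorm g)⁻¹ := by
  have hd := sl2_det g
  have hr := (rowNorm_pos g).ne'
  have h : ((g • UpperHalfPlane.I : UpperHalfPlane) : ℂ) =
      (realPart g : ℂ) + ((rowNorm g)⁻¹ : ℝ) * Complex.I := by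
    rw [UpperHalfPlane.specialLinearGroup_apply]
    have hne : ((g 1 0 : ℝ) : ℂ) * Complex.I + (g 1 1 : ℝ) ≠ 0 := by
      intro h0
      have him := congrArg Complex.im h0
      have hre := congrArg Complex.re h0
      simp at him hre
      exact hr (by simp [rowNorm, him, hre])
    have hne' : ((rowNorm g : ℝ) : ℂ) ≠ 0 := by exact_mod_cast hr
    have hd' : ((g 0 0 : ℝ) : ℂ) * (g 1 1 : ℝ) - (g 0 1 : ℝ) * (g 1 0 : ℝ) = 1 := by
      exact_mod_cast hd
    change ((g 0 0 : ℝ) * Complex.I + (g 0 1 : ℝ)) / ((g 1 0 : ℝ) * Complex.I + (g 1 1 : ℝ)) = _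
    rw [div_eq_iff hne, realPart]
    push_cast
    field_simp
    simp only [rowNorm]
    push_cast
    linear_combination ((g 1 1 : ℂ) * Complex.I - g 1 0) * hd' - (g 1 0 : ℂ) * Complex.I_sq
  constructor
  · have := congrArg Complex.re h
    simpa using this
  · have := congrArg Complex.im h
    simpa using this

end HilbertGeom

namespace HilbertGeom

/-! ### Finite covolume and non-cocompactness of the modular group -/

/-- The set of the `g` with `g • i` of real part in `I` and inverse imaginary part in `J`. -/
def siegelSet (I J : Set ℝ) : Set SL(2, ℝ) := {g | realPart g ∈ I ∧ rowNorm g ∈ J}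

/-- In the classical fundamental domain $|\tau|\ge 1$ and $|\mathrm{Re}\,\tau|\le 1/2$ force
imaginary part greater than $1/2$, so its inverse is less than $2$. -/
theorem exists_mul_mem_siegelSet (g : SL(2, ℝ)) :
    ∃ γ ∈ modularGroup, γ * g ∈ siegelSet (Set.Ico (-1) 1) (Set.Ioc 0 2) := by
  obtain ⟨γ, hγ⟩ := ModularGroup.exists_smul_mem_fd (g • UpperHalfPlane.I)
  set h := Matrix.SpecialLinearGroup.map (n := Fin 2) (Int.castRingHom ℝ) γ with hh
  refine ⟨h, ⟨γ, rfl⟩, ?_⟩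
  have e : γ • g • UpperHalfPlane.I = (h * g) • UpperHalfPlane.I := by
    rw [mul_smul]
    rfl
  rw [e] at hγ
  obtain ⟨h1, h2⟩ := smul_I_eq (h * g)
  have h3 : |((h * g) • UpperHalfPlane.I).re| ≤ 1 / 2 := hγ.2
  have h4 : 1 ≤ Complex.normSq ((h * g) • UpperHalfPlane.I : UpperHalfPlane) := hγ.1
  have h5 : Complex.normSq ((h * g) • UpperHalfPlane.I : UpperHalfPlane) =
      ((h * g) • UpperHalfPlane.I).re ^ 2 + ((h * g) • UpperHalfPlane.I).im ^ 2 := by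
    rw [Complex.normSq_apply, sq, sq]
    rfl
  rw [h5] at h4
  rw [h1] at h3 h4
  rw [h2] at h4
  have hpos := rowNorm_pos (h * g)
  rw [abs_le] at h3
  refine ⟨⟨by linarith [h3.1], by linarith [h3.2]⟩, hpos, ?_⟩
  by_contra! hlt
  have : (rowNorm (h * g))⁻¹ < 1 / 2 := by
    rw [inv_lt_comm₀ hpos (by norm_num)]
    norm_num
    exact hlt
  have h6 : 0 < (rowNorm (h * g))⁻¹ := inv_pos.2 hpos
  nlinarith

theorem sl2_mul_zero {a b c e : ℝ} (h : a * e - b * c = 1) (g : SL(2, ℝ)) (j : Fin 2) :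
    (sl2 a b c e h * g) 0 j = a * g 0 j + b * g 1 j := by
  change (!![a, b; c, e] * g.1) 0 j = _
  simp [Matrix.mul_apply, Fin.sum_univ_two]

theorem sl2_mul_one {a b c e : ℝ} (h : a * e - b * c = 1) (g : SL(2, ℝ)) (j : Fin 2) :
    (sl2 a b c e h * g) 1 j = c * g 0 j + e * g 1 j := by
  change (!![a, b; c, e] * g.1) 1 j = _
  simp [Matrix.mul_apply, Fin.sum_univ_two]

/-- Diagonal matrices. -/
noncomputable def diagSL (s : ℝ) (hs : s ≠ 0) : SL(2, ℝ) :=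
  sl2 s 0 0 s⁻¹ (by rw [mul_inv_cancel₀ hs]; ring)

/-- Unipotent matrices. -/
def unipSL (x : ℝ) : SL(2, ℝ) := sl2 1 x 0 1 (by ring)

theorem rowNorm_diagSL_mul {s : ℝ} (hs : s ≠ 0) (g : SL(2, ℝ)) :
    rowNorm (diagSL s hs * g) = rowNorm g / s ^ 2 := by
  simp only [rowNorm, diagSL, sl2_mul_one]
  field_simp
  ring

theorem realPart_diagSL_mul {s : ℝ} (hs : s ≠ 0) (g : SL(2, ℝ)) :
    realPart (diagSL s hs * g) = s ^ 2 * realPart g := by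
  have := (rowNorm_pos g).ne'
  rw [realPart, rowNorm_diagSL_mul, realPart]
  simp only [diagSL, sl2_mul_one, sl2_mul_zero]
  field_simp
  ring

theorem rowNorm_unipSL_mul (x : ℝ) (g : SL(2, ℝ)) : rowNorm (unipSL x * g) = rowNorm g := by
  simp only [rowNorm, unipSL, sl2_mul_one]
  ring

theorem realPart_unipSL_mul (x : ℝ) (g : SL(2, ℝ)) :
    realPart (unipSL x * g) = realPart g + x := by
  have := (rowNorm_pos g).ne'
  rw [realPart, rowNorm_unipSL_mul, realPart, eq_comm, div_add' _ _ _ this]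
  congr 1
  simp only [unipSL, sl2_mul_one, sl2_mul_zero, rowNorm]
  ring

/-- With $\rho$ the squared norm of the second row and $R$ the real part, the first row has squared
norm $1/\rho+R^2\rho$, so both rows stay bounded. -/
theorem siegelSet_subset_bounded :
    siegelSet (Set.Ico (-1) 2) (Set.Ioc (1 / 2) 2) ⊆ {g : SL(2, ℝ) | ∀ i j, |g i j| ≤ 6} := by
  rintro g ⟨⟨h1, h2⟩, h3, h4⟩
  have hd := sl2_det g
  have hR : realPart g * rowNorm g = g 0 0 * g 1 0 + g 0 1 * g 1 1 :=
    div_mul_cancel₀ _ (rowNorm_pos g).ne'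
  have hid : (g 0 0 ^ 2 + g 0 1 ^ 2) * rowNorm g = 1 + (realPart g * rowNorm g) ^ 2 := by
    rw [hR, rowNorm]
    linear_combination (g 0 0 * g 1 1 - g 0 1 * g 1 0 + 1) * hd
  have hR2 : realPart g ^ 2 ≤ 4 := by nlinarith
  have hb : g 0 0 ^ 2 + g 0 1 ^ 2 ≤ 36 := by
    have h5 : (g 0 0 ^ 2 + g 0 1 ^ 2) * rowNorm g ≤ (2 + 4 * 2) * rowNorm g := by
      rw [hid]
      nlinarith [mul_le_mul_of_nonneg_right hR2 (sq_nonneg (rowNorm g)), sq_nonneg (rowNorm g)]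
    have := le_of_mul_le_mul_right h5 (rowNorm_pos g)
    linarith
  have hc : g 1 0 ^ 2 + g 1 1 ^ 2 ≤ 2 := h4
  intro i j
  apply abs_le_of_sq_le_sq _ (by norm_num)
  fin_cases i <;> fin_cases j <;> simp <;>
    nlinarith [sq_nonneg (g 0 0), sq_nonneg (g 0 1), sq_nonneg (g 1 0), sq_nonneg (g 1 1)]

-- The Siegel set is cut into slices going up the cusp. Left invariance of Haar measure under
-- diagonal and unipotent matrices shows that the $n$-th slice has measure at most $4^{-n}$ times
-- that of a relatively compact set, so the series converges.
open MeasureTheory in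
theorem modularGroup_isLattice : IsLatticeSL2 modularGroup := by
  refine ⟨inferInstance, ?_⟩
  let _ : MeasurableSpace SL(2, ℝ) := borel SL(2, ℝ)
  have : BorelSpace SL(2, ℝ) := ⟨rfl⟩
  set μ : Measure SL(2, ℝ) := Measure.haar
  have hmeas : ∀ {I J : Set ℝ}, MeasurableSet I → MeasurableSet J →
      MeasurableSet (siegelSet I J) := fun hI hJ =>
    (continuous_realPart.measurable hI).inter (continuous_rowNorm.measurable hJ)
  set M := μ (siegelSet (Set.Ico (-1) 2) (Set.Ioc (1 / 2) 2)) with hM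
  have hMfin : M < ∞ :=
    (measure_mono siegelSet_subset_bounded).trans_lt (isCompact_sl2_bounded 6).measure_lt_top
  have hpiece : ∀ n : ℕ, μ (siegelSet (Set.Ico (-1) 1)
      (Set.Ioc (1 / 2 * (4⁻¹ : ℝ) ^ n) (2 * (4⁻¹ : ℝ) ^ n))) ≤ M * (4⁻¹ : ℝ≥0∞) ^ n := by
    intro n
    -- The diagonal matrix with entry $2^n$ brings the $n$-th slice back to a fixed height,
    -- shrinking its width by $4^n$.
    set T := siegelSet (Set.Ico (-(4⁻¹ : ℝ) ^ n) ((4⁻¹ : ℝ) ^ n)) (Set.Ioc (1 / 2) 2) with hT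
    have hq : (0 : ℝ) < (4⁻¹ : ℝ) ^ n := by positivity
    have hq4 : (4 : ℝ) ^ n * (4⁻¹ : ℝ) ^ n = 1 := by rw [← mul_pow]; norm_num
    have hs2 : ((2 : ℝ) ^ n) ^ 2 = 4 ^ n := by rw [← pow_mul, mul_comm, pow_mul]; norm_num
    have e1 : (fun h => diagSL ((2 : ℝ) ^ n) (by positivity) * h) ⁻¹' (siegelSet (Set.Ico (-1) 1)
        (Set.Ioc (1 / 2 * (4⁻¹ : ℝ) ^ n) (2 * (4⁻¹ : ℝ) ^ n))) = T := by
      ext h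
      simp only [Set.mem_preimage, siegelSet, Set.mem_ofPred_eq, rowNorm_diagSL_mul,
        realPart_diagSL_mul, hs2, hT, Set.mem_Ico, Set.mem_Ioc]
      have h4 : (0 : ℝ) < 4 ^ n := by positivity
      have i1 : (4⁻¹ : ℝ) ^ n = 1 / 4 ^ n := by rw [inv_pow, one_div]
      rw [i1, lt_div_iff₀ h4, div_le_iff₀ h4, ← neg_div, div_le_iff₀ h4, lt_div_iff₀ h4,
        mul_assoc, mul_assoc, div_mul_cancel₀ _ h4.ne', mul_one, mul_one, mul_comm]
    rw [← measure_preimage_mul μ (diagSL ((2 : ℝ) ^ n) (by positivity)), e1]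
    have hTm : MeasurableSet T := hmeas measurableSet_Ico measurableSet_Ioc
    -- Horizontal translates of `T` by multiples of its width. The first $4^n$ of them are disjoint
    -- and fit in a fixed bounded box.
    set B : ℕ → Set SL(2, ℝ) := fun k =>
      (fun h => unipSL (-(2 * k * (4⁻¹ : ℝ) ^ n)) * h) ⁻¹' T with hB
    have hBmem : ∀ k h, h ∈ B k ↔ ((2 * k - 1) * (4⁻¹ : ℝ) ^ n ≤ realPart h ∧
        realPart h < (2 * k + 1) * (4⁻¹ : ℝ) ^ n) ∧ 1 / 2 < rowNorm h ∧ rowNorm h ≤ 2 := by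
      intro k h
      simp only [hB, Set.mem_preimage, hT, siegelSet, Set.mem_ofPred_eq, rowNorm_unipSL_mul,
        realPart_unipSL_mul, Set.mem_Ico, Set.mem_Ioc]
      constructor
      · rintro ⟨⟨h1, h2⟩, h3⟩
        exact ⟨⟨by linarith, by linarith⟩, h3⟩
      · rintro ⟨⟨h1, h2⟩, h3⟩
        exact ⟨⟨by linarith, by linarith⟩, h3⟩
    have hBm : ∀ k, MeasurableSet (B k) := fun k =>
      (by fun_prop : Continuous fun h => unipSL (-(2 * k * (4⁻¹ : ℝ) ^ n)) * h).measurable hTm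
    have hBμ : ∀ k, μ (B k) = μ T := fun k => measure_preimage_mul μ _ _
    have hdisj : Set.PairwiseDisjoint (↑(Finset.range (4 ^ n))) B := by
      have aux : ∀ {k l : ℕ}, k < l → Disjoint (B k) (B l) := by
        intro k l hkl
        rw [Set.disjoint_left]
        intro h hk hl
        rw [hBmem] at hk hl
        have : (k : ℝ) + 1 ≤ l := by exact_mod_cast hkl
        have : (2 * k + 1) * (4⁻¹ : ℝ) ^ n ≤ (2 * l - 1) * (4⁻¹ : ℝ) ^ n := by
          apply mul_le_mul_of_nonneg_right _ hq.le
          linarith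
        linarith [hk.1.2, hl.1.1]
      intro k _ l _ hkl
      rcases lt_or_gt_of_ne hkl with h | h
      · exact aux h
      · exact (aux h).symm
    have hsub : (⋃ k ∈ Finset.range (4 ^ n), B k) ⊆
        siegelSet (Set.Ico (-1) 2) (Set.Ioc (1 / 2) 2) := by
      intro h hh
      simp only [Set.mem_iUnion, Finset.mem_range] at hh
      obtain ⟨k, hk, hh⟩ := hh
      rw [hBmem] at hh
      have hk' : (k : ℝ) + 1 ≤ 4 ^ n := by exact_mod_cast hk
      have hq1 : (4⁻¹ : ℝ) ^ n ≤ 1 := pow_le_one₀ (by norm_num) (by norm_num)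
      have hk0 : (0 : ℝ) ≤ k := Nat.cast_nonneg k
      refine ⟨⟨?_, ?_⟩, hh.2⟩
      · have : 0 ≤ (k : ℝ) * (4⁻¹ : ℝ) ^ n := by positivity
        linarith [hh.1.1]
      · have : ((k : ℝ) + 1) * (4⁻¹ : ℝ) ^ n ≤ 4 ^ n * (4⁻¹ : ℝ) ^ n :=
          mul_le_mul_of_nonneg_right hk' hq.le
        rw [hq4] at this
        linarith [hh.1.2]
    have hsum : (4 : ℝ≥0∞) ^ n * μ T ≤ M := by
      have := measure_mono (μ := μ) hsub
      rw [measure_biUnion_finset hdisj fun k _ => hBm k] at this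
      rw [Finset.sum_congr rfl fun k _ => hBμ k, Finset.sum_const, Finset.card_range,
        nsmul_eq_mul] at this
      simpa only [Nat.cast_pow, Nat.cast_ofNat] using this
    have h4n : (4 : ℝ≥0∞) ^ n ≠ 0 := pow_ne_zero _ (by norm_num)
    have h4t : (4 : ℝ≥0∞) ^ n ≠ ∞ := ENNReal.pow_ne_top (by norm_num)
    rw [← ENNReal.inv_pow, ← div_eq_mul_inv, ENNReal.le_div_iff_mul_le (Or.inl h4n) (Or.inl h4t),
      mul_comm]
    exact hsum
  have hfin : μ (siegelSet (Set.Ico (-1) 1) (Set.Ioc 0 2)) < ∞ := by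
    -- The intervals $(\frac12 4^{-n},2\cdot4^{-n}]$ tile $(0,2]$: the lower end of each is the
    -- upper end of the next.
    have hcover : siegelSet (Set.Ico (-1) 1) (Set.Ioc 0 2) ⊆ ⋃ n : ℕ, siegelSet (Set.Ico (-1) 1)
        (Set.Ioc (1 / 2 * (4⁻¹ : ℝ) ^ n) (2 * (4⁻¹ : ℝ) ^ n)) := by
      rintro g ⟨h1, h2, h3⟩
      have hex : ∃ n : ℕ, 1 / 2 * (4⁻¹ : ℝ) ^ n < rowNorm g := by
        obtain ⟨n, hn⟩ := exists_pow_lt_of_lt_one h2 (by norm_num : (4⁻¹ : ℝ) < 1)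
        exact ⟨n, by linarith [pow_pos (by norm_num : (0 : ℝ) < 4⁻¹) n]⟩
      classical
      simp only [Set.mem_iUnion]
      refine ⟨Nat.find hex, h1, Nat.find_spec hex, ?_⟩
      rcases Nat.eq_zero_or_pos (Nat.find hex) with h0 | h0
      · rw [h0]; simpa using h3
      · have := Nat.find_min hex (Nat.sub_one_lt h0.ne')
        rw [not_lt] at this
        obtain ⟨m, hm⟩ : ∃ m, Nat.find hex = m + 1 := ⟨_, (Nat.sub_add_cancel h0).symm⟩
        rw [hm] at this ⊢
        rw [Nat.add_sub_cancel] at this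
        rw [pow_succ]
        linarith
    calc μ (siegelSet (Set.Ico (-1) 1) (Set.Ioc 0 2)) ≤ ∑' n : ℕ, μ (siegelSet (Set.Ico (-1) 1)
        (Set.Ioc (1 / 2 * (4⁻¹ : ℝ) ^ n) (2 * (4⁻¹ : ℝ) ^ n))) :=
          (measure_mono hcover).trans (measure_iUnion_le _)
      _ ≤ ∑' n : ℕ, M * (4⁻¹ : ℝ≥0∞) ^ n := ENNReal.tsum_le_tsum hpiece
      _ = M * (1 - 4⁻¹)⁻¹ := by rw [ENNReal.tsum_mul_left, ENNReal.tsum_geometric]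
      _ < ∞ := by
        apply ENNReal.mul_lt_top hMfin
        rw [ENNReal.inv_lt_top, tsub_pos_iff_lt, ENNReal.inv_lt_one]
        norm_num
  obtain ⟨F, hFS, hF⟩ := exists_isFundamentalDomain_subset modularGroup μ
    (hmeas measurableSet_Ico measurableSet_Ioc) exists_mul_mem_siegelSet
  exact ⟨μ, F, inferInstance, hF, (measure_mono hFS).trans_lt hfin⟩

/-- The cosets having a representative with second row bounded by $m$ form an increasing open cover
of the quotient. A diagonal matrix times an integral one has second row $m+1$ times a nonzero
integral row, so no single member covers. -/
theorem modularGroup_not_cocompact : ¬ IsCocompactSL2 modularGroup := by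
  intro hcomp
  have : CompactSpace (SL(2, ℝ) ⧸ modularGroup) := hcomp
  set U : ℕ → Set (SL(2, ℝ) ⧸ modularGroup) := fun m =>
    (QuotientGroup.mk : SL(2, ℝ) → SL(2, ℝ) ⧸ modularGroup) '' {g | ∀ j, |g 1 j| < m} with hU
  have hopen : ∀ m, IsOpen (U m) := by
    intro m
    apply QuotientGroup.isOpenMap_coe
    have : {g : SL(2, ℝ) | ∀ j, |g 1 j| < m} = ⋂ j : Fin 2, {g : SL(2, ℝ) | |g 1 j| < (m : ℝ)} := by
      ext; simp
    rw [this]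
    exact isOpen_iInter_of_finite fun j =>
      isOpen_lt (continuous_abs.comp (continuous_sl2_entry 1 j)) continuous_const
  have hcov : (Set.univ : Set (SL(2, ℝ) ⧸ modularGroup)) ⊆ ⋃ m, U m := by
    intro x _
    obtain ⟨g, rfl⟩ := QuotientGroup.mk_surjective x
    obtain ⟨m, hm⟩ := exists_nat_gt (max |g 1 0| |g 1 1|)
    rw [max_lt_iff] at hm
    refine Set.mem_iUnion.2 ⟨m, g, fun j => ?_, rfl⟩
    fin_cases j
    · exact hm.1
    · exact hm.2
  have hmono : Monotone U := by
    intro m n hmn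
    apply Set.image_mono
    intro g hg j
    exact (hg j).trans_le (by exact_mod_cast hmn)
  obtain ⟨m, hm⟩ := isCompact_univ.elim_directed_cover U hopen hcov hmono.directed_le
  have hm1 : (0 : ℝ) < (m : ℝ) + 1 := by positivity
  have hne : ((m : ℝ) + 1)⁻¹ ≠ 0 := (inv_pos.2 hm1).ne'
  obtain ⟨k, hk, hka⟩ := hm (Set.mem_univ (QuotientGroup.mk (diagSL ((m : ℝ) + 1)⁻¹ hne)))
  rw [eq_comm, QuotientGroup.eq] at hka
  set γ := (diagSL ((m : ℝ) + 1)⁻¹ hne)⁻¹ * k with hγ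
  have hkγ : k = diagSL ((m : ℝ) + 1)⁻¹ hne * γ := by rw [hγ, mul_inv_cancel_left]
  have hrow : ∀ j, k 1 j = ((m : ℝ) + 1) * γ 1 j := by
    intro j
    rw [hkγ]
    simp [diagSL, sl2_mul_one]
  have hzero : ∀ j, γ 1 j = 0 := by
    intro j
    obtain ⟨n, hn⟩ := entry_of_mem_modularGroup hka 1 j
    have h1 := hk j
    rw [hrow j, hn, abs_mul, abs_of_pos hm1] at h1
    by_contra hne0
    rw [hn] at hne0
    have hn0 : n ≠ 0 := by exact_mod_cast hne0
    have h2 : (1 : ℝ) ≤ |(n : ℝ)| := by exact_mod_cast Int.one_le_abs hn0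
    nlinarith
  have := rowNorm_pos γ
  rw [rowNorm, hzero, hzero] at this
  norm_num at this

end HilbertGeom

namespace HilbertGeom

/-! ### The modular group acting on quartic forms -/

instance {d : ℕ} : T1Space (Proj d) where
  t1 p := by
    induction p using Projectivization.ind with
    | h v hv =>
      rw [← closure_subset_iff_isClosed]
      intro q hq
      induction q using Projectivization.ind with
      | h w hw =>
        rw [mem_closure_proj_iff] at hq
        have hsub : coneOver {Projectivization.mk ℝ v hv} ⊆ (Submodule.span ℝ {v} : Set (Fin d → ℝ)) := by
          rintro u ⟨hu, h⟩
          obtain ⟨a, ha⟩ := (Projectivization.mk_eq_mk_iff' _ _ _ _ _).1 h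
          exact Submodule.mem_span_singleton.2 ⟨a, ha⟩
        have hcl : IsClosed (Submodule.span ℝ {v} : Set (Fin d → ℝ)) :=
          Submodule.closed_of_finiteDimensional _
        obtain ⟨a, ha⟩ := Submodule.mem_span_singleton.1 (closure_minimal hsub hcl hq)
        exact (Projectivization.mk_eq_mk_iff' _ _ _ _ _).2 ⟨a, ha⟩

theorem tendsto_proj_mk {d : ℕ} {u : ℕ → Fin d → ℝ} {v : Fin d → ℝ} (hu : ∀ n, u n ≠ 0)
    (hv : v ≠ 0) (h : Filter.Tendsto u Filter.atTop (𝓝 v)) :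
    Filter.Tendsto (fun n => Projectivization.mk ℝ (u n) (hu n)) Filter.atTop
      (𝓝 (Projectivization.mk ℝ v hv)) :=
  (continuous_proj_mk.tendsto (⟨v, hv⟩ : {v : Fin d → ℝ // v ≠ 0})).comp
    (tendsto_subtype_rng.2 h : Filter.Tendsto (fun n => (⟨u n, hu n⟩ : {v : Fin d → ℝ // v ≠ 0})) _ _)

theorem exists_int_substMatrix (a b c e : ℤ) :
    ∃ B : Matrix (Fin 5) (Fin 5) ℤ, substMatrix (a : ℝ) b c e = B.map (Int.cast : ℤ → ℝ) := by
  refine ⟨!![a ^ 4, a ^ 3 * c, a ^ 2 * c ^ 2, a * c ^ 3, c ^ 4;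
     4 * a ^ 3 * b, a ^ 3 * e + 3 * a ^ 2 * b * c, 2 * a ^ 2 * c * e + 2 * a * b * c ^ 2,
       3 * a * c ^ 2 * e + b * c ^ 3, 4 * c ^ 3 * e;
     6 * a ^ 2 * b ^ 2, 3 * a ^ 2 * b * e + 3 * a * b ^ 2 * c,
       a ^ 2 * e ^ 2 + 4 * a * b * c * e + b ^ 2 * c ^ 2,
       3 * a * c * e ^ 2 + 3 * b * c ^ 2 * e, 6 * c ^ 2 * e ^ 2;
     4 * a * b ^ 3, 3 * a * b ^ 2 * e + b ^ 3 * c, 2 * a * b * e ^ 2 + 2 * b ^ 2 * c * e,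
       a * e ^ 3 + 3 * b * c * e ^ 2, 4 * c * e ^ 3;
     b ^ 4, b ^ 3 * e, b ^ 2 * e ^ 2, b * e ^ 3, e ^ 4], ?_⟩
  ext i j
  fin_cases i <;> fin_cases j <;> simp [substMatrix]

/-- The image of the modular group in `SL₅(ℝ)`. -/
def quarticGroup : Subgroup SL(5, ℝ) := modularGroup.map rho

theorem rho_mem_quarticGroup {g : SL(2, ℝ)} (hg : g ∈ modularGroup) : rho g ∈ quarticGroup :=
  Subgroup.mem_map_of_mem _ hg

/-- An integral matrix acts on quartic forms by an integral matrix, so the group lies in the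
discrete image of $\mathrm{SL}_5(\mathbb Z)$. -/
instance : DiscreteTopology quarticGroup := by
  have hsub : (quarticGroup : Set SL(5, ℝ)) ⊆
      ((Matrix.SpecialLinearGroup.map (n := Fin 5) (Int.castRingHom ℝ)).range : Set SL(5, ℝ)) := by
    rintro _ ⟨g, hg, rfl⟩
    obtain ⟨γ, rfl⟩ := hg
    obtain ⟨B, hB⟩ := exists_int_substMatrix (γ 1 1) (-γ 0 1) (-γ 1 0) (γ 0 0)
    have hval : (rho (Matrix.SpecialLinearGroup.map (Int.castRingHom ℝ) γ)).1 =
        B.map (Int.cast : ℤ → ℝ) := by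
      rw [← hB]
      push_cast
      rfl
    have hdet : B.det = 1 := by
      have h1 := (rho (Matrix.SpecialLinearGroup.map (Int.castRingHom ℝ) γ)).2
      rw [hval] at h1
      have h2 : ((Int.castRingHom ℝ).mapMatrix B).det = 1 := h1
      rw [← RingHom.map_det] at h2
      simpa using h2
    exact ⟨⟨B, hdet⟩, Subtype.ext hval.symm⟩
  have hd : DiscreteTopology (Matrix.SpecialLinearGroup.map (n := Fin 5) (Int.castRingHom ℝ)).range :=
    inferInstance
  exact DiscreteTopology.of_subset hd hsub

theorem quarticGroup_le_aut : quarticGroup ≤ Aut (projTrace midCone) :=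
  (Subgroup.map_le_range _ _).trans range_rho_le_aut

theorem quartic_normalForm_third (x y : ℝ) :
    quartic (normalForm (1 / 3)) ![x, y] = (x ^ 2 + y ^ 2) ^ 2 := by
  rw [quartic_normalForm]; ring

theorem normalForm_third_mem : normalForm (1 / 3) ∈ midCone :=
  (normalForm_mem_midCone_iff le_rfl).2 (by norm_num)

/-- Compactness applied to the open condition at $m=0$. It yields uniform order comparisons, that
is, uniform bounds on Hilbert distances. -/
theorem IsSharpCone.exists_sub_smul_mem {N : Set (Fin 5 → ℝ)} {f : Module.Dual ℝ (Fin 5 → ℝ)}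
    (hN : IsSharpCone N f) {S T : Set (Fin 5 → ℝ)} (hS : IsCompact S) (hT : IsCompact T)
    (hSN : S ⊆ N) :
    ∃ m : ℝ, 0 < m ∧ ∀ u ∈ S, ∀ v ∈ T, u - m • v ∈ N := by
  have hc : Continuous fun p : ℝ × ((Fin 5 → ℝ) × (Fin 5 → ℝ)) => p.2.1 - p.1 • p.2.2 := by
    fun_prop
  have hev : ∀ᶠ m in 𝓝 (0 : ℝ), ∀ p ∈ S ×ˢ T, p.1 - m • p.2 ∈ N := by
    refine (hS.prod hT).eventually_forall_of_forall_eventually fun p hp => ?_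
    refine (hN.isOpen.preimage hc).mem_nhds ?_
    simpa using hSN hp.1
  have h2 := (hev.filter_mono nhdsWithin_le_nhds).and (self_mem_nhdsWithin : Set.Ioi (0 : ℝ) ∈ 𝓝[>] 0)
  obtain ⟨m, hm, hm0⟩ := h2.exists
  exact ⟨m, hm0, fun u hu v hv => hm (u, v) ⟨hu, hv⟩⟩

theorem exists_quartic_lower {f : Fin 5 → ℝ} (hf : f ∈ posCone) :
    ∃ m : ℝ, 0 < m ∧ ∀ x y : ℝ, m * (x ^ 2 + y ^ 2) ^ 2 ≤ quartic f ![x, y] := by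
  obtain ⟨m, hm, h⟩ := posCone_isSharpCone.exists_sub_smul_mem (S := {f}) (T := {normalForm (1 / 3)})
    isCompact_singleton isCompact_singleton (by simpa using hf)
  refine ⟨m, hm, fun x y => ?_⟩
  have := mem_closure_posCone.1 (subset_closure (h f rfl _ rfl)) ![x, y]
  rw [quartic_sub, quartic_smul, quartic_normalForm_third] at this
  linarith

theorem one_le_sq_add_sq {m n : ℤ} (h : ¬ (m = 0 ∧ n = 0)) : (1 : ℝ) ≤ (m : ℝ) ^ 2 + (n : ℝ) ^ 2 := by
  have : 1 ≤ m ^ 2 + n ^ 2 := by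
    by_contra! hlt
    apply h
    constructor <;> nlinarith [sq_nonneg m, sq_nonneg n]
  exact_mod_cast this

theorem abs_le_of_pow_four_le {x R : ℝ} (h : x ^ 4 ≤ R) : |x| ≤ 1 + R := by
  have h0 : 0 ≤ R := le_trans (by positivity) h
  by_contra! hlt
  have h1 : 1 ≤ |x| := by linarith
  have h2 : |x| ^ 1 ≤ |x| ^ 4 := pow_le_pow_right₀ h1 (by norm_num)
  have h3 : |x| ^ 4 = x ^ 4 := by rw [← abs_pow]; exact abs_of_nonneg (by positivity)
  rw [h3, pow_one] at h2
  linarith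

/-- Only finitely many elements of the modular group send a given positive form, up to rescaling, to
a form that is bounded below and whose value at `(0, 1)` is bounded above. -/
theorem finite_modularGroup_of_bounds {f : Fin 5 → ℝ} (hf : f ∈ posCone) {m : ℝ} (hm : 0 < m)
    (K : ℝ) :
    {g : SL(2, ℝ) | g ∈ modularGroup ∧ ∃ μ : ℝ, 0 < μ ∧ μ * quartic (rho g • f) ![0, 1] ≤ K ∧
      ∀ x y : ℝ, m * (x ^ 2 + y ^ 2) ^ 2 ≤ μ * quartic (rho g • f) ![x, y]}.Finite := by
  obtain ⟨ε, hε, hlow⟩ := exists_quartic_lower hf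
  have hf0 := coeff_zero_pos hf
  have hf4 := coeff_four_pos hf
  set R := K / ε * (f 0 + f 4) / m with hR
  refine (finite_modularGroup_bounded (1 + R)).subset ?_
  rintro g ⟨hg, μ, hμ, h1, h2⟩
  refine ⟨hg, ?_⟩
  -- The value of `rho g • f` at $(0,1)$ is that of `f` at a nonzero integral vector, hence at least
  -- `ε`. This is where integrality enters.
  have hμK : μ ≤ K / ε := by
    have hinv := modularGroup.inv_mem hg
    obtain ⟨a, ha⟩ := entry_of_mem_modularGroup hinv 0 1
    obtain ⟨b, hb⟩ := entry_of_mem_modularGroup hinv 1 1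
    rw [quartic_rho, sl2_smul_mk, ha, hb] at h1
    have hne : ¬ (a = 0 ∧ b = 0) := by
      rintro ⟨rfl, rfl⟩
      have := sl2_det g⁻¹
      rw [ha, hb] at this
      simp at this
    have h3 := one_le_sq_add_sq hne
    have h4 := hlow a b
    simp only [mul_zero, mul_one, zero_add] at h1
    rw [le_div_iff₀ hε]
    have h5 : ε ≤ ε * ((a : ℝ) ^ 2 + (b : ℝ) ^ 2) ^ 2 :=
      le_mul_of_one_le_right hε.le (one_le_pow₀ h3)
    exact le_trans (mul_le_mul_of_nonneg_left (h5.trans h4) hμ.le) h1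
  -- The lower bound, evaluated at the image of $(x,y)$ under `g`, bounds that image. The two basis
  -- vectors satisfy the hypothesis and give the columns of `g`.
  have key : ∀ x y : ℝ, quartic f ![x, y] ≤ f 0 + f 4 →
      ((g 0 0 * x + g 0 1 * y) ^ 2 + (g 1 0 * x + g 1 1 * y) ^ 2) ^ 2 ≤ R := by
    intro x y hxy
    have h3 := h2 (g 0 0 * x + g 0 1 * y) (g 1 0 * x + g 1 1 * y)
    rw [← sl2_smul_mk, quartic_rho, inv_smul_smul] at h3
    rw [hR, le_div_iff₀ hm, mul_comm]
    refine h3.trans (mul_le_mul hμK hxy ?_ (hμ.le.trans hμK))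
    exact mem_closure_posCone.1 (subset_closure hf) _
  have k1 := key 1 0 (by rw [quartic_mk]; norm_num; linarith)
  have k2 := key 0 1 (by rw [quartic_mk]; norm_num; linarith)
  simp only [mul_one, mul_zero, add_zero, zero_add] at k1 k2
  intro i j
  apply abs_le_of_pow_four_le
  fin_cases i <;> fin_cases j
  · change g 0 0 ^ 4 ≤ R
    nlinarith [mul_nonneg (sq_nonneg (g 0 0)) (sq_nonneg (g 1 0)), sq_nonneg (g 1 0 ^ 2)]
  · change g 0 1 ^ 4 ≤ R
    nlinarith [mul_nonneg (sq_nonneg (g 0 1)) (sq_nonneg (g 1 1)), sq_nonneg (g 1 1 ^ 2)]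
  · change g 1 0 ^ 4 ≤ R
    nlinarith [mul_nonneg (sq_nonneg (g 0 0)) (sq_nonneg (g 1 0)), sq_nonneg (g 0 0 ^ 2)]
  · change g 1 1 ^ 4 ≤ R
    nlinarith [mul_nonneg (sq_nonneg (g 0 1)) (sq_nonneg (g 1 1)), sq_nonneg (g 0 1 ^ 2)]

/-! ### The limit set -/

theorem exists_of_mem_orb {f : Fin 5 → ℝ} (hf : f ≠ 0) {y : Proj 5}
    (hy : y ∈ orb quarticGroup (Projectivization.mk ℝ f hf)) :
    ∃ g ∈ modularGroup, y = Projectivization.mk ℝ (rho g • f) (rho_smul_ne_zero g hf) := by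
  obtain ⟨_, ⟨g, hg, rfl⟩, rfl⟩ := hy
  exact ⟨g, hg, smul_mk_rho g hf⟩

/-- Near a positive definite form the bounds of `finite_modularGroup_of_bounds` hold uniformly, so
only finitely many orbit points come close. Orbits are thus closed inside the positive definite
forms. -/
theorem mem_orb_of_mem_closure {f F : Fin 5 → ℝ} (hf : f ∈ posCone) (hF : F ∈ posCone)
    (hf0 : f ≠ 0) (hF0 : F ≠ 0)
    (h : Projectivization.mk ℝ F hF0 ∈ closure (orb quarticGroup (Projectivization.mk ℝ f hf0))) :
    Projectivization.mk ℝ F hF0 ∈ orb quarticGroup (Projectivization.mk ℝ f hf0) := by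
  have hP := posCone_isSharpCone
  obtain ⟨m, hm, hmF⟩ := hP.exists_sub_smul_mem (S := {F}) (T := {normalForm (1 / 3)})
    isCompact_singleton isCompact_singleton (by simpa using hF)
  set T : Set (Proj 5) := (fun g : SL(2, ℝ) => rho g • Projectivization.mk ℝ f hf0) ''
    {g : SL(2, ℝ) | g ∈ modularGroup ∧ ∃ μ : ℝ, 0 < μ ∧
      μ * quartic (rho g • f) ![0, 1] ≤ F 4 + 1 ∧
      ∀ x y : ℝ, m * (x ^ 2 + y ^ 2) ^ 2 ≤ μ * quartic (rho g • f) ![x, y]} with hT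
  have hTfin : T.Finite := (finite_modularGroup_of_bounds hf hm _).image _
  have hU : {G : Fin 5 → ℝ | G - m • normalForm (1 / 3) ∈ posCone ∧ G 4 < F 4 + 1} ∈ 𝓝 F := by
    refine Filter.inter_mem ((isOpen_posCone.preimage (by fun_prop :
      Continuous fun G : Fin 5 → ℝ => G - m • normalForm (1 / 3))).mem_nhds (hmF F rfl _ rfl)) ?_
    exact (isOpen_lt (continuous_apply 4) continuous_const).mem_nhds (by simp)
  have hTcl : Projectivization.mk ℝ F hF0 ∈ closure T := by
    rw [mem_closure_proj_iff] at h ⊢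
    rw [mem_closure_iff_nhds] at h ⊢
    intro V hV
    obtain ⟨G, ⟨hGV, hG1, hG2⟩, hG0, hGo⟩ := h _ (Filter.inter_mem hV hU)
    refine ⟨G, hGV, hG0, ?_⟩
    have hGpos : G ∈ posCone := by
      have := hP.add_mem _ hG1 _ (hP.smul_mem m hm _ (midCone_subset_posCone normalForm_third_mem))
      simpa using this
    obtain ⟨g, hg, hGg⟩ := exists_of_mem_orb hf0 hGo
    obtain ⟨μ, hμ, hGμ⟩ := (mk_eq_mk_iff_pos _ _).1 hGg
    have hGμ' : G = μ • rho g • f := by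
      refine hGμ.resolve_right fun hneg => ?_
      have h1 := coeff_four_pos hGpos
      have h2 := coeff_four_pos (hP.smul_mem μ hμ _ (rho_smul_mem_posCone g hf))
      rw [hneg] at h1
      simp only [Pi.neg_apply] at h1
      linarith
    rw [hGg, ← smul_mk_rho g hf0]
    refine ⟨g, ⟨hg, μ, hμ, ?_, fun x y => ?_⟩, rfl⟩
    · rw [← quartic_smul, ← hGμ', quartic_mk]
      norm_num
      exact hG2.le
    · have := mem_closure_posCone.1 (subset_closure hG1) ![x, y]
      rw [quartic_sub, quartic_smul, quartic_normalForm_third] at this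
      rw [← quartic_smul, ← hGμ']
      linarith
  rw [hTfin.isClosed.closure_eq] at hTcl
  obtain ⟨g, ⟨hg, -⟩, hg2⟩ := hTcl
  exact ⟨rho g, rho_mem_quarticGroup hg, hg2⟩

theorem fourthPower_ne_zero {a b : ℝ} (h : a ≠ 0 ∨ b ≠ 0) : fourthPower a b ≠ 0 := by
  intro h0
  have h1 := congrFun h0 0
  have h2 := congrFun h0 4
  simp [fourthPower] at h1 h2
  tauto

theorem orb_subset {x : Proj 5} (hx : x ∈ projTrace midCone) :
    orb quarticGroup x ⊆ projTrace midCone := by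
  rintro _ ⟨γ, hγ, rfl⟩
  have h : (fun x => γ • x) '' projTrace midCone = projTrace midCone := quarticGroup_le_aut hγ
  rw [← h]
  exact ⟨x, hx, rfl⟩

/-- A limit point is not positive definite, by closedness of orbits there, and the only such
boundary points of `midCone` are fourth powers. -/
theorem exists_fourthPower_of_mem_limitSet {p : Proj 5}
    (hp : p ∈ limitSet (projTrace midCone) quarticGroup) :
    ∃ (a b : ℝ) (h : a ≠ 0 ∨ b ≠ 0),
      p = Projectivization.mk ℝ (fourthPower a b) (fourthPower_ne_zero h) := by
  have hN := midCone_isSharpCone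
  obtain ⟨x, hx, hp1, hp2⟩ := hp
  have hcl := closure_mono (orb_subset hx) hp1
  obtain ⟨f, hf, hf0, rfl⟩ := hx
  have main : ∀ F : Fin 5 → ℝ, ∀ hF0 : F ≠ 0, F ∈ closure midCone →
      p = Projectivization.mk ℝ F hF0 → ∃ (a b : ℝ) (h : a ≠ 0 ∨ b ≠ 0),
      p = Projectivization.mk ℝ (fourthPower a b) (fourthPower_ne_zero h) := by
    rintro F hF0 hF rfl
    have hnp : F ∉ posCone := fun h =>
      hp2 (mem_orb_of_mem_closure (midCone_subset_posCone hf) h hf0 hF0 hp1)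
    obtain ⟨g, l, hl, hg⟩ := exists_fourthPower hF hF0 hnp
    have hF' : F = l • fourthPower (g 1 0) (g 1 1) := by
      rw [← rho_inv_smul g F, hg, rho_smul, rho_inv_fourthPower]
      simp
    refine ⟨g 1 0, g 1 1, ?_, (Projectivization.mk_eq_mk_iff' _ _ _ _ _).2 ⟨l, hF'.symm⟩⟩
    by_contra! h0
    have := sl2_det g
    simp [h0.1, h0.2] at this
  induction p using Projectivization.ind with
  | h F hF0 =>
    rcases (hN.mk_mem_closure hF0).1 hcl with h | h
    · exact main F hF0 h rfl
    · exact main (-F) (neg_ne_zero.2 hF0) h (mk_neg' hF0).symm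

theorem fourthPower_notMem {a b : ℝ} (h : a ≠ 0 ∨ b ≠ 0) :
    Projectivization.mk ℝ (fourthPower a b) (fourthPower_ne_zero h) ∉ projTrace midCone := by
  have h0 : quartic (fourthPower a b) ![-b, a] = 0 := by rw [quartic_fourthPower]; ring
  have hne : (![-b, a] : Fin 2 → ℝ) ≠ 0 := by
    rw [vec2_ne_zero, neg_ne_zero]
    exact h.symm
  rw [midCone_isSharpCone.mk_mem]
  rintro (h1 | h1)
  · exact (midCone_subset_posCone h1 _ hne).ne' h0
  · have h2 := midCone_subset_posCone h1 _ hne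
    rw [← neg_one_smul ℝ, quartic_smul, h0] at h2
    simp at h2

theorem rho_smul_mem_closure_orb {x : Proj 5} {g : SL(2, ℝ)} (hg : g ∈ modularGroup)
    {v : Fin 5 → ℝ} (hv : v ∈ closure (coneOver (orb quarticGroup x))) :
    rho g • v ∈ closure (coneOver (orb quarticGroup x)) := by
  refine map_mem_closure (continuous_rho_smul g) hv ?_
  rintro u ⟨hu, γ, hγ, h⟩
  refine ⟨rho_smul_ne_zero g hu, rho g * γ, quarticGroup.mul_mem (rho_mem_quarticGroup hg) hγ, ?_⟩
  rw [mul_smul, h, smul_mk_rho]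

/-- The form `X⁴` is in the closure of the orbit of `(X² + Y²)²`. -/
theorem fourthPower_one_zero_mem_closure :
    fourthPower 1 0 ∈ closure (coneOver (orb quarticGroup (Projectivization.mk ℝ (normalForm (1 / 3))
      (midCone_isSharpCone.ne_zero normalForm_third_mem)))) := by
  -- The coefficients of $((X+tY)^2+t^2X^2)^2$. At $t=1/(n+1)$ this is $t^4$ times the image of
  -- $(X^2+Y^2)^2$ under the integral substitution $Y\mapsto (n+1)X+Y$.
  set F : ℝ → Fin 5 → ℝ := fun t => ![(1 + t ^ 2) ^ 2, 4 * t * (1 + t ^ 2),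
    4 * t ^ 2 + 2 * t ^ 2 * (1 + t ^ 2), 4 * t ^ 3, t ^ 4] with hF
  have hFc : Continuous F := by
    refine continuous_pi fun i => ?_
    fin_cases i <;> simp [hF] <;> fun_prop
  have hF0 : F 0 = fourthPower 1 0 := by simp [hF, fourthPower]
  have hlim : Filter.Tendsto (fun n : ℕ => F (1 / ((n : ℝ) + 1))) Filter.atTop (𝓝 (fourthPower 1 0)) := by
    rw [← hF0]
    exact (hFc.tendsto 0).comp tendsto_one_div_add_atTop_nhds_zero_nat
  refine mem_closure_of_tendsto hlim (Filter.Eventually.of_forall fun n => ?_)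
  have hn : (n : ℝ) + 1 ≠ 0 := by positivity
  have hdet : ((1 : ℤ) : ℝ) * (1 : ℤ) - (0 : ℤ) * ((n + 1 : ℤ) : ℝ) = 1 := by simp
  set g := sl2 _ _ _ _ hdet with hg
  have hgm : g ∈ modularGroup := sl2_mem_modularGroup hdet
  have heq : F (1 / ((n : ℝ) + 1)) = (1 / ((n : ℝ) + 1)) ^ 4 • rho g⁻¹ • normalForm (1 / 3) := by
    apply quartic_ext
    intro x y
    rw [quartic_smul, quartic_rho_inv, hg, sl2_smul, quartic_normalForm_third, quartic_mk]
    simp [hF]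
    field_simp
    ring
  rw [heq]
  refine coneOver_smul (by positivity) ?_
  exact ⟨rho_smul_ne_zero _ (midCone_isSharpCone.ne_zero normalForm_third_mem), rho g⁻¹,
    rho_mem_quarticGroup (modularGroup.inv_mem hgm), smul_mk_rho _ _⟩

/-- A primitive integral row is the first row of an element of the modular group. -/
theorem exists_modularGroup_row {p q : ℤ} (h : IsCoprime p q) :
    ∃ g ∈ modularGroup, g 0 0 = p ∧ g 0 1 = q := by
  obtain ⟨u, v, huv⟩ := h
  have hdet : (p : ℝ) * u - q * ((-v : ℤ) : ℝ) = 1 := by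
    have : ((u * p + v * q : ℤ) : ℝ) = 1 := by rw [huv]; simp
    push_cast at this ⊢
    linarith
  exact ⟨sl2 _ _ _ _ hdet, sl2_mem_modularGroup hdet, rfl, rfl⟩

theorem fourthPower_smul (c a b : ℝ) : fourthPower (c * a) (c * b) = c ^ 4 • fourthPower a b := by
  ext i
  fin_cases i <;> simp [fourthPower] <;> ring

theorem exists_modularGroup_rat (r : ℚ) : ∃ g ∈ modularGroup,
    fourthPower r 1 = (1 / (r.den : ℝ)) ^ 4 • rho g • fourthPower 1 0 := by
  have hc : IsCoprime r.num (r.den : ℤ) := by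
    rw [Int.isCoprime_iff_gcd_eq_one]
    exact r.reduced
  obtain ⟨g, hg, h1, h2⟩ := exists_modularGroup_row hc
  refine ⟨g⁻¹, modularGroup.inv_mem hg, ?_⟩
  have hd : (r.den : ℝ) ≠ 0 := by exact_mod_cast r.den_nz
  rw [rho_inv_fourthPower, h1, h2, ← fourthPower_smul]
  have : (r : ℝ) = r.num / r.den := by exact_mod_cast (Rat.num_div_den r).symm
  rw [this]
  congr 1
  · field_simp
    ring
  · simp only [Int.cast_natCast]
    field_simp
    ring

/-- The modular group moves $X^4$ to all rational points of the curve, up to scaling, and these are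
dense. -/
theorem fourthPower_mem_closure {a b : ℝ} (h : a ≠ 0 ∨ b ≠ 0) :
    fourthPower a b ∈ closure (coneOver (orb quarticGroup (Projectivization.mk ℝ (normalForm (1 / 3))
      (midCone_isSharpCone.ne_zero normalForm_third_mem)))) := by
  set S := coneOver (orb quarticGroup (Projectivization.mk ℝ (normalForm (1 / 3))
      (midCone_isSharpCone.ne_zero normalForm_third_mem))) with hS
  have hsmul : ∀ {c : ℝ}, c ≠ 0 → ∀ {v}, v ∈ closure S → c • v ∈ closure S := fun {c} hc {v} hv =>
    map_mem_closure (continuous_const_smul c) hv fun u hu => coneOver_smul hc hu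
  have hone := fourthPower_one_zero_mem_closure
  have hrat : ∀ r : ℚ, fourthPower r 1 ∈ closure S := by
    intro r
    obtain ⟨g, hg, h⟩ := exists_modularGroup_rat r
    rw [h]
    have hd : (r.den : ℝ) ≠ 0 := by exact_mod_cast r.den_nz
    exact hsmul (by positivity) (rho_smul_mem_closure_orb hg hone)
  have hreal : ∀ t : ℝ, fourthPower t 1 ∈ closure S := by
    have hc : Continuous fun t : ℝ => fourthPower t 1 := by
      refine continuous_pi fun i => ?_
      fin_cases i <;> simp [fourthPower] <;> fun_prop
    intro t
    have : t ∈ closure (Set.range ((↑) : ℚ → ℝ)) := Rat.denseRange_cast t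
    refine (isClosed_closure.closure_subset) (map_mem_closure (f := fun t : ℝ => fourthPower t 1) hc this ?_)
    rintro _ ⟨r, rfl⟩
    exact hrat r
  by_cases hb : b = 0
  · subst hb
    have ha : a ≠ 0 := by simpa using h
    have := hsmul (pow_ne_zero 4 ha) hone
    rwa [← fourthPower_smul, mul_one, mul_zero] at this
  · have := hsmul (pow_ne_zero 4 hb) (hreal (a / b))
    rwa [← fourthPower_smul, mul_one, mul_div_cancel₀ _ hb] at this

theorem fourthPower_mem_limitSet {a b : ℝ} (h : a ≠ 0 ∨ b ≠ 0) :
    Projectivization.mk ℝ (fourthPower a b) (fourthPower_ne_zero h) ∈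
      limitSet (projTrace midCone) quarticGroup := by
  have hx : Projectivization.mk ℝ (normalForm (1 / 3))
      (midCone_isSharpCone.ne_zero normalForm_third_mem) ∈ projTrace midCone :=
    ⟨_, normalForm_third_mem, _, rfl⟩
  exact ⟨_, hx, (mem_closure_proj_iff _).2 (fourthPower_mem_closure h),
    fun h' => fourthPower_notMem h (orb_subset hx h')⟩

end HilbertGeom

namespace HilbertGeom

/-! ### Bounded parabolic points -/

/-- The point `[X⁴]`. -/
noncomputable def cusp : Proj 5 :=
  Projectivization.mk ℝ (fourthPower 1 0) (fourthPower_ne_zero (Or.inl one_ne_zero))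

theorem exists_rho_mk_fourthPower (g : SL(2, ℝ)) {a b : ℝ} (h : a ≠ 0 ∨ b ≠ 0) :
    ∃ (a' b' : ℝ) (h' : a' ≠ 0 ∨ b' ≠ 0),
      rho g • Projectivization.mk ℝ (fourthPower a b) (fourthPower_ne_zero h) =
        Projectivization.mk ℝ (fourthPower a' b') (fourthPower_ne_zero h') := by
  have h1 := rho_inv_fourthPower g⁻¹ a b
  rw [inv_inv] at h1
  have h2 := rho_smul_ne_zero g (fourthPower_ne_zero h)
  rw [h1] at h2
  refine ⟨a * g⁻¹ 0 0 + b * g⁻¹ 1 0, a * g⁻¹ 0 1 + b * g⁻¹ 1 1, ?_, ?_⟩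
  rotate_left
  · rw [smul_mk_rho]
    congr 1
  · by_contra! h0
    rw [h0.1, h0.2] at h2
    apply h2
    ext i
    fin_cases i <;> simp [fourthPower]

theorem mk_fourthPower_ne_cusp (t : ℝ) :
    Projectivization.mk ℝ (fourthPower t 1) (fourthPower_ne_zero (Or.inr one_ne_zero)) ≠ cusp := by
  intro h
  obtain ⟨c, hc⟩ := (Projectivization.mk_eq_mk_iff' _ _ _ _ _).1 h
  have := congrFun hc 4
  simp [fourthPower] at this

theorem eq_cusp_or {a b : ℝ} (h : a ≠ 0 ∨ b ≠ 0) :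
    Projectivization.mk ℝ (fourthPower a b) (fourthPower_ne_zero h) = cusp ∨
    ∃ t : ℝ, Projectivization.mk ℝ (fourthPower a b) (fourthPower_ne_zero h) =
      Projectivization.mk ℝ (fourthPower t 1) (fourthPower_ne_zero (Or.inr one_ne_zero)) := by
  by_cases hb : b = 0
  · subst hb
    refine Or.inl ((Projectivization.mk_eq_mk_iff' _ _ _ _ _).2 ⟨a ^ 4, ?_⟩)
    rw [← fourthPower_smul, mul_one, mul_zero]
  · refine Or.inr ⟨a / b, (Projectivization.mk_eq_mk_iff' _ _ _ _ _).2 ⟨b ^ 4, ?_⟩⟩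
    rw [← fourthPower_smul, mul_one, mul_div_cancel₀ _ hb]

theorem continuous_fourthPower : Continuous fun t : ℝ => fourthPower t 1 := by
  refine continuous_pi fun i => ?_
  fin_cases i <;> simp [fourthPower] <;> fun_prop

theorem isBoundedParabolic_smul_cusp {g : SL(2, ℝ)} (hg : g ∈ modularGroup) :
    IsBoundedParabolic (projTrace midCone) quarticGroup (rho g • cusp) := by
  have h1 : ∀ t : ℝ, t ≠ 0 ∨ (1 : ℝ) ≠ 0 := fun t => Or.inr one_ne_zero
  refine ⟨(fun t : ℝ => rho g • Projectivization.mk ℝ (fourthPower t 1)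
    (fourthPower_ne_zero (h1 t))) '' Set.Icc 0 1, ?_, ?_, ?_⟩
  · rintro _ ⟨t, -, rfl⟩
    refine ⟨?_, fun h => mk_fourthPower_ne_cusp t (smul_left_cancel _ h)⟩
    obtain ⟨a', b', h', he⟩ := exists_rho_mk_fourthPower g (h1 t)
    simp only [he]
    exact fourthPower_mem_limitSet h'
  · refine isCompact_Icc.image ?_
    simp only [smul_mk_rho]
    exact continuous_proj_mk.comp (Continuous.subtype_mk
      ((continuous_rho_smul g).comp continuous_fourthPower)
      fun t => rho_smul_ne_zero g (fourthPower_ne_zero (h1 t)))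
  · rintro y ⟨hy, hne⟩
    obtain ⟨a, b, hab, rfl⟩ := exists_fourthPower_of_mem_limitSet hy
    obtain ⟨a', b', hab', he⟩ := exists_rho_mk_fourthPower g⁻¹ hab
    have hy' : Projectivization.mk ℝ (fourthPower a b) (fourthPower_ne_zero hab) =
        rho g • Projectivization.mk ℝ (fourthPower a' b') (fourthPower_ne_zero hab') := by
      rw [← he, map_inv, smul_inv_smul]
    rcases eq_cusp_or hab' with h | ⟨t, ht⟩
    · rw [h] at hy'
      exact absurd hy' hne
    rw [ht] at hy'
    -- The curve minus the cusp is a line with coordinate `t`, on which the stabilizer contains the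
    -- integral translations; subtracting the integer part leads into $[0,1]$.
    have hdet : ((1 : ℤ) : ℝ) * (1 : ℤ) - (0 : ℤ) * ((-⌊t⌋ : ℤ) : ℝ) = 1 := by simp
    set τ := sl2 _ _ _ _ hdet with hτ
    have hτm : τ ∈ modularGroup := sl2_mem_modularGroup hdet
    have hτ' : ∀ a b : ℝ, rho τ⁻¹ • fourthPower a b = fourthPower (a - b * ⌊t⌋) b := by
      intro a b
      rw [rho_inv_fourthPower]
      have e : τ 0 0 = 1 ∧ τ 0 1 = 0 ∧ τ 1 0 = -⌊t⌋ ∧ τ 1 1 = 1 := by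
        refine ⟨?_, ?_, ?_, ?_⟩ <;> simp [hτ, sl2]
      rw [e.1, e.2.1, e.2.2.1, e.2.2.2]
      congr 1 <;> ring
    refine ⟨rho g * rho τ⁻¹ * (rho g)⁻¹, quarticGroup.mul_mem (quarticGroup.mul_mem
      (rho_mem_quarticGroup hg) (rho_mem_quarticGroup (modularGroup.inv_mem hτm)))
      (quarticGroup.inv_mem (rho_mem_quarticGroup hg)), ?_, ?_⟩
    · rw [mul_smul, inv_smul_smul, mul_smul]
      congr 1
      rw [cusp, smul_mk_rho]
      congr 1
      rw [hτ']
      simp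
    · rw [hy', mul_smul, inv_smul_smul, mul_smul]
      refine ⟨Int.fract t, ⟨Int.fract_nonneg t, (Int.fract_lt_one t).le⟩, ?_⟩
      change rho g • _ = rho g • _
      congr 1
      rw [smul_mk_rho]
      congr 1
      rw [hτ', one_mul]
      rfl

/-! ### Conical points -/

theorem exists_int_bezout {p q : ℤ} (hq : 0 < q) (h : IsCoprime p q) :
    ∃ p' q' : ℤ, p * q' - q * p' = 1 ∧ 0 ≤ q' ∧ q' < q := by
  obtain ⟨u, v, huv⟩ := h
  refine ⟨-v - p * (u / q), u % q, ?_, Int.emod_nonneg _ hq.ne', Int.emod_lt_of_pos _ hq⟩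
  have := Int.emod_add_mul_ediv u q
  have hu : u % q = u - q * (u / q) := by linarith
  rw [hu]
  linear_combination huv

/-- Dirichlet's theorem gives infinitely many such approximations, whereas those of denominator at
most `n` have bounded numerators and are finite in number. -/
theorem exists_rat_approx {ξ : ℝ} (hξ : Irrational ξ) (n : ℕ) :
    ∃ r : ℚ, n < r.den ∧ |ξ - r| < 1 / (r.den : ℝ) ^ 2 := by
  by_contra! hcon
  have hinf := Real.infinite_rat_abs_sub_lt_one_div_den_sq_of_irrational hξ
  apply hinf
  set M : ℤ := ⌈(|ξ| + 1) * n⌉ with hM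
  refine ((((Set.finite_Icc (-M) M).prod (Set.finite_Icc 0 n)).image
    fun p : ℤ × ℕ => (p.1 : ℚ) / (p.2 : ℚ))).subset ?_
  intro r hr
  have hr' : |ξ - r| < 1 / (r.den : ℝ) ^ 2 := hr
  have hden : r.den ≤ n := by
    by_contra! h
    exact absurd hr' (not_lt.2 (hcon r h))
  have hd1 : (1 : ℝ) ≤ r.den := by exact_mod_cast r.den_pos
  have hdn : (r.den : ℝ) ≤ n := by exact_mod_cast hden
  have hlt1 : |ξ - r| < 1 := hr'.trans_le (by
    rw [div_le_one (by positivity)]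
    exact one_le_pow₀ hd1)
  have habs : |(r : ℝ)| ≤ |ξ| + 1 := by
    have := abs_sub_abs_le_abs_sub (r : ℝ) ξ
    rw [abs_sub_comm] at this
    linarith
  have hnum : (r.num : ℝ) = r * r.den := by exact_mod_cast (Rat.mul_den_eq_num r).symm
  have hle : |(r.num : ℝ)| ≤ (|ξ| + 1) * n := by
    rw [hnum, abs_mul, abs_of_nonneg (by positivity : (0 : ℝ) ≤ r.den)]
    exact mul_le_mul habs hdn (by positivity) (by positivity)
  have hle' : |(r.num : ℝ)| ≤ (M : ℝ) := hle.trans (Int.le_ceil _)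
  have hle'' : |r.num| ≤ M := by exact_mod_cast hle'
  exact ⟨(r.num, r.den), ⟨abs_le.1 hle'', Nat.zero_le _, hden⟩, Rat.num_div_den r⟩

theorem continuous_rho_inv : Continuous fun g : SL(2, ℝ) => rho g⁻¹ • normalForm (1 / 3) := by
  have h1 := continuous_sl2_entry 0 0
  have h2 := continuous_sl2_entry 0 1
  have h3 := continuous_sl2_entry 1 0
  have h4 := continuous_sl2_entry 1 1
  simp only [rho_inv_coeff]
  refine continuous_pi fun i => ?_
  fin_cases i <;>
    simp [substMatrix, Matrix.mulVec, dotProduct, Fin.sum_univ_five, normalForm] <;> fun_prop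

/-- The two compact families of forms that are compared along a geodesic ray to an irrational point
are at bounded distance. -/
theorem exists_compare : ∃ m : ℝ, 0 < m ∧ ∀ h : SL(2, ℝ), (∀ i j, |h i j| ≤ 2) →
    ∀ c ∈ Set.Icc (0 : ℝ) (1 / 3),
      rho h⁻¹ • normalForm (1 / 3) - m • normalForm c ∈ midCone ∧
      normalForm c - m • rho h⁻¹ • normalForm (1 / 3) ∈ midCone := by
  have hS1 := (isCompact_sl2_bounded 2).image continuous_rho_inv
  have hc : Continuous normalForm := by
    refine continuous_pi fun i => ?_
    fin_cases i <;> simp [normalForm] <;> fun_prop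
  have hS2 := (isCompact_Icc (a := (0 : ℝ)) (b := 1 / 3)).image hc
  have hm1 : (fun g : SL(2, ℝ) => rho g⁻¹ • normalForm (1 / 3)) '' {g | ∀ i j, |g i j| ≤ 2} ⊆
      midCone := by
    rintro _ ⟨g, -, rfl⟩
    exact rho_smul_mem_midCone _ normalForm_third_mem
  have hm2 : normalForm '' Set.Icc (0 : ℝ) (1 / 3) ⊆ midCone := by
    rintro _ ⟨c, hc, rfl⟩
    exact (normalForm_mem_midCone_iff hc.2).2 (by linarith [hc.1])
  obtain ⟨m1, hm1p, h1⟩ := midCone_isSharpCone.exists_sub_smul_mem hS1 hS2 hm1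
  obtain ⟨m2, hm2p, h2⟩ := midCone_isSharpCone.exists_sub_smul_mem hS2 hS1 hm2
  have hN := midCone_isSharpCone
  refine ⟨min m1 m2, lt_min hm1p hm2p, fun h hh c hc => ⟨?_, ?_⟩⟩
  · have k1 := h1 _ ⟨h, hh, rfl⟩ _ ⟨c, hc, rfl⟩
    have k2 := hN.closure_smul' (sub_nonneg.2 (min_le_left m1 m2)) (subset_closure (hm2 ⟨c, hc, rfl⟩))
    have := hN.add_closure k1 k2
    rw [sub_smul] at this
    convert this using 1
    abel
  · have k1 := h2 _ ⟨c, hc, rfl⟩ _ ⟨h, hh, rfl⟩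
    have k2 := hN.closure_smul' (sub_nonneg.2 (min_le_right m1 m2))
      (subset_closure (hm1 ⟨h, hh, rfl⟩))
    have := hN.add_closure k1 k2
    rw [sub_smul] at this
    convert this using 1
    abel

/-- A point of the ray from `[u]` to the boundary point `[w]`. -/
theorem IsSharpCone.mk_add_smul_mem_seg {N : Set (Fin 5 → ℝ)} {f : Module.Dual ℝ (Fin 5 → ℝ)}
    (hN : IsSharpCone N f) {u w : Fin 5 → ℝ} (hu : u ∈ N) (hw : w ∈ closure N) (hw0 : w ≠ 0)
    {s : ℝ} (hs : 0 ≤ s) (h : u + s • w ≠ 0) :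
    Projectivization.mk ℝ (u + s • w) h ∈
      seg (projTrace N) (Projectivization.mk ℝ u (hN.ne_zero hu)) (Projectivization.mk ℝ w hw0) := by
  have h1 := hN.pos u (subset_closure hu) (hN.ne_zero hu)
  have h2 := hN.pos w hw hw0
  have h3 : 0 < f u + s * f w := by positivity
  refine ⟨f, hN.chart_subset, ?_, ?_⟩
  · rw [mk_mem_chart, map_add, map_smul, smul_eq_mul]
    exact h3.ne'
  · rw [coord_mk, coord_mk, coord_mk, map_add, map_smul, smul_eq_mul]
    refine ⟨f u / (f u + s * f w), s * f w / (f u + s * f w), by positivity, by positivity, ?_, ?_⟩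
    · field_simp
    · rw [smul_smul, smul_smul, smul_add, smul_smul]
      congr 2 <;> field_simp

theorem fourthPower_mem_closure_midCone {a b : ℝ} (h : a ≠ 0 ∨ b ≠ 0) :
    fourthPower a b ∈ closure midCone := by
  obtain ⟨x, hx, h1, -⟩ := fourthPower_mem_limitSet h
  refine ((midCone_isSharpCone.mk_mem_closure _).1 (closure_mono (orb_subset hx) h1)).resolve_right
    fun hneg => ?_
  have h2 := quartic_nonneg_of_mem_closure (closure_mono midCone_subset_posCone hneg) ![a, b]
  rw [← neg_one_smul ℝ, quartic_smul, quartic_fourthPower] at h2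
  have h3 : 0 < (a * a + b * b) ^ 4 := by
    have : 0 < a * a + b * b := by
      rcases h with h | h
      · nlinarith [mul_self_pos.2 h, mul_self_nonneg b]
      · nlinarith [mul_self_pos.2 h, mul_self_nonneg a]
    positivity
  linarith

/-! ### Integral approximants and rays to irrational points -/

/-- The unipotent substitution `(X, Y) ↦ (X - ξ Y, Y)`. -/
def shear (ξ : ℝ) : SL(2, ℝ) := sl2 1 (-ξ) 0 1 (by ring)

/-- The rows of `g`, in the coordinates `(X - ξ Y, Y)`, are `(q, ε)` and `(q', η)`, with the bounds
satisfied when the first row of `g` is given by a good rational approximation of `ξ`. -/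
structure IsApproximant (ξ : ℝ) (g : SL(2, ℝ)) (q q' ε η : ℝ) : Prop where
  one_le : 1 ≤ q
  nonneg : 0 ≤ q'
  le : q' ≤ q
  abs_le_one_div : |ε| ≤ 1 / q
  abs_le_two_div : |η| ≤ 2 / q
  det : q * η - ε * q' = 1
  smul : ∀ x y : ℝ, g • ![x, y] = ![q * (x - ξ * y) + ε * y, q' * (x - ξ * y) + η * y]

/-- The rows of the matrix are $(q,-p)$ and $(q',-p')$, with $p/q$ a good approximation of `ξ` and
$p',q'$ its Bézout companions reduced modulo $q$. Then `ε` is $\xi q-p$ and `η` is $\xi q'-p'$. -/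
theorem exists_isApproximant {ξ : ℝ} (hξ : Irrational ξ) (n : ℕ) :
    ∃ g ∈ modularGroup, ∃ q q' ε η : ℝ, (n : ℝ) < q ∧ IsApproximant ξ g q q' ε η := by
  obtain ⟨r, hrn, hr⟩ := exists_rat_approx hξ n
  have hqpos : (0 : ℤ) < r.den := by exact_mod_cast r.den_pos
  have hc : IsCoprime r.num (r.den : ℤ) := by
    rw [Int.isCoprime_iff_gcd_eq_one]
    exact r.reduced
  obtain ⟨p', q', hpq, hq0, hq1⟩ := exists_int_bezout hqpos hc
  have hpq' : (r.num : ℝ) * q' - r.den * p' = 1 := by exact_mod_cast hpq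
  have hdet : (((r.den : ℤ) : ℝ)) * ((-p' : ℤ) : ℝ) - ((-r.num : ℤ) : ℝ) * q' = 1 := by
    push_cast
    linarith
  have hq : (0 : ℝ) < r.den := by exact_mod_cast r.den_pos
  have hq0' : (0 : ℝ) ≤ q' := by exact_mod_cast hq0
  have hq1' : (q' : ℝ) ≤ r.den := by exact_mod_cast hq1.le
  have hnum : (r.num : ℝ) = r * r.den := by exact_mod_cast (Rat.mul_den_eq_num r).symm
  have hε : |ξ * r.den - r.num| ≤ 1 / r.den := by
    rw [hnum, ← sub_mul, abs_mul, abs_of_pos hq, le_div_iff₀ hq]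
    rw [lt_div_iff₀ (by positivity)] at hr
    nlinarith
  have hdet2 : (r.den : ℝ) * (ξ * q' - p') - (ξ * r.den - r.num) * q' = 1 := by
    linear_combination hpq'
  have hη : |ξ * q' - p'| ≤ 2 / r.den := by
    have h1 : ξ * q' - p' = (1 + (ξ * r.den - r.num) * q') / r.den := by
      rw [eq_div_iff hq.ne']
      linarith
    rw [h1, abs_div, abs_of_pos hq]
    gcongr
    have h2 : |(ξ * r.den - r.num) * q'| ≤ 1 := by
      rw [abs_mul, abs_of_nonneg hq0']
      calc |ξ * r.den - r.num| * q' ≤ 1 / r.den * r.den := by gcongr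
        _ = 1 := by field_simp
    calc |1 + (ξ * r.den - r.num) * q'| ≤ |1| + |(ξ * r.den - r.num) * q'| := abs_add_le _ _
      _ ≤ 2 := by rw [abs_one]; linarith
  refine ⟨sl2 _ _ _ _ hdet, sl2_mem_modularGroup hdet, r.den, q', ξ * r.den - r.num, ξ * q' - p',
    by exact_mod_cast hrn, by exact_mod_cast r.den_pos, hq0', hq1', hε, hη, hdet2, fun x y => ?_⟩
  rw [sl2_smul]
  push_cast
  congr 1
  · ring
  · congr 1
    ring

theorem fourthPower_eq_shear (ξ : ℝ) :
    fourthPower 1 (-ξ) = rho (shear ξ)⁻¹ • fourthPower 1 0 := by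
  rw [rho_inv_fourthPower]
  simp [shear, sl2]

/-- The form `(X² + 2 β X Y + α Y²)²`. -/
def squareForm (β α : ℝ) : Fin 5 → ℝ :=
  ![1, 4 * β, 4 * β ^ 2 + 2 * α, 4 * α * β, α ^ 2]

theorem quartic_squareForm (β α x y : ℝ) :
    quartic (squareForm β α) ![x, y] = (x ^ 2 + 2 * β * x * y + α * y ^ 2) ^ 2 := by
  rw [quartic_mk]
  simp [squareForm]
  ring

theorem IsApproximant.exists_squareForm {ξ : ℝ} {g : SL(2, ℝ)} {q q' ε η : ℝ}
    (h : IsApproximant ξ g q q' ε η) : ∃ β α : ℝ, ‖β‖ ≤ 3 * q⁻¹ ^ 2 ∧ ‖α‖ ≤ 5 * q⁻¹ ^ 4 ∧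
      ∃ c : ℝ, c • rho (shear ξ)⁻¹ • squareForm β α = rho g⁻¹ • normalForm (1 / 3) := by
  have hq : 0 < q := one_pos.trans_le h.one_le
  have hpos : 0 < q ^ 2 + q' ^ 2 := by positivity
  have hε := h.abs_le_one_div
  have hη := h.abs_le_two_div
  -- In the sheared coordinates the quadratic form is $(qX+\varepsilon Y)^2+(q'X+\eta Y)^2$; its
  -- leading coefficient is factored out.
  refine ⟨(q * ε + q' * η) / (q ^ 2 + q' ^ 2), (ε ^ 2 + η ^ 2) / (q ^ 2 + q' ^ 2), ?_, ?_,
    (q ^ 2 + q' ^ 2) ^ 2, ?_⟩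
  · have h1 : |q * ε + q' * η| ≤ 3 := by
      calc |q * ε + q' * η| ≤ |q * ε| + |q' * η| := abs_add_le _ _
        _ = q * |ε| + q' * |η| := by
          rw [abs_mul, abs_mul, abs_of_pos hq, abs_of_nonneg h.nonneg]
        _ ≤ q * (1 / q) + q * (2 / q) := by
          gcongr
          exact h.le
        _ = 3 := by field_simp; norm_num
    rw [Real.norm_eq_abs, abs_div, abs_of_pos hpos]
    calc |q * ε + q' * η| / (q ^ 2 + q' ^ 2) ≤ 3 / (q ^ 2) := by
          gcongr
          exact le_add_of_nonneg_right (sq_nonneg _)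
      _ = 3 * q⁻¹ ^ 2 := by field_simp
  · have h1 : ε ^ 2 ≤ (1 / q) ^ 2 := by
      rw [← sq_abs ε]
      gcongr
    have h2 : η ^ 2 ≤ (2 / q) ^ 2 := by
      rw [← sq_abs η]
      gcongr
    rw [Real.norm_eq_abs, abs_of_nonneg (by positivity)]
    calc (ε ^ 2 + η ^ 2) / (q ^ 2 + q' ^ 2) ≤ ((1 / q) ^ 2 + (2 / q) ^ 2) / q ^ 2 := by
          gcongr
          exact le_add_of_nonneg_right (sq_nonneg _)
      _ = 5 * q⁻¹ ^ 4 := by field_simp; norm_num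
  · apply quartic_ext
    intro x y
    rw [quartic_smul, quartic_rho_inv, quartic_rho_inv, h.smul, shear, sl2_smul,
      quartic_normalForm_third, quartic_squareForm]
    field_simp
    ring

/-- In sheared coordinates and up to scaling, the orbit points are squares of quadratic forms
tending to $X^2$ as $q\to\infty$. -/
theorem tendsto_of_isApproximant {ξ : ℝ} {g : ℕ → SL(2, ℝ)} {q q' ε η : ℕ → ℝ}
    (hnq : ∀ n : ℕ, (n : ℝ) < q n) (h : ∀ n, IsApproximant ξ (g n) (q n) (q' n) (ε n) (η n)) :
    Filter.Tendsto (fun n => rho (g n)⁻¹ • Projectivization.mk ℝ (normalForm (1 / 3))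
      (midCone_isSharpCone.ne_zero normalForm_third_mem)) Filter.atTop
      (𝓝 (Projectivization.mk ℝ (fourthPower 1 (-ξ))
        (fourthPower_ne_zero (Or.inl one_ne_zero)))) := by
  choose β α hβ hα c hc using fun n => (h n).exists_squareForm
  have hqt : Filter.Tendsto (fun n => (q n)⁻¹) Filter.atTop (𝓝 0) :=
    Filter.Tendsto.inv_tendsto_atTop
      (Filter.tendsto_atTop_mono (fun n => (hnq n).le) tendsto_natCast_atTop_atTop)
  have hβt : Filter.Tendsto β Filter.atTop (𝓝 0) :=
    squeeze_zero_norm hβ (by simpa using (hqt.pow 2).const_mul 3)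
  have hαt : Filter.Tendsto α Filter.atTop (𝓝 0) :=
    squeeze_zero_norm hα (by simpa using (hqt.pow 4).const_mul 5)
  have hGc : Continuous fun p : ℝ × ℝ => squareForm p.1 p.2 := by
    refine continuous_pi fun i => ?_
    fin_cases i <;> simp [squareForm] <;> fun_prop
  have hG0 : squareForm 0 0 = fourthPower 1 0 := by simp [squareForm, fourthPower]
  have hGne : ∀ β α, squareForm β α ≠ 0 := fun β α h0 => by
    have := congrFun h0 0
    simp [squareForm] at this
  have hlim : Filter.Tendsto (fun n => rho (shear ξ)⁻¹ • squareForm (β n) (α n)) Filter.atTop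
      (𝓝 (fourthPower 1 (-ξ))) := by
    rw [fourthPower_eq_shear, ← hG0]
    have h1 : Filter.Tendsto (fun n => squareForm (β n) (α n)) Filter.atTop
        (𝓝 (squareForm 0 0)) := (hGc.tendsto ((0 : ℝ), (0 : ℝ))).comp (hβt.prodMk_nhds hαt)
    exact ((continuous_rho_smul (shear ξ)⁻¹).tendsto (squareForm 0 0)).comp h1
  refine (tendsto_proj_mk (fun n => rho_smul_ne_zero _ (hGne _ _))
    (fourthPower_ne_zero (Or.inl one_ne_zero)) hlim).congr fun n => ?_
  rw [smul_mk_rho]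
  refine ((Projectivization.mk_eq_mk_iff' _ _ _ _ _).2 ⟨c n, hc n⟩).symm

theorem shear_form_mem (ξ : ℝ) : rho (shear ξ)⁻¹ • normalForm (1 / 3) ∈ midCone :=
  rho_smul_mem_midCone _ normalForm_third_mem

/-- The rescaling $(X,Y)\mapsto(qX,q^{-1}Y)$ brings both the orbit point and the point of the ray
into compact families of forms in `midCone`, where the distance is uniformly bounded. -/
theorem hilbertDist_le_of_isApproximant {m : ℝ} (hm : 0 < m)
    (hcomp : ∀ h : SL(2, ℝ), (∀ i j, |h i j| ≤ 2) → ∀ c ∈ Set.Icc (0 : ℝ) (1 / 3),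
      rho h⁻¹ • normalForm (1 / 3) - m • normalForm c ∈ midCone ∧
      normalForm c - m • rho h⁻¹ • normalForm (1 / 3) ∈ midCone)
    {ξ : ℝ} {g : SL(2, ℝ)} {q q' ε η : ℝ} (hg : IsApproximant ξ g q q' ε η)
    (hy : rho (shear ξ)⁻¹ • normalForm (1 / 3) + (q ^ 8 - 1) • fourthPower 1 (-ξ) ∈ midCone) :
    hilbertDist (projTrace midCone) (rho g⁻¹ • Projectivization.mk ℝ (normalForm (1 / 3))
      (midCone_isSharpCone.ne_zero normalForm_third_mem))
      (Projectivization.mk ℝ _ (midCone_isSharpCone.ne_zero hy)) ≤ -(1 / 2) * Real.log (m * m) := by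
  have hN := midCone_isSharpCone
  have ho := normalForm_third_mem
  have hqn : 0 < q := one_pos.trans_le hg.one_le
  have hD2det : q * q⁻¹ - -(q * ξ) * 0 = 1 := by field_simp; ring
  have hhdet : 1 * (η * q) - ε * q * (q' / q) = 1 := by
    field_simp
    linarith [hg.det]
  -- Shear followed by rescaling: `g` factors as `h * E`, and the approximation bounds say exactly
  -- that the entries of `h` stay bounded.
  set E := sl2 _ _ _ _ hD2det with hE
  set h := sl2 _ _ _ _ hhdet with hh
  set c := q⁻¹ ^ 4 / 3 with hc
  have hcmem : c ∈ Set.Icc (0 : ℝ) (1 / 3) := by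
    refine ⟨by positivity, ?_⟩
    have : q⁻¹ ^ 4 ≤ 1 := pow_le_one₀ (by positivity) (inv_le_one_of_one_le₀ hg.one_le)
    rw [hc]
    linarith
  have hhb : ∀ i j, |h i j| ≤ 2 := by
    intro i j
    fin_cases i <;> fin_cases j
    · change |(1 : ℝ)| ≤ 2
      norm_num
    · change |ε * q| ≤ 2
      rw [abs_mul, abs_of_pos hqn]
      have := hg.abs_le_one_div
      rw [le_div_iff₀ hqn] at this
      linarith
    · change |q' / q| ≤ 2
      rw [abs_of_nonneg (div_nonneg hg.nonneg hqn.le), div_le_iff₀ hqn]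
      linarith [hg.le]
    · change |η * q| ≤ 2
      rw [abs_mul, abs_of_pos hqn]
      have := hg.abs_le_two_div
      rwa [le_div_iff₀ hqn] at this
  obtain ⟨hc1, hc2⟩ := hcomp h hhb c hcmem
  have hnf : normalForm c ∈ midCone :=
    (normalForm_mem_midCone_iff hcmem.2).2 (by linarith [hcmem.1])
  have hU : rho E⁻¹ • rho h⁻¹ • normalForm (1 / 3) ∈ midCone :=
    rho_smul_mem_midCone _ (rho_smul_mem_midCone _ ho)
  have hV : rho E⁻¹ • normalForm c ∈ midCone := rho_smul_mem_midCone _ hnf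
  have hUe : rho g⁻¹ • normalForm (1 / 3) = rho E⁻¹ • rho h⁻¹ • normalForm (1 / 3) := by
    apply quartic_ext
    intro x y
    rw [quartic_rho_inv, quartic_rho_inv, quartic_rho_inv, hg.smul, hE, hh, sl2_smul, sl2_smul]
    congr 1
    field_simp
    congr 1
    · ring
    · congr 1
      ring
  -- The coefficient $q^8-1$ makes the point of the ray equal to $q^8X^4+2X^2Y^2+Y^4$ in sheared
  -- coordinates, that is, $q^4$ times the normal form with $6c=2q^{-4}$ after rescaling.
  have hVe : rho (shear ξ)⁻¹ • normalForm (1 / 3) + (q ^ 8 - 1) • fourthPower 1 (-ξ) =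
      q ^ 4 • rho E⁻¹ • normalForm c := by
    apply quartic_ext
    intro x y
    rw [quartic_add, quartic_smul, quartic_smul, quartic_rho_inv, quartic_rho_inv, shear, hE,
      sl2_smul, sl2_smul, quartic_normalForm_third, quartic_normalForm, quartic_fourthPower, hc]
    field_simp
    ring
  have hle := hN.hilbertDist_le hU hV hm hm
    (subset_closure (by
      have := rho_smul_mem_midCone E⁻¹ hc1
      rwa [smul_sub, rho_smul] at this))
    (subset_closure (by
      have := rho_smul_mem_midCone E⁻¹ hc2
      rwa [smul_sub, rho_smul] at this))
  have e1 : rho g⁻¹ • Projectivization.mk ℝ _ (hN.ne_zero ho) =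
      Projectivization.mk ℝ _ (hN.ne_zero hU) := by
    rw [smul_mk_rho]
    congr 1
  have e2 : Projectivization.mk ℝ _ (hN.ne_zero hy) =
      Projectivization.mk ℝ _ (hN.ne_zero hV) :=
    (Projectivization.mk_eq_mk_iff' _ _ _ _ _).2 ⟨_, hVe.symm⟩
  rw [e1, e2]
  exact hle

theorem isConical_irrational {ξ : ℝ} (hξ : Irrational ξ) :
    IsConical (projTrace midCone) quarticGroup (Projectivization.mk ℝ (fourthPower 1 (-ξ))
      (fourthPower_ne_zero (Or.inl one_ne_zero))) := by
  have hN := midCone_isSharpCone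
  obtain ⟨m, hm, hcomp⟩ := exists_compare
  choose g hg q q' ε η hnq happ using exists_isApproximant hξ
  refine ⟨fun n => rho (g n)⁻¹, fun n => rho_mem_quarticGroup (modularGroup.inv_mem (hg n)),
    Projectivization.mk ℝ _ (hN.ne_zero normalForm_third_mem), ⟨_, normalForm_third_mem, _, rfl⟩,
    Projectivization.mk ℝ _ (hN.ne_zero (shear_form_mem ξ)), ⟨_, shear_form_mem ξ, _, rfl⟩,
    |-(1 / 2) * Real.log (m * m)| + 1, by positivity, tendsto_of_isApproximant hnq happ,
    fun n => ?_⟩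
  have hs : 0 ≤ q n ^ 8 - 1 := sub_nonneg.2 (one_le_pow₀ (happ n).one_le)
  have hwc := fourthPower_mem_closure_midCone (a := 1) (b := -ξ) (Or.inl one_ne_zero)
  have hyN := hN.add_closure (shear_form_mem ξ) (hN.closure_smul' hs hwc)
  refine ⟨Projectivization.mk ℝ _ (hN.ne_zero hyN),
    ⟨hN.mk_add_smul_mem_seg (shear_form_mem ξ) hwc _ hs _, ?_⟩, ?_⟩
  · intro h
    rw [Set.mem_singleton_iff] at h
    exact fourthPower_notMem (a := 1) (b := -ξ) (Or.inl one_ne_zero) (h ▸ ⟨_, hyN, _, rfl⟩)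
  · have := hilbertDist_le_of_isApproximant hm hcomp (happ n) hyN
    linarith [le_abs_self (-(1 / 2) * Real.log (m * m))]

/-- The limit points are $[X^4]$ and the $[(tX+Y)^4]$; rational parameters belong to the orbit of
the cusp and irrational ones are conical. -/
theorem geomFiniteOnBoundary : GeomFiniteOnBoundary (projTrace midCone) quarticGroup := by
  intro x hx
  obtain ⟨a, b, hab, rfl⟩ := exists_fourthPower_of_mem_limitSet hx
  have hone : cusp = rho 1 • cusp := by rw [map_one, one_smul]
  rcases eq_cusp_or hab with h | ⟨t, ht⟩
  · right
    rw [h, hone]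
    exact isBoundedParabolic_smul_cusp modularGroup.one_mem
  · rw [ht]
    by_cases hirr : Irrational t
    · left
      have ht0 : t ≠ 0 := hirr.ne_zero
      -- The forms $tX+Y$ and $X+t^{-1}Y$ are proportional, so $\xi=-t^{-1}$.
      have hirr' : Irrational (-t⁻¹) := hirr.inv.neg
      have := isConical_irrational hirr'
      convert this using 1
      rw [Projectivization.mk_eq_mk_iff']
      refine ⟨t ^ 4, ?_⟩
      rw [← fourthPower_smul]
      congr 1
      · ring
      · field_simp
    · right
      simp only [Irrational, not_not] at hirr
      obtain ⟨r, rfl⟩ := hirr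
      obtain ⟨g, hg, h⟩ := exists_modularGroup_rat r
      have hd : (r.den : ℝ) ≠ 0 := by exact_mod_cast r.den_nz
      have := isBoundedParabolic_smul_cusp hg
      convert this using 1
      rw [cusp, smul_mk_rho, Projectivization.mk_eq_mk_iff']
      exact ⟨_, h.symm⟩

end HilbertGeom

namespace HilbertGeom

/-! ### The cusp is not conical -/

theorem IsSharpCone.exists_of_mem_seg {N : Set (Fin 5 → ℝ)} {f : Module.Dual ℝ (Fin 5 → ℝ)}
    (hN : IsSharpCone N f) {u w : Fin 5 → ℝ} (hu : u ∈ N) (hw : w ∈ closure N) (hw0 : w ≠ 0)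
    {y : Proj 5} (hy : y ∈ seg (projTrace N) (Projectivization.mk ℝ u (hN.ne_zero hu))
      (Projectivization.mk ℝ w hw0)) (hne : y ≠ Projectivization.mk ℝ w hw0) :
    ∃ s : ℝ, 0 ≤ s ∧ ∃ h : u + s • w ≠ 0, y = Projectivization.mk ℝ (u + s • w) h := by
  have main : ∀ g : Module.Dual ℝ (Fin 5 → ℝ), (∀ v ∈ closure N, v ≠ 0 → 0 < g v) → y ∈ chart g →
      coord g y ∈ segment ℝ (coord g (Projectivization.mk ℝ u (hN.ne_zero hu)))
        (coord g (Projectivization.mk ℝ w hw0)) →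
      ∃ s : ℝ, 0 ≤ s ∧ ∃ h : u + s • w ≠ 0, y = Projectivization.mk ℝ (u + s • w) h := by
    rintro g hg hyg ⟨a, b, ha, hb, hab, h⟩
    have h1 := hg u (subset_closure hu) (hN.ne_zero hu)
    have h2 := hg w hw hw0
    rw [coord_mk, coord_mk, smul_smul, smul_smul] at h
    rcases ha.eq_or_lt with ha0 | ha0
    · exfalso
      apply hne
      rw [← mk_coord hyg, Projectivization.mk_eq_mk_iff']
      refine ⟨b * (g w)⁻¹, ?_⟩
      rw [← h, ← ha0, zero_mul, zero_smul, zero_add]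
    · have hs : 0 ≤ b * (g w)⁻¹ * (g u / a) := by positivity
      have hmem := hN.add_closure hu (hN.closure_smul' hs hw)
      refine ⟨_, hs, hN.ne_zero hmem, ?_⟩
      conv_lhs => rw [← mk_coord hyg]
      rw [Projectivization.mk_eq_mk_iff']
      refine ⟨a * (g u)⁻¹, ?_⟩
      rw [← h, smul_add, smul_smul]
      congr 2
      field_simp
  obtain ⟨g, hg, hyg, h⟩ := hy
  rcases hN.chart_pos hg with hpos | hpos
  · exact main g hpos hyg h
  · refine main (-g) hpos (by rwa [chart_neg]) ?_
    obtain ⟨a, b, ha, hb, hab, h⟩ := h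
    refine ⟨a, b, ha, hb, hab, ?_⟩
    rw [coord_neg, coord_neg, coord_neg, ← h]
    module

/-- A ray to the cusp consists of forms $u+sX^4$: they dominate $u$ and all take the value `u 4` at
$(0,1)$. Orbit points at bounded distance inherit both bounds, so there are finitely many of them
and they cannot accumulate at the cusp. -/
theorem cusp_not_isConical : ¬ IsConical (projTrace midCone) quarticGroup cusp := by
  have hN := midCone_isSharpCone
  have hP := posCone_isSharpCone
  have hcl : closure midCone ⊆ closure posCone := closure_mono midCone_subset_posCone
  rintro ⟨γ, hγ, _, ⟨f, hf, hf0, rfl⟩, _, ⟨u, hu, hu0, rfl⟩, C, hC, hlim, hd⟩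
  obtain ⟨m, hm, hmu⟩ := exists_quartic_lower (midCone_subset_posCone hu)
  set K := u 4 / Real.exp (-(2 * C)) with hK
  set T : Set (Proj 5) := (fun g : SL(2, ℝ) => rho g • Projectivization.mk ℝ f hf0) ''
    {g : SL(2, ℝ) | g ∈ modularGroup ∧ ∃ μ : ℝ, 0 < μ ∧ μ * quartic (rho g • f) ![0, 1] ≤ K ∧
      ∀ x y : ℝ, m * (x ^ 2 + y ^ 2) ^ 2 ≤ μ * quartic (rho g • f) ![x, y]} with hT
  have hTfin : T.Finite := (finite_modularGroup_of_bounds (midCone_subset_posCone hf) hm K).image _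
  have hmem : ∀ n, γ n • Projectivization.mk ℝ f hf0 ∈ T := by
    intro n
    obtain ⟨g, hg, hgn⟩ := hγ n
    obtain ⟨y, ⟨hy, hyne⟩, hdy⟩ := hd n
    have hw0 := fourthPower_ne_zero (a := 1) (b := 0) (Or.inl one_ne_zero)
    have hwc := fourthPower_mem_closure_midCone (a := 1) (b := 0) (Or.inl one_ne_zero)
    obtain ⟨s, hs, h0, rfl⟩ := hN.exists_of_mem_seg hu hwc hw0 hy hyne
    have hv := hN.add_closure hu (hN.closure_smul' hs hwc)
    have hgf := rho_smul_mem_midCone g hf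
    rw [← hgn, smul_mk_rho] at hdy
    obtain ⟨a, b, ha, hb, h1, h2, hab⟩ := hN.exists_of_hilbertDist_le hgf hv hdy
    refine ⟨g, ⟨hg, a⁻¹, inv_pos.2 ha, ?_, fun x y => ?_⟩, by simp only [hgn]⟩
    -- The orbit form is rescaled by $1/a$. Its value at $(0,1)$ is at most $u_4/b$, and $ab\ge
    -- e^{-2C}$ turns this into the bound `K`.
    · have h3 := mem_closure_posCone.1 (hcl h2) ![0, 1]
      rw [quartic_sub, quartic_smul, quartic_add, quartic_smul, quartic_fourthPower,
        quartic_mk u] at h3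
      simp only [mul_zero, add_zero, zero_add, mul_one, one_pow, ne_eq,
        OfNat.ofNat_ne_zero, not_false_eq_true, zero_pow] at h3
      have hu4 := coeff_four_pos (midCone_subset_posCone hu)
      rw [hK, le_div_iff₀ (Real.exp_pos _), inv_mul_eq_div, div_mul_eq_mul_div, div_le_iff₀ ha]
      have hpos := mem_closure_posCone.1 (hcl (subset_closure hgf)) ![0, 1]
      calc quartic (rho g • f) ![0, 1] * Real.exp (-(2 * C))
          ≤ quartic (rho g • f) ![0, 1] * (a * b) := by gcongr
        _ = (b * quartic (rho g • f) ![0, 1]) * a := by ring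
        _ ≤ u 4 * a := by gcongr; linarith
    · have h3 := mem_closure_posCone.1 (hcl h1) ![x, y]
      rw [quartic_sub, quartic_smul, quartic_add, quartic_smul, quartic_fourthPower] at h3
      rw [inv_mul_eq_div, le_div_iff₀ ha]
      have h4 : 0 ≤ s * (1 * x + 0 * y) ^ 4 := by positivity
      nlinarith [hmu x y]
  have hcT : cusp ∈ T := hTfin.isClosed.mem_of_tendsto hlim (Filter.Eventually.of_forall hmem)
  obtain ⟨g, ⟨hg, -⟩, h⟩ := hcT
  apply fourthPower_notMem (a := 1) (b := 0) (Or.inl one_ne_zero)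
  change cusp ∈ _
  rw [← h]
  exact orb_subset ⟨f, hf, hf0, rfl⟩ ⟨_, rho_mem_quarticGroup hg, rfl⟩

/-! ### The cusp is not uniformly bounded parabolic -/

theorem cusp_submodule : cusp.submodule = Submodule.span ℝ {fourthPower 1 0} := by
  rw [cusp, Projectivization.submodule_mk]

/-- The coefficients of index at least `1`, as linear forms on the quotient by `X⁴`. -/
noncomputable def cuspCoord (i : Fin 4) : ((Fin 5 → ℝ) ⧸ cusp.submodule) →ₗ[ℝ] ℝ :=
  cusp.submodule.liftQ (LinearMap.proj i.succ) (by
    rw [cusp_submodule, Submodule.span_le, Set.singleton_subset_iff]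
    fin_cases i <;> simp [fourthPower])

theorem cuspCoord_mkQ (i : Fin 4) (v : Fin 5 → ℝ) :
    cuspCoord i (cusp.submodule.mkQ v) = v i.succ := rfl

theorem continuous_cuspCoord (i : Fin 4) : Continuous (cuspCoord i) :=
  continuous_coinduced_dom.2 (continuous_apply i.succ)

/-- The sets which exhaust the space of lines through the cusp that meet the domain; they are
preserved by the stabilizer of the cusp. -/
def cuspSet (m : ℕ) : Set (Pencil cusp) :=
  {l | 8 * cuspCoord 1 l.rep * cuspCoord 3 l.rep - 3 * cuspCoord 2 l.rep ^ 2 <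
    m * cuspCoord 3 l.rep ^ 2}

theorem mk_mem_cuspSet {m : ℕ} {Q : (Fin 5 → ℝ) ⧸ cusp.submodule} (hQ : Q ≠ 0) :
    Projectivization.mk ℝ Q hQ ∈ cuspSet m ↔
      8 * cuspCoord 1 Q * cuspCoord 3 Q - 3 * cuspCoord 2 Q ^ 2 < m * cuspCoord 3 Q ^ 2 := by
  obtain ⟨a, ha⟩ := Projectivization.exists_smul_eq_mk_rep ℝ Q hQ
  have ha' : (a : ℝ) • Q = (Projectivization.mk ℝ Q hQ).rep := ha
  have h0 : 0 < (a : ℝ) ^ 2 := by have := a.ne_zero; positivity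
  simp only [cuspSet, Set.mem_ofPred_eq, ← ha', map_smul, smul_eq_mul]
  generalize (a : ℝ) = a at h0
  generalize cuspCoord 1 Q = x, cuspCoord 2 Q = y, cuspCoord 3 Q = z
  rw [show 8 * (a * x) * (a * z) - 3 * (a * y) ^ 2 = a ^ 2 * (8 * x * z - 3 * y ^ 2) by ring,
    show m * (a * z) ^ 2 = a ^ 2 * (m * z ^ 2) by ring, mul_lt_mul_iff_right₀ h0]

theorem isOpen_cuspSet (m : ℕ) : IsOpen (cuspSet m) := by
  rw [isOpen_proj_iff]
  simp only [mk_mem_cuspSet]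
  have h1 := continuous_cuspCoord 1
  have h2 := continuous_cuspCoord 2
  have h3 := continuous_cuspCoord 3
  have hs : Continuous (Subtype.val : {v : (Fin 5 → ℝ) ⧸ cusp.submodule // v ≠ 0} → _) :=
    continuous_subtype_val
  exact isOpen_lt ((((h1.comp hs).const_mul 8 |>.mul (h3.comp hs))).sub
    (((h2.comp hs).pow 2).const_mul 3)) (((h3.comp hs).pow 2).const_mul _)

theorem mkQ_ne_zero_of_mk_ne {v : Fin 5 → ℝ} (hv : v ≠ 0)
    (h : Projectivization.mk ℝ v hv ≠ cusp) : cusp.submodule.mkQ v ≠ 0 := by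
  intro h0
  apply h
  have h1 : v ∈ cusp.submodule := by simpa using h0
  rw [cusp_submodule, Submodule.mem_span_singleton] at h1
  exact (Projectivization.mk_eq_mk_iff' _ _ _ _ _).2 h1

theorem line_mk {v : Fin 5 → ℝ} (hv : v ≠ 0) (h : Projectivization.mk ℝ v hv ≠ cusp) :
    line cusp (Projectivization.mk ℝ v hv) h =
      Projectivization.mk ℝ (cusp.submodule.mkQ v) (mkQ_ne_zero_of_mk_ne hv h) := by
  obtain ⟨a, ha⟩ := Projectivization.exists_smul_eq_mk_rep ℝ v hv
  have ha' : (a : ℝ) • v = (Projectivization.mk ℝ v hv).rep := ha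
  rw [line, Projectivization.mk_eq_mk_iff']
  exact ⟨a, by rw [← map_smul, ha']⟩

/-- On the domain the coefficient of $Y^4$ is positive, so the ratio defining the exhaustion is
finite. -/
theorem lines_subset_iUnion_cuspSet : lines cusp (projTrace midCone) ⊆ ⋃ m, cuspSet m := by
  rintro _ ⟨_, ⟨v, hv, hv0, rfl⟩, h, rfl⟩
  rw [line_mk, Set.mem_iUnion]
  have h4 : 0 < v 4 := coeff_four_pos (midCone_subset_posCone hv)
  obtain ⟨m, hm⟩ := exists_nat_gt ((8 * v 2 * v 4 - 3 * v 3 ^ 2) / v 4 ^ 2)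
  refine ⟨m, (mk_mem_cuspSet _).2 ?_⟩
  rw [cuspCoord_mkQ, cuspCoord_mkQ, cuspCoord_mkQ]
  rwa [div_lt_iff₀ (by positivity)] at hm

theorem cuspSet_mono : Monotone cuspSet := by
  intro m n hmn l hl
  have h1 : (m : ℝ) ≤ n := by exact_mod_cast hmn
  exact lt_of_lt_of_le hl (mul_le_mul_of_nonneg_right h1 (sq_nonneg _))

theorem pencilMap_mk {γ : SL(5, ℝ)} (hγ : γ • cusp = cusp) {v : Fin 5 → ℝ}
    (h : cusp.submodule.mkQ v ≠ 0) (h' : cusp.submodule.mkQ (γ • v) ≠ 0) :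
    pencilMap γ cusp hγ (Projectivization.mk ℝ _ h) = Projectivization.mk ℝ _ h' := rfl

/-- The stabilizer of the cusp consists of integral triangular matrices with diagonal entries
$\pm1$, and $(8v_2v_4-3v_3^2)/v_4^2$ is unchanged by them: it is, up to a factor, the second
coefficient after completing the fourth power. -/
theorem cuspSet_of_pencilMap {γ : SL(5, ℝ)} (hγm : γ ∈ quarticGroup) (hγ : γ • cusp = cusp)
    {v : Fin 5 → ℝ} (h : cusp.submodule.mkQ v ≠ 0) {m : ℕ}
    (hmem : pencilMap γ cusp hγ (Projectivization.mk ℝ _ h) ∈ cuspSet m) :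
    8 * v 2 * v 4 - 3 * v 3 ^ 2 < m * v 4 ^ 2 := by
  obtain ⟨g', hg', rfl⟩ := hγm
  obtain ⟨g, rfl⟩ : ∃ g, g' = g⁻¹ := ⟨g'⁻¹, by simp⟩
  have hg : g ∈ modularGroup := by simpa using modularGroup.inv_mem hg'
  -- The image of $X^4$ has $Y^4$-coefficient the fourth power of this entry, and it must be a
  -- multiple of $X^4$.
  have hb : g 0 1 = 0 := by
    have h1 := hγ
    rw [cusp, smul_mk_rho, Projectivization.mk_eq_mk_iff'] at h1
    obtain ⟨a, ha⟩ := h1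
    have h4 := congrFun ha 4
    rw [rho_inv_fourthPower] at h4
    simpa [fourthPower] using h4.symm
  have hdet := sl2_det g
  rw [hb, zero_mul, sub_zero] at hdet
  obtain ⟨p, hp⟩ := entry_of_mem_modularGroup hg 0 0
  obtain ⟨r, hr⟩ := entry_of_mem_modularGroup hg 1 1
  have hpr : p * r = 1 := by
    rw [hp, hr] at hdet
    exact_mod_cast hdet
  have hr1 : (r : ℝ) ^ 2 = 1 := by
    have : r ^ 2 = 1 := by
      rcases Int.isUnit_iff.1 (IsUnit.of_mul_eq_one_right p hpr) with h | h <;> rw [h] <;> norm_num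
    exact_mod_cast this
  have hp1 : (p : ℝ) ^ 2 = 1 := by
    have : p ^ 2 = 1 := by
      rcases Int.isUnit_iff.1 (IsUnit.of_mul_eq_one r hpr) with h | h <;> rw [h] <;> norm_num
    exact_mod_cast this
  have hne : cusp.submodule.mkQ (rho g⁻¹ • v) ≠ 0 := by
    intro h0
    apply h
    have h1 : rho g⁻¹ • v ∈ cusp.submodule := by simpa using h0
    have h2 : v ∈ cusp.submodule := by
      rw [← map_submodule_of_fix _ _ hγ] at h1
      obtain ⟨w, hw, hwv⟩ := h1
      have : w = v := smul_left_cancel (rho g⁻¹) hwv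
      rwa [← this]
    simpa using h2
  rw [pencilMap_mk hγ h hne, mk_mem_cuspSet, cuspCoord_mkQ, cuspCoord_mkQ, cuspCoord_mkQ,
    rho_inv_coeff, hb, hp, hr] at hmem
  have e2 : (substMatrix p 0 (g 1 0) r *ᵥ v) 2 =
      p ^ 2 * r ^ 2 * v 2 + 3 * p * g 1 0 * r ^ 2 * v 3 + 6 * g 1 0 ^ 2 * r ^ 2 * v 4 := by
    simp [substMatrix, Matrix.mulVec, dotProduct, Fin.sum_univ_five]
  have e3 : (substMatrix p 0 (g 1 0) r *ᵥ v) 3 = p * r ^ 3 * v 3 + 4 * g 1 0 * r ^ 3 * v 4 := by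
    simp [substMatrix, Matrix.mulVec, dotProduct, Fin.sum_univ_five]
  have e4 : (substMatrix p 0 (g 1 0) r *ᵥ v) 4 = r ^ 4 * v 4 := by
    simp [substMatrix, Matrix.mulVec, dotProduct, Fin.sum_univ_five]
  change 8 * (substMatrix p 0 (g 1 0) r *ᵥ v) 2 * (substMatrix p 0 (g 1 0) r *ᵥ v) 4 -
    3 * (substMatrix p 0 (g 1 0) r *ᵥ v) 3 ^ 2 < m * (substMatrix p 0 (g 1 0) r *ᵥ v) 4 ^ 2 at hmem
  rw [e2, e3, e4] at hmem
  have h1 : 8 * (p ^ 2 * r ^ 2 * v 2 + 3 * p * g 1 0 * r ^ 2 * v 3 + 6 * g 1 0 ^ 2 * r ^ 2 * v 4) *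
      (r ^ 4 * v 4) - 3 * (p * r ^ 3 * v 3 + 4 * g 1 0 * r ^ 3 * v 4) ^ 2 =
      (p : ℝ) ^ 2 * ((r : ℝ) ^ 2) ^ 3 * (8 * v 2 * v 4 - 3 * v 3 ^ 2) := by ring
  have h2 : (m : ℝ) * (r ^ 4 * v 4) ^ 2 = ((r : ℝ) ^ 2) ^ 4 * (m * v 4 ^ 2) := by ring
  rw [h1, h2, hr1, hp1] at hmem
  simpa using hmem

/-- The catalecticant is $N^4z_0^2+N^2z_1^2+(z_2+N^2z_0)^2$. The leading coefficient $2N^4$ instead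
of $N^4$ makes it definite; the change only moves the point along its line through the cusp. -/
theorem midpoint_form_mem (N : ℕ) (hN : 0 < N) :
    ![2 * (N : ℝ) ^ 4, 0, 6 * (N : ℝ) ^ 2, 0, 1] ∈ midCone := by
  have hN' : (0 : ℝ) < N := by exact_mod_cast hN
  have key : ∀ z, z ≠ 0 → 0 < pencilForm ![2 * (N : ℝ) ^ 4, 0, 6 * (N : ℝ) ^ 2, 0, 1] 0 z := by
    intro z hz
    have he : pencilForm ![2 * (N : ℝ) ^ 4, 0, 6 * (N : ℝ) ^ 2, 0, 1] 0 z =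
        (N : ℝ) ^ 4 * z 0 ^ 2 + N ^ 2 * z 1 ^ 2 + (z 2 + N ^ 2 * z 0) ^ 2 := by
      simp [pencilForm]
      ring
    rw [he]
    by_contra! hle
    have h1 : 0 ≤ (N : ℝ) ^ 4 * z 0 ^ 2 := by positivity
    have h2 : 0 ≤ (N : ℝ) ^ 2 * z 1 ^ 2 := by positivity
    have h3 := sq_nonneg (z 2 + N ^ 2 * z 0)
    have e1 : z 0 = 0 := by
      have : (N : ℝ) ^ 4 * z 0 ^ 2 = 0 := by linarith
      simpa [hN'.ne'] using this
    have e2 : z 1 = 0 := by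
      have : (N : ℝ) ^ 2 * z 1 ^ 2 = 0 := by linarith
      simpa [hN'.ne'] using this
    have e3 : z 2 = 0 := by
      have : (z 2 + N ^ 2 * z 0) ^ 2 = 0 := by linarith
      simpa [e1] using this
    apply hz
    rw [vec3_eta z, e1, e2, e3]
    simp
  exact ⟨0, key, by simpa using key⟩

/-- The midpoint of $(NX+Y)^4$ and $(-NX+Y)^4$ is $N^4X^4+6N^2X^2Y^2+Y^4$. It lies in the hull, and
it is congruent modulo $X^4$ to a form in the domain. -/
theorem midpoint_mem_limitLines (N : ℕ) (hN : 0 < N) :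
    ∃ h : cusp.submodule.mkQ ![2 * (N : ℝ) ^ 4, 0, 6 * (N : ℝ) ^ 2, 0, 1] ≠ 0,
      Projectivization.mk ℝ _ h ∈ limitLines (projTrace midCone) quarticGroup cusp := by
  have hS := midCone_isSharpCone
  set v : Fin 5 → ℝ := ![2 * (N : ℝ) ^ 4, 0, 6 * (N : ℝ) ^ 2, 0, 1] with hv
  set w : Fin 5 → ℝ := ![(N : ℝ) ^ 4, 0, 6 * (N : ℝ) ^ 2, 0, 1] with hw
  have hvm := midpoint_form_mem N hN
  have hv0 : v ≠ 0 := hS.ne_zero hvm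
  have hw0 : w ≠ 0 := fun h => by
    have := congrFun h 4
    simp [hw] at this
  have hvq : ∀ {u : Fin 5 → ℝ} (hu : u ≠ 0), u 4 = 1 → Projectivization.mk ℝ u hu ≠ cusp := by
    intro u hu h4 h
    obtain ⟨a, ha⟩ := (Projectivization.mk_eq_mk_iff' _ _ _ _ _).1 h
    have := congrFun ha 4
    simp [fourthPower, h4] at this
  have hvc := hvq hv0 (by simp [hv])
  have hwc := hvq hw0 (by simp [hw])
  refine ⟨mkQ_ne_zero_of_mk_ne hv0 hvc, subset_closure ?_, ?_⟩
  · refine ⟨Projectivization.mk ℝ w hw0, ?_, hwc, ?_⟩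
    -- Both endpoints and the midpoint have the same `meanForm`, so the vector midpoint is also the
    -- midpoint in the chart.
    · have hmean : ∀ t : ℝ, t ^ 2 = (N : ℝ) ^ 2 →
          meanForm (fourthPower t 1) = 3 * (N : ℝ) ^ 4 + 6 * N ^ 2 + 3 := by
        intro t ht
        rw [meanForm_apply]
        simp only [fourthPower, Matrix.cons_val]
        have : t ^ 4 = (N : ℝ) ^ 4 := by
          rw [show t ^ 4 = (t ^ 2) ^ 2 by ring, ht]; ring
        rw [this, ht]
        ring
      have hmw : meanForm w = 3 * (N : ℝ) ^ 4 + 6 * N ^ 2 + 3 := by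
        rw [meanForm_apply]
        simp [hw]
      have hpos : (0 : ℝ) < 3 * (N : ℝ) ^ 4 + 6 * N ^ 2 + 3 := by positivity
      refine ⟨meanForm, hS.chart_subset, (mk_mem_chart hw0).2 (by rw [hmw]; exact hpos.ne'), ?_⟩
      have hmem : ∀ t : ℝ, coord meanForm (Projectivization.mk ℝ (fourthPower t 1)
          (fourthPower_ne_zero (Or.inr one_ne_zero))) ∈ convexHull ℝ
            (coord meanForm '' (limitSet (projTrace midCone) quarticGroup \ {cusp})) := fun t =>
        subset_convexHull _ _ ⟨_, ⟨fourthPower_mem_limitSet (Or.inr one_ne_zero),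
          mk_fourthPower_ne_cusp t⟩, rfl⟩
      have hconv := convex_convexHull ℝ
        (coord meanForm '' (limitSet (projTrace midCone) quarticGroup \ {cusp}))
        (hmem N) (hmem (-N)) (by norm_num : (0 : ℝ) ≤ 1 / 2) (by norm_num : (0 : ℝ) ≤ 1 / 2)
        (by norm_num)
      convert hconv using 1
      rw [coord_mk, coord_mk, coord_mk, hmw, hmean N rfl, hmean (-N) (by ring)]
      ext i
      fin_cases i <;> simp [hw, fourthPower] <;> ring
    · rw [line_mk]
      congr 1
      rw [← sub_eq_zero, ← map_sub]
      have : v - w ∈ cusp.submodule := by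
        rw [cusp_submodule, Submodule.mem_span_singleton]
        refine ⟨(N : ℝ) ^ 4, ?_⟩
        ext i
        fin_cases i <;> simp [hv, hw, fourthPower]
        ring
      exact (Submodule.Quotient.mk_eq_zero _).2 this
  · exact ⟨_, ⟨v, hvm, hv0, rfl⟩, hvc, (line_mk hv0 hvc).symm⟩

/-- A compact `K` lies in one set of the open exhaustion, and so do all lines that the stabilizer
can move into `K`; the midpoints, where the invariant is $48N^2$, leave every such set. -/
theorem cusp_not_isUniformlyBoundedParabolic :
    ¬ IsUniformlyBoundedParabolic (projTrace midCone) quarticGroup cusp := by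
  rintro ⟨K, hK, hKc, h⟩
  obtain ⟨m, hm⟩ := hKc.elim_directed_cover cuspSet isOpen_cuspSet
    (fun l hl => lines_subset_iUnion_cuspSet (hK hl).2) cuspSet_mono.directed_le
  obtain ⟨hne, hmem⟩ := midpoint_mem_limitLines (m + 1) m.succ_pos
  obtain ⟨γ, hγ, hγc, hl⟩ := h _ hmem
  have := cuspSet_of_pencilMap hγ hγc hne (hm hl)
  simp at this
  nlinarith [(Nat.cast_nonneg m : (0 : ℝ) ≤ m)]

theorem not_geomFinite : ¬ GeomFinite (projTrace midCone) quarticGroup := fun h =>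
  (h cusp (fourthPower_mem_limitSet (Or.inl one_ne_zero))).elim cusp_not_isConical
    cusp_not_isUniformlyBoundedParabolic

end HilbertGeom

/-! ### The domain and the group -/

theorem proposition10p5 :
    ∃ (Ω : Set (HilbertGeom.Proj 5)) (Γ : Subgroup SL(5, ℝ)),
      HilbertGeom.IsProperlyConvexOpen Ω ∧
      HilbertGeom.IsStrictlyConvex Ω ∧
      HilbertGeom.HasC1Boundary Ω ∧
      Γ ≤ HilbertGeom.Aut Ω ∧
      DiscreteTopology Γ ∧
      HilbertGeom.GeomFiniteOnBoundary Ω Γ ∧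
      ¬ HilbertGeom.GeomFinite Ω Γ ∧
      HilbertGeom.rho.range ≤ HilbertGeom.Aut Ω ∧
      (∃ r : ℝ, 0 < r ∧ Ω = HilbertGeom.omega r) ∧
      ∃ Γ₀ : Subgroup SL(2, ℝ),
        HilbertGeom.IsLatticeSL2 Γ₀ ∧ ¬ HilbertGeom.IsCocompactSL2 Γ₀ ∧
        Γ = Γ₀.map HilbertGeom.rho := by
  open HilbertGeom in
  exact ⟨projTrace midCone, quarticGroup, midCone_isSharpCone.isProperlyConvexOpen,
    midCone_isStrictlyConvex, midCone_hasC1Boundary, quarticGroup_le_aut, inferInstance,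
    geomFiniteOnBoundary, not_geomFinite, range_rho_le_aut,
    ⟨Real.log (5 / 2) / 2, half_pos (Real.log_pos (by norm_num)), omega_eq.symm⟩,
    modularGroup, modularGroup_isLattice, modularGroup_not_cocompact, rfl⟩
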